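/- Let $V$ be a finite dimensional complex vector space with a rational structure $V_{\mathbb Q}$ (so $V=V_{\mathbb Q}\otimes\mathbb C$), a finite increasing filtration $W$ of $V$ defined over $\mathbb Q$, and rational non-degenerate bilinear forms $\mathcal S_k$ of parity $(-1)^k$ on $Gr^W_k=W_k/W_{k-1}$; let $\{h^{p,q}\}$ be a partition of $\dim V$ into non-negative integers. Let $\mathcal M$ be the classifying space of all (finite decreasing) filtrations $F$ of $V$ such that $(F,W)$ is a mixed Hodge structure, each $Gr^W_k$ is polarized by $\mathcal S_k$, and $\dim I^{p,q}_{(F,W)}=h^{p,q}$. Here $V=\bigoplus_{p,q} I^{p,q}_{(F,W)}$ is Deligne's bigrading, i.e. the unique bigrading with $F^p=\bigoplus_{r\ge p,s}I^{r,s}$, $W_k=\bigoplus_{r+s\le k}I^{r,s}$ and $I^{p,q}=\overline{I^{q,p}}$ modulo $\bigoplus_{r<p,s<q}I^{r,s}$. Let $\check{\mathcal M}\supseteq\mathcal M$ be the set of all filtrations $F$ with $\dim F^p=\sum_{r\ge p,s}h^{r,s}$, $\dim F^pGr^W_k=\sum_{r\ge p}h^{r,k-r}$ and $\mathcal S_k(F^pGr^W_k,F^{k-p+1}Gr^W_k)=0$.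 The topology and complex structure of $\mathcal M$ are those induced from the flag variety $\{F\mid \dim F^p=\sum_{r\geq p,s}h^{r,s}\}$. Let $G_{\mathbb C}$ be the group of $g\in GL(V)$ that preserve $W$ and act on each $Gr^W_k$ by an isometry of $\mathcal S_k$. For $F\in\mathcal M$ put $$\mathfrak g^{r,s}=\{\alpha\in Lie(G_{\mathbb C})\mid \alpha(I^{p,q}_{(F,W)})\subseteq I^{p+r,q+s}_{(F,W)}\ \ \forall\,p,q\},\qquad q_F=\sum_{r<0,\,r+s\le 0}\mathfrak g^{r,s}.$$ Then, for every $F\in\mathcal M$: 1. The sum of the $\mathfrak g^{r,s}$ is direct (so $q_F=\bigoplus_{r<0,\,r+s\le0}\mathfrak g^{r,s}$), and $q_F$ is a nilpotent Lie subalgebra of $Lie(G_{\mathbb C})$. 2. The map $u\mapsto \exp(u).F$ sends $q_F$ into $\check{\mathcal M}$ and restricts to a biholomorphism from a neighborhood of $0$ in $q_F$ onto a neighborhood of $F$ in $\mathcal M$. 3. The map $q_F\to T_F(\mathcal M)$ that sends $u$ to the derivation $\zeta\mapsto \frac{d}{dt}\zeta(\exp(tu).F)|_{t=0}$ is a $\mathbb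 C$-linear isomorphism. 4. If $\Phi:S\to\mathcal M$ is a holomorphic map from a complex manifold that is horizontal (derivatives of local holomorphic sections of the bundle with fibers $\Phi(s)^p$ lie in $\Phi(s)^{p-1}$, for all $p$), and $\Phi(s)=F$, then under the isomorphism of part 3 the derivative $\Phi_*:T_s(S)\to T_F(\mathcal M)$ takes values in $\bigoplus_{k\le1}\mathfrak g^{-1,k}$. -/

import Mathlib

open scoped Topology Manifold ContDiff TensorProduct

noncomputable section

/-- A decreasing filtration `⋯ ⊇ F^p ⊇ F^{p+1} ⊇ ⋯` of `V` by complex subspaces. -/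
@[ext]
structure DecFiltration (V : Type*) [AddCommGroup V] [Module ℂ V] where
  toFun : ℤ → Submodule ℂ V
  antitone' : Antitone toFun

namespace DecFiltration

instance {V : Type*} [AddCommGroup V] [Module ℂ V] :
    CoeFun (DecFiltration V) (fun _ => ℤ → Submodule ℂ V) := ⟨toFun⟩

variable {V : Type*} [NormedAddCommGroup V] [NormedSpace ℂ V]

/-- The filtration `A.F`, with `(A.F)^p = A(F^p)`. For `A ∈ GL(V)` this is the usual action. -/
def map (A : V →L[ℂ] V) (F : DecFiltration V) : DecFiltration V where
  toFun p := (F p).map (A : V →ₗ[ℂ] V)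
  antitone' _ _ h := Submodule.map_mono (F.antitone' h)

/-- The set of filtrations of `V` is the disjoint union of the `GL(V)`-orbits, which are the flag
varieties `{F | dim F^p = f^p}`. Each of them gets the topology of the homogeneous space
`GL(V) / Stab(F)`: a set `O` is open iff `{g ∈ GL(V) | g.F ∈ O}` is open for every `F`. -/
instance : TopologicalSpace (DecFiltration V) :=
  ⨆ F : DecFiltration V,
    TopologicalSpace.coinduced (fun g : (V →L[ℂ] V)ˣ => F.map (g : V →L[ℂ] V)) inferInstance

/-- A function `ζ` defined near `F` on the flag variety `GL(V) / Stab(F)` is holomorphic near `F`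
iff its pullback `g ↦ ζ (g.F)` is holomorphic near `1 ∈ GL(V)` (an open subset of `End(V)`). -/
def HolomorphicAt {E : Type*} [NormedAddCommGroup E] [NormedSpace ℂ E]
    (ζ : DecFiltration V → E) (F : DecFiltration V) : Prop :=
  AnalyticAt ℂ (fun A : V →L[ℂ] V => ζ (F.map A)) 1

/-- Let `X` be a (locally closed) complex submanifold of the flag variety and `F ∈ X`. A function
`ζ` on `X` is holomorphic near `F` iff near `F` it is the restriction to `X` of a holomorphic
function on the flag variety. The values of `ζ` outside `X` are irrelevant. -/
def HolomorphicOnAt {E : Type*} [NormedAddCommGroup E] [NormedSpace ℂ E]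
    (X : Set (DecFiltration V)) (ζ : DecFiltration V → E) (F : DecFiltration V) : Prop :=
  ∃ ζ' : DecFiltration V → E, HolomorphicAt ζ' F ∧ ∀ᶠ F' in 𝓝[X] F, ζ F' = ζ' F'

/-- A map `Φ` from (an open subset of) a complex manifold `S` to `X` is holomorphic near `s`: it is
continuous at `s`, takes values in `X` near `s`, and pulls back holomorphic functions on `X` near
`Φ s` to holomorphic functions on `S` near `s`. -/
def HolomorphicMapAt (E : Type*) [NormedAddCommGroup E] [NormedSpace ℂ E]
    {S : Type*} [TopologicalSpace S] [ChartedSpace E S]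
    (X : Set (DecFiltration V)) (Φ : S → DecFiltration V) (s : S) : Prop :=
  ContinuousAt Φ s ∧ (∀ᶠ s' in 𝓝 s, Φ s' ∈ X) ∧
    ∀ ζ : DecFiltration V → ℂ, HolomorphicOnAt X ζ (Φ s) →
      ContMDiffAt 𝓘(ℂ, E) 𝓘(ℂ, ℂ) ω (fun s' => ζ (Φ s')) s

/-- `φ` restricts to a biholomorphism from the open subset `U` of the complex vector space `E`
onto the relatively open subset `N ∩ X` of `X` (with `N` open in the flag variety). -/
def IsBiholomorphicOn {E : Type*} [NormedAddCommGroup E] [NormedSpace ℂ E]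
    (X : Set (DecFiltration V)) (φ : E → DecFiltration V)
    (U : Set E) (N : Set (DecFiltration V)) : Prop :=
  IsOpen U ∧ IsOpen N ∧ Set.BijOn φ U (N ∩ X) ∧ (∀ u ∈ U, HolomorphicMapAt E X φ u) ∧
    ∃ ψ : DecFiltration V → E, Set.InvOn ψ φ U (N ∩ X) ∧ ContinuousOn ψ (N ∩ X) ∧
      ∀ F ∈ N ∩ X, HolomorphicOnAt X ψ F

/-- A map `Φ` from a complex manifold to a space of filtrations is horizontal iff
`∂F^p/∂s_j ⊆ F^{p-1}`: the derivatives at `s` of a local holomorphic section `σ` of the bundle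
`F^p(s') := (Φ s')^p` lie in `F^{p-1}(s)`. -/
def IsHorizontal (E : Type*) [NormedAddCommGroup E] [NormedSpace ℂ E]
    {S : Type*} [TopologicalSpace S] [ChartedSpace E S] (Φ : S → DecFiltration V) : Prop :=
  ∀ (s : S) (p : ℤ) (σ : S → V), ContMDiffAt 𝓘(ℂ, E) 𝓘(ℂ, V) ω σ s →
    (∀ᶠ s' in 𝓝 s, σ s' ∈ Φ s' p) →
      ∀ v : TangentSpace 𝓘(ℂ, E) s, (mfderiv 𝓘(ℂ, E) 𝓘(ℂ, V) σ s v : V) ∈ Φ s (p - 1)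

/-- The algebra of functions that are holomorphic on `X` near `F`. -/
def holomorphicFunctions (X : Set (DecFiltration V)) (F : DecFiltration V) :
    Subalgebra ℂ (DecFiltration V → ℂ) where
  carrier := {ζ | HolomorphicOnAt X ζ F}
  mul_mem' := by
    rintro a b ⟨a', ha, ha'⟩ ⟨b', hb, hb'⟩
    refine ⟨a' * b', AnalyticAt.mul ha hb, ?_⟩
    filter_upwards [ha', hb'] with x h1 h2
    simp [h1, h2]
  add_mem' := by
    rintro a b ⟨a', ha, ha'⟩ ⟨b', hb, hb'⟩
    refine ⟨a' + b', AnalyticAt.add ha hb, ?_⟩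
    filter_upwards [ha', hb'] with x h1 h2
    simp [h1, h2]
  algebraMap_mem' c := ⟨fun _ => c, analyticAt_const, Filter.Eventually.of_forall fun _ => rfl⟩

/-- The holomorphic tangent space `T_F(X)`: the `ℂ`-linear derivations at `F` of the holomorphic
functions on `X` near `F`. (The Leibniz rule, applied to a product of `ζ` with the indicator
function of a neighborhood, shows that a derivation depends on the germ of `ζ|_X` at `F` only.) -/
def tangentSpaceAt (X : Set (DecFiltration V)) (F : DecFiltration V) :
    Submodule ℂ (Module.Dual ℂ (holomorphicFunctions X F)) where
  carrier := {δ | ∀ ζ η : holomorphicFunctions X F,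
    δ (ζ * η) = ζ.1 F * δ η + η.1 F * δ ζ}
  add_mem' := by
    intro a b ha hb ζ η
    simp only [LinearMap.add_apply, ha ζ η, hb ζ η]
    ring
  zero_mem' := by
    intro ζ η
    simp
  smul_mem' := by
    intro c a ha ζ η
    simp only [LinearMap.smul_apply, ha ζ η, smul_eq_mul]
    ring

end DecFiltration

section Pure

variable {H : Type*} [AddCommGroup H] [Module ℂ H]

/-- A finite decreasing filtration `F` of a complex vector space `H` with conjugation `c` is a pure
Hodge structure of weight `k`: `H = F^p ⊕ conj(F^{k-p+1})` for all `p`. -/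
def IsPureHodge (c : H →ₛₗ[starRingEnd ℂ] H) (k : ℤ) (F : ℤ → Submodule ℂ H) : Prop :=
  Antitone F ∧ (∃ p, F p = ⊤) ∧ (∃ p, F p = ⊥) ∧ ∀ p, IsCompl (F p) ((F (k - p + 1)).map c)

/-- `H^{p,q} = F^p ∩ conj(F^q)` -/
def hodgePiece (c : H →ₛₗ[starRingEnd ℂ] H) (F : ℤ → Submodule ℂ H) (p q : ℤ) :
    Submodule ℂ H :=
  F p ⊓ (F q).map c

/-- The Riemann bilinear relations for a Hodge structure of weight `k`: `Q(F^p, F^{k-p+1}) = 0`, and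
`i^{p-q} Q(u, conj u) > 0` for all nonzero `u ∈ H^{p,q}`, `p + q = k`. -/
def IsPolarizedBy (c : H →ₛₗ[starRingEnd ℂ] H) (k : ℤ) (F : ℤ → Submodule ℂ H)
    (Q : LinearMap.BilinForm ℂ H) : Prop :=
  (∀ p, ∀ u ∈ F p, ∀ v ∈ F (k - p + 1), Q u v = 0) ∧
    ∀ p q, p + q = k → ∀ u ∈ hodgePiece c F p q, u ≠ 0 →
      (Complex.I ^ (p - q) * Q u (c u)).im = 0 ∧ 0 < (Complex.I ^ (p - q) * Q u (c u)).re

end Pure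

/-- The graded piece `Gr^W_k = W_k / W_{k-1}`. -/
abbrev GrW {V : Type*} [AddCommGroup V] [Module ℂ V] (W : ℤ → Submodule ℂ V) (k : ℤ) : Type _ :=
  ↥(W k) ⧸ (W (k - 1)).submoduleOf (W k)

/-- The class in `Gr^W_k` of an element of `W_k`. -/
abbrev GrW.mk {V : Type*} [AddCommGroup V] [Module ℂ V] (W : ℤ → Submodule ℂ V) (k : ℤ) :
    ↥(W k) →ₗ[ℂ] GrW W k :=
  ((W (k - 1)).submoduleOf (W k)).mkQ

/-- The data that define a classifying space of graded-polarized mixed Hodge structures on `V`. -/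
structure GradedPolarizationData (V : Type*) [AddCommGroup V] [Module ℂ V] [Module ℚ V] where
  /-- the rational structure `V_ℚ` of `V` -/
  VQ : Submodule ℚ V
  /-- `ℂ ⊗ V_ℚ → V` is an isomorphism -/
  isBaseChange : IsBaseChange ℂ VQ.subtype
  /-- the weight filtration: finite, increasing, and defined over `ℚ` -/
  W : ℤ → Submodule ℂ V
  W_mono : Monotone W
  W_bot : ∃ k, W k = ⊥
  W_top : ∃ k, W k = ⊤
  W_rational : ∀ k, Submodule.span ℂ {x | x ∈ VQ ∧ x ∈ W k} = W k
  /-- the rational, non-degenerate bilinear forms of parity `(-1)^k` on `Gr^W_k` -/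
  S : ∀ k, LinearMap.BilinForm ℂ (GrW W k)
  S_rational : ∀ k (x y : W k), (x : V) ∈ VQ → (y : V) ∈ VQ →
    ∃ r : ℚ, S k (GrW.mk W k x) (GrW.mk W k y) = r
  S_nondegenerate : ∀ k, (S k).Nondegenerate
  S_parity : ∀ k x y, S k x y = (-1 : ℂ) ^ k * S k y x
  /-- the Hodge numbers `h^{p,q}`, a partition of `dim V` -/
  h : (ℤ × ℤ) →₀ ℕ
  h_sum : (h.sum fun _ n => n) = Module.finrank ℂ V

namespace GradedPolarizationData

section Conj

variable {V : Type*} [AddCommGroup V] [Module ℂ V] [Module ℚ V] (D : GradedPolarizationData V)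

/-- Complex conjugation of the first factor of `ℂ ⊗ V_ℚ`. -/
def conjTensor : ℂ ⊗[ℚ] D.VQ →ₗ[ℚ] ℂ ⊗[ℚ] D.VQ :=
  LinearMap.rTensor D.VQ (Complex.conjAe.toLinearMap.restrictScalars ℚ)

/-- The complex conjugation of `V = ℂ ⊗ V_ℚ`. -/
def conj : V →ₛₗ[starRingEnd ℂ] V where
  toFun x := D.isBaseChange.equiv (D.conjTensor (D.isBaseChange.equiv.symm x))
  map_add' x y := by simp
  map_smul' c x := by
    have key : ∀ t : ℂ ⊗[ℚ] D.VQ,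
        D.conjTensor (c • t) = (starRingEnd ℂ) c • D.conjTensor t := by
      intro t
      induction t with
      | zero => simp
      | tmul a b => simp [conjTensor, TensorProduct.smul_tmul']
      | add a b ha hb => simp only [smul_add, map_add, ha, hb]
    simp only [map_smul, key]

theorem conj_smul_rational (c : ℂ) {x : V} (hx : x ∈ D.VQ) :
    D.conj (c • x) = (starRingEnd ℂ) c • x := by
  have e : D.isBaseChange.equiv.symm x = (1 : ℂ) ⊗ₜ ⟨x, hx⟩ := by
    simp [LinearEquiv.symm_apply_eq, IsBaseChange.equiv_tmul]
  rw [LinearMap.map_smulₛₗ]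
  congr 1
  change D.isBaseChange.equiv (D.conjTensor (D.isBaseChange.equiv.symm x)) = x
  simp [e, conjTensor, IsBaseChange.equiv_tmul]

theorem conj_mem_W (k : ℤ) : ∀ x ∈ D.W k, D.conj x ∈ D.W k := by
  intro x hx
  have h2 : Submodule.span ℂ {x | x ∈ D.VQ ∧ x ∈ D.W k} ≤ (D.W k).comap D.conj := by
    rw [Submodule.span_le]
    rintro y ⟨hy, hy'⟩
    have := D.conj_smul_rational 1 hy
    simp only [one_smul, map_one] at this
    simpa [this] using hy'
  rw [D.W_rational k] at h2
  exact h2 hx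

/-- The complex conjugation of `Gr^W_k`. -/
def grConj (k : ℤ) : GrW D.W k →ₛₗ[starRingEnd ℂ] GrW D.W k :=
  Submodule.mapQ _ _ (D.conj.restrict (D.conj_mem_W k)) (by
    intro x hx
    exact D.conj_mem_W (k - 1) _ hx)

/-- The filtration `F^p Gr^W_k = (F^p ∩ W_k + W_{k-1}) / W_{k-1}` induced by `F` on `Gr^W_k`. -/
def grF (F : DecFiltration V) (k p : ℤ) : Submodule ℂ (GrW D.W k) :=
  ((F p).submoduleOf (D.W k)).map (GrW.mk D.W k)

/-- `(F, W)` is a mixed Hodge structure. -/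
def IsMixedHodge (F : DecFiltration V) : Prop :=
  (∃ p, F p = ⊤) ∧ (∃ p, F p = ⊥) ∧ ∀ k, IsPureHodge (D.grConj k) k (D.grF F k)

/-- The direct sum decomposition `V = ⊕ I^{p,q}` is a bigrading of `(F, W)`, that is,
`F^p = ⊕_{r ≥ p} I^{r,s}` and `W_k = ⊕_{r+s ≤ k} I^{r,s}`, and has the additional property
`I^{p,q} = conj(I^{q,p})` modulo `⊕_{r<p,s<q} I^{r,s}`. -/
structure IsDeligneBigrading (F : DecFiltration V) (I : ℤ → ℤ → Submodule ℂ V) : Prop where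
  isInternal : DirectSum.IsInternal fun pq : ℤ × ℤ => I pq.1 pq.2
  hodge : ∀ p, F p = ⨆ (r : ℤ) (s : ℤ) (_ : p ≤ r), I r s
  weight : ∀ k, D.W k = ⨆ (r : ℤ) (s : ℤ) (_ : r + s ≤ k), I r s
  conj : ∀ p q, I p q ⊔ (⨆ (r : ℤ) (s : ℤ) (_ : r < p) (_ : s < q), I r s) =
    (I q p).map D.conj ⊔ ⨆ (r : ℤ) (s : ℤ) (_ : r < p) (_ : s < q), I r s

/-- Deligne's bigrading `I^{p,q}_{(F,W)}`, the unique one with the preceding properties (a mixed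
Hodge structure has exactly one). -/
def I (F : DecFiltration V) : ℤ → ℤ → Submodule ℂ V :=
  Classical.epsilon (D.IsDeligneBigrading F)

/-- The classifying space `M` of all mixed Hodge structures `(F, W)` that are graded-polarized by
`S` and satisfy `dim I^{p,q} = h^{p,q}`. -/
def M : Set (DecFiltration V) :=
  {F | D.IsMixedHodge F ∧ (∀ k, IsPolarizedBy (D.grConj k) k (D.grF F k) (D.S k)) ∧
    ∀ p q, Module.finrank ℂ (D.I F p q) = D.h (p, q)}

/-- The compact dual `M̌`: all filtrations with `dim F^p = f^p` and `dim F^p Gr^W_k = f^p_k` that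
satisfy the first Riemann bilinear relation. -/
def compactDual : Set (DecFiltration V) :=
  {F | (∀ p, Module.finrank ℂ (F p) = ∑ rs ∈ D.h.support with p ≤ rs.1, D.h rs) ∧
    (∀ k p, Module.finrank ℂ (D.grF F k p) =
      ∑ rs ∈ D.h.support with p ≤ rs.1 ∧ rs.1 + rs.2 = k, D.h rs) ∧
    ∀ k p, ∀ u ∈ D.grF F k p, ∀ v ∈ D.grF F k (k - p + 1), D.S k u v = 0}

end Conj

variable {V : Type*} [NormedAddCommGroup V] [NormedSpace ℂ V] [Module ℚ V]
  (D : GradedPolarizationData V)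

/-- The Lie algebra of `G_ℂ = {g ∈ GL(V)^W | Gr(g) ∈ Aut_ℂ(S)}`: the endomorphisms of `V` that
preserve `W` and act on each `Gr^W_k` by an infinitesimal isometry of `S_k`. -/
def lieGC : Submodule ℂ (V →L[ℂ] V) where
  carrier := {α | ∃ hα : ∀ k, ∀ x ∈ D.W k, α x ∈ D.W k, ∀ k (x y : D.W k),
    D.S k (GrW.mk D.W k ⟨α x, hα k x x.2⟩) (GrW.mk D.W k y) +
      D.S k (GrW.mk D.W k x) (GrW.mk D.W k ⟨α y, hα k y y.2⟩) = 0}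
  add_mem' := by
    rintro a b ⟨ha, ha'⟩ ⟨hb, hb'⟩
    refine ⟨fun k x hx => (D.W k).add_mem (ha k x hx) (hb k x hx), fun k x y => ?_⟩
    have e : ∀ z : D.W k, GrW.mk D.W k ⟨(a + b) z, (D.W k).add_mem (ha k z z.2) (hb k z z.2)⟩ =
        GrW.mk D.W k ⟨a z, ha k z z.2⟩ + GrW.mk D.W k ⟨b z, hb k z z.2⟩ := by
      intro z
      rw [← map_add]
      rfl
    rw [e, e]
    simp only [map_add, LinearMap.add_apply]
    linear_combination ha' k x y + hb' k x y
  zero_mem' := by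
    refine ⟨fun k x _ => by simp, fun k x y => ?_⟩
    have e : ∀ z : D.W k, GrW.mk D.W k ⟨(0 : V →L[ℂ] V) z, by simp⟩ = 0 := by
      intro z
      rw [← map_zero (GrW.mk D.W k)]
      rfl
    rw [e, e]
    simp
  smul_mem' := by
    rintro c a ⟨ha, ha'⟩
    refine ⟨fun k x hx => (D.W k).smul_mem c (ha k x hx), fun k x y => ?_⟩
    have e : ∀ z : D.W k, GrW.mk D.W k ⟨(c • a) z, (D.W k).smul_mem c (ha k z z.2)⟩ =
        c • GrW.mk D.W k ⟨a z, ha k z z.2⟩ := by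
      intro z
      rw [← map_smul]
      rfl
    rw [e, e]
    simp only [map_smul, LinearMap.smul_apply, smul_eq_mul]
    linear_combination c * ha' k x y

/-- `gl(V)^{r,s} = {α | α(I^{p,q}) ⊆ I^{p+r,q+s} for all p, q}` -/
def gl (F : DecFiltration V) (r s : ℤ) : Submodule ℂ (V →L[ℂ] V) where
  carrier := {α | ∀ p q, ∀ x ∈ D.I F p q, α x ∈ D.I F (p + r) (q + s)}
  add_mem' ha hb p q x hx := Submodule.add_mem _ (ha p q x hx) (hb p q x hx)
  zero_mem' p q x _ := by simp
  smul_mem' c _ ha p q x hx := Submodule.smul_mem _ c (ha p q x hx)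

/-- `𝔤^{r,s} = gl(V)^{r,s} ∩ Lie(G_ℂ)` -/
def g (F : DecFiltration V) (r s : ℤ) : Submodule ℂ (V →L[ℂ] V) :=
  D.gl F r s ⊓ D.lieGC

/-- `q_F = ⊕_{r < 0, r+s ≤ 0} 𝔤^{r,s}` -/
def q (F : DecFiltration V) : Submodule ℂ (V →L[ℂ] V) :=
  ⨆ (r : ℤ) (s : ℤ) (_ : r < 0) (_ : r + s ≤ 0), D.g F r s

/-- `T^horiz_F(M) = ⊕_{k ≤ 1} 𝔤^{-1,k}` -/
def horizontal (F : DecFiltration V) : Submodule ℂ (V →L[ℂ] V) :=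
  ⨆ (k : ℤ) (_ : k ≤ 1), D.g F (-1) k

end GradedPolarizationData

section Lie

attribute [local instance 100] LieRing.ofAssociativeRing

/-- A subspace of `gl(V)` is a nilpotent Lie subalgebra (for the commutator bracket). -/
def IsNilpotentLieSubalgebra {V : Type*} [NormedAddCommGroup V] [NormedSpace ℂ V]
    (q : Submodule ℂ (V →L[ℂ] V)) : Prop :=
  ∃ L : LieSubalgebra ℂ (V →L[ℂ] V), L.toSubmodule = q ∧ LieRing.IsNilpotent L

end Lie

end

/-!
A Hodge structure on each graded quotient means that `F` and its conjugate are opposed on `Gr^W`,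
and opposed filtrations have a Deligne bigrading `I`. Sorting the components of an endomorphism by
the sign of `r` writes `End V` as the sum of the stabilizer of `F` and the *lowering* endomorphisms
`r < 0`; hence, by the inverse function theorem, `u ↦ exp(u).F` on lowering `u` is a chart of the
flag variety at `F`.

A lowering `u` is nilpotent. If `exp(u).F` lies in the compact dual, then comparing dimensions of
`F^p ∩ W_k` shows that `exp(u)` preserves `W`, and the first bilinear relation for both filtrations
shows that `exp(u)` acts on `Gr^W` by isometries; as `t ↦ exp(tu)` is polynomial and these
properties hold at every `t ∈ ℕ`, it follows that `u ∈ Lie(G_ℂ)`, that is, `u ∈ q_F`. Being a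
polarized mixed Hodge structure is an open condition on the compact dual, so the chart restricts to
a chart `q_F → M`. A parametrization identifies tangent vectors with derivations by Hadamard's
lemma. Finally, differentiating `exp(u(s)).x` for `x ∈ F^p` shows that horizontality leaves only the
components with `r = -1`.
-/

noncomputable section

/-! ### Bigradings of a vector space -/

namespace BigradedSum

variable {ι R V : Type*} [Ring R] [AddCommGroup V] [Module R V] {J : ι → Submodule R V}

/-- The sum `∑_{i ∈ A} J i` of the pieces with index in `A`. -/
def part (J : ι → Submodule R V) (A : Set ι) : Submodule R V := ⨆ i ∈ A, J i

theorem le_part {A : Set ι} {i : ι} (hi : i ∈ A) : J i ≤ part J A :=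
  le_iSup₂_of_le i hi le_rfl

theorem part_mono {A B : Set ι} (h : A ⊆ B) : part J A ≤ part J B :=
  biSup_mono fun _ hi => h hi

theorem part_le {A : Set ι} {P : Submodule R V} (h : ∀ i ∈ A, J i ≤ P) : part J A ≤ P :=
  iSup₂_le h

theorem part_union (J : ι → Submodule R V) (A B : Set ι) :
    part J (A ∪ B) = part J A ⊔ part J B :=
  iSup_union

theorem disjoint_part (h : iSupIndep J) {A B : Set ι} (hAB : Disjoint A B) :
    Disjoint (part J A) (part J B) :=
  h.disjoint_biSup_biSup hAB

theorem part_inf_part (h : iSupIndep J) (A B : Set ι) :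
    part J A ⊓ part J B = part J (A ∩ B) := by
  have hdisj : part J (A \ B) ⊓ part J B = ⊥ :=
    (disjoint_part h Set.disjoint_sdiff_left).eq_bot
  rw [← Set.inter_union_sdiff A B, part_union,
    sup_inf_assoc_of_le _ (part_mono Set.inter_subset_right), hdisj, sup_bot_eq,
    Set.inter_union_sdiff]

theorem exists_finset_eq_bot (h : iSupIndep J) [IsNoetherian R V] :
    ∃ s : Finset ι, ∀ i, i ∉ s → J i = ⊥ :=
  ⟨(WellFoundedGT.finite_ne_bot_of_iSupIndep h).toFinset, fun i hi => by simpa using hi⟩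

section Finrank

variable {K V : Type*} [DivisionRing K] [AddCommGroup V] [Module K V] [FiniteDimensional K V]
  {J : ι → Submodule K V}

theorem finrank_part_union (h : iSupIndep J) {A B : Set ι} (hAB : Disjoint A B) :
    Module.finrank K (part J (A ∪ B)) =
      Module.finrank K (part J A) + Module.finrank K (part J B) := by
  rw [← Submodule.finrank_sup_add_finrank_inf_eq, (disjoint_part h hAB).eq_bot, finrank_bot,
    add_zero, part_union]

theorem finrank_part (h : iSupIndep J) (A : Set ι) [DecidablePred (· ∈ A)] {s : Finset ι}
    (hs : ∀ i, i ∉ s → J i = ⊥) :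
    Module.finrank K (part J A) = ∑ i ∈ s with i ∈ A, Module.finrank K (J i) := by
  classical
  have hfinset (t : Finset ι) :
      Module.finrank K (part J (t : Set ι)) = ∑ i ∈ t, Module.finrank K (J i) := by
    induction t using Finset.induction_on with
    | empty => rw [Finset.coe_empty, part, iSup_emptyset, finrank_bot, Finset.sum_empty]
    | insert i t hi ih =>
      have hsingleton : part J {i} = J i := iSup_singleton
      rw [Finset.sum_insert hi, ← ih, Finset.coe_insert, Set.insert_eq,
        finrank_part_union h (by simpa using hi), hsingleton]
  have hpart : part J A = part J {i | i ∈ s ∧ i ∈ A} := by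
    refine le_antisymm (part_le fun i hi => ?_) (part_mono fun i hi => hi.2)
    by_cases his : i ∈ s
    · exact le_part ⟨his, hi⟩
    · exact (hs i his).trans_le bot_le
  rw [← hfinset, Finset.coe_filter, hpart]

end Finrank

section Internal

variable [DecidableEq ι] (h : DirectSum.IsInternal J)

/-- The linear map on `V = ⨁ J i` that is given on each piece `J i`. -/
def lift {M : Type*} [AddCommGroup M] [Module R M] (f : ∀ i, J i →ₗ[R] M) : V →ₗ[R] M :=
  DirectSum.toModule R ι M f ∘ₗ (LinearEquiv.ofBijective (DirectSum.coeLinearMap J) h).symm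

/-- The projection of `V = ⨁ J i` onto the piece `J i`. -/
def proj (i : ι) : V →ₗ[R] V :=
  (J i).subtype ∘ₗ DirectSum.component R ι (fun i => J i) i ∘ₗ
    (LinearEquiv.ofBijective (DirectSum.coeLinearMap J) h).symm

theorem lift_of_mem {M : Type*} [AddCommGroup M] [Module R M] (f : ∀ i, J i →ₗ[R] M) {i : ι}
    {x : V} (hx : x ∈ J i) : lift h f x = f i ⟨x, hx⟩ := by
  have hsymm : (LinearEquiv.ofBijective (DirectSum.coeLinearMap J) h).symm x =
      DirectSum.lof R ι (fun i => J i) i ⟨x, hx⟩ := by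
    rw [LinearEquiv.symm_apply_eq]
    exact (DirectSum.coeLinearMap_lof J i ⟨x, hx⟩).symm
  rw [lift, LinearMap.comp_apply, LinearEquiv.coe_coe, hsymm, DirectSum.toModule_lof]

theorem proj_mem (i : ι) (x : V) : proj h i x ∈ J i :=
  Subtype.property _

theorem proj_of_mem {i : ι} {x : V} (hx : x ∈ J i) : proj h i x = x :=
  congrArg (J i).subtype (h.ofBijective_coeLinearMap_of_mem hx)

theorem proj_of_mem_of_ne {i j : ι} (hij : i ≠ j) {x : V} (hx : x ∈ J i) : proj h j x = 0 :=
  congrArg (J j).subtype (h.ofBijective_coeLinearMap_of_mem_ne hij hx)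

theorem proj_of_mem_part {A : Set ι} {x : V} (hx : x ∈ part J A) {i : ι} (hi : i ∉ A) :
    proj h i x = 0 := by
  have hle : part J A ≤ LinearMap.ker (proj h i) :=
    part_le fun j hj y hy => proj_of_mem_of_ne h (ne_of_mem_of_not_mem hj hi) hy
  exact hle hx

include h in
theorem ext_pieces {M : Type*} [AddCommGroup M] [Module R M] {f g : V →ₗ[R] M}
    (hfg : ∀ i, ∀ x ∈ J i, f x = g x) : f = g := by
  rw [← sub_eq_zero, ← LinearMap.ker_eq_top, eq_top_iff, ← h.submodule_iSup_eq_top]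
  exact iSup_le fun i x hx => by simp [hfg i x hx]

theorem sum_proj {s : Finset ι} (hs : ∀ i, i ∉ s → J i = ⊥) (x : V) :
    ∑ i ∈ s, proj h i x = x := by
  suffices ∑ i ∈ s, proj h i = LinearMap.id by
    simpa [LinearMap.sum_apply] using LinearMap.congr_fun this x
  refine ext_pieces h fun i x hx => ?_
  rw [LinearMap.sum_apply, Finset.sum_eq_single i (fun j _ hj => proj_of_mem_of_ne h hj.symm hx)
    (fun hi => ?_), proj_of_mem h hx, LinearMap.id_apply]
  rw [(Submodule.eq_bot_iff _).1 (hs i hi) x hx, map_zero]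

end Internal

section Endomorphisms

variable {ι 𝕜 V : Type*} [AddCommGroup ι] [NontriviallyNormedField 𝕜] [NormedAddCommGroup V]
  [NormedSpace 𝕜 V] {J : ι → Submodule 𝕜 V}

/-- The endomorphisms of `V = ⨁ J i` all of whose homogeneous components have degree in `A`. -/
def endOfDegree (J : ι → Submodule 𝕜 V) (A : Set ι) : Submodule 𝕜 (V →L[𝕜] V) where
  carrier := {α | ∀ i, ∀ x ∈ J i, α x ∈ part J {j | j - i ∈ A}}
  add_mem' ha hb i x hx := add_mem (ha i x hx) (hb i x hx)
  zero_mem' _ _ _ := zero_mem _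
  smul_mem' c _ ha i x hx := Submodule.smul_mem _ c (ha i x hx)

theorem endOfDegree_mono {A B : Set ι} (h : A ⊆ B) : endOfDegree J A ≤ endOfDegree J B :=
  fun _ hα i x hx => part_mono (Set.preimage_mono (f := (· - i)) h) (hα i x hx)

theorem apply_mem_part {A B C : Set ι} {α : V →L[𝕜] V} (hα : α ∈ endOfDegree J A)
    (h : ∀ a ∈ A, ∀ b ∈ B, a + b ∈ C) {x : V} (hx : x ∈ part J B) : α x ∈ part J C := by
  have hle : part J B ≤ (part J C).comap (α : V →ₗ[𝕜] V) :=
    part_le fun i hi y hy => part_mono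
      (fun j hj => by simpa using h (j - i) hj i hi) (hα i y hy)
  exact hle hx

theorem mul_mem_endOfDegree {A B C : Set ι} {α β : V →L[𝕜] V} (hα : α ∈ endOfDegree J A)
    (hβ : β ∈ endOfDegree J B) (h : ∀ a ∈ A, ∀ b ∈ B, a + b ∈ C) : α * β ∈ endOfDegree J C :=
  fun i x hx => apply_mem_part hα
    (fun a ha j hj => by simpa [add_sub_assoc] using h a ha (j - i) hj) (hβ i x hx)

theorem mem_endOfDegree_singleton {d : ι} {α : V →L[𝕜] V} :
    α ∈ endOfDegree J {d} ↔ ∀ i, ∀ x ∈ J i, α x ∈ J (i + d) := by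
  have hset (i : ι) : part J {j | j - i ∈ ({d} : Set ι)} = J (i + d) := by
    rw [show {j | j - i ∈ ({d} : Set ι)} = {i + d} by ext; simp [sub_eq_iff_eq_add'], part,
      iSup_singleton]
  exact forall₃_congr fun i x _ => by rw [hset]

theorem endOfDegree_inf (h : iSupIndep J) (A B : Set ι) :
    endOfDegree J A ⊓ endOfDegree J B = endOfDegree J (A ∩ B) := by
  refine le_antisymm (fun α hα i x hx => ?_) (le_inf (endOfDegree_mono Set.inter_subset_left)
    (endOfDegree_mono Set.inter_subset_right))
  exact (part_inf_part h _ _).le (Submodule.mem_inf.2 ⟨hα.1 i x hx, hα.2 i x hx⟩)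

theorem mem_endOfDegree_le_iff {Γ : Type*} [AddCommGroup Γ] [PartialOrder Γ] [IsOrderedAddMonoid Γ]
    (φ : ι →+ Γ) (c : Γ) {α : V →L[𝕜] V} : α ∈ endOfDegree J {d | c ≤ φ d} ↔
      ∀ p, ∀ x ∈ part J {i | p ≤ φ i}, α x ∈ part J {i | c + p ≤ φ i} := by
  refine ⟨fun hα p x hx => apply_mem_part hα (fun a ha b hb => ?_) hx, fun hα i x hx => ?_⟩
  · simpa only [Set.mem_ofPred_eq, map_add] using add_le_add ha hb
  · simpa only [Set.mem_ofPred_eq, map_sub, le_sub_iff_add_le] using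
      hα (φ i) x (le_part (i := i) (le_refl (φ i)) hx)

variable [DecidableEq ι] (h : DirectSum.IsInternal J)
include h

theorem endOfDegree_univ : endOfDegree J Set.univ = ⊤ := by
  have hpart : part J Set.univ = ⊤ := by rw [part, iSup_univ, h.submodule_iSup_eq_top]
  refine eq_top_iff.2 fun α _ i x _ => ?_
  simp only [Set.mem_univ, Set.ofPred_true, hpart, Submodule.mem_top]

theorem endOfDegree_eq_bot {A : Set ι} (hA : ∀ i j, J i ≠ ⊥ → J j ≠ ⊥ → j - i ∉ A) :
    endOfDegree J A = ⊥ := by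
  refine eq_bot_iff.2 fun α hα => (Submodule.mem_bot 𝕜).2 (ContinuousLinearMap.coe_injective
    (ext_pieces h fun i x hx => ?_))
  by_cases hi : J i = ⊥
  · rw [(Submodule.eq_bot_iff _).1 hi x hx, map_zero, map_zero]
  · have hbot : part J {j | j - i ∈ A} ≤ ⊥ :=
      part_le fun j hj => (not_not.1 fun hJj => hA i j hi hJj hj : J j = ⊥).le
    exact hbot (hα i x hx)

theorem iSupIndep_endOfDegree : iSupIndep fun d => endOfDegree J {d} := by
  refine iSupIndep_def.2 fun d => ?_
  have hle : ⨆ e, ⨆ _ : e ≠ d, endOfDegree J {e} ≤ endOfDegree J {d}ᶜ :=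
    iSup₂_le fun e he => endOfDegree_mono (by simpa using he.symm)
  refine Disjoint.mono_right hle (disjoint_iff.2 ?_)
  rw [endOfDegree_inf h.submodule_iSupIndep, Set.inter_compl_self]
  exact endOfDegree_eq_bot h fun _ _ _ _ => Set.notMem_empty _

theorem isNilpotent_of_mem_endOfDegree [IsNoetherian 𝕜 V] (φ : ι →+ ℤ) {A : Set ι}
    (hφ : ∀ d ∈ A, φ d < 0) {α : V →L[𝕜] V} (hα : α ∈ endOfDegree J A) : IsNilpotent α := by
  have hpow (n : ℕ) : α ^ n ∈ endOfDegree J {d | φ d ≤ -n} := by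
    induction n with
    | zero => exact fun i x hx => le_part (i := i) (by simp) hx
    | succ n ih =>
      rw [pow_succ]
      refine mul_mem_endOfDegree ih hα fun a ha b hb => ?_
      have hφb := hφ b hb
      simp only [Set.mem_ofPred_eq, map_add, Nat.cast_add, Nat.cast_one] at ha ⊢
      lia
  obtain ⟨t, ht⟩ := exists_finset_eq_bot h.submodule_iSupIndep
  obtain ⟨b, hb⟩ := (t.image fun i => |φ i|).bddAbove
  have hφt {i : ι} (hi : J i ≠ ⊥) : |φ i| ≤ b :=
    hb (Finset.mem_coe.2 (Finset.mem_image_of_mem _ (not_not.1 fun hit => hi (ht i hit))))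
  have hbot : endOfDegree J {d | φ d ≤ -((2 * b + 1).toNat : ℤ)} = ⊥ := by
    refine endOfDegree_eq_bot h fun i j hi hj hij => ?_
    have hi' := abs_le.1 (hφt hi)
    have hj' := abs_le.1 (hφt hj)
    simp only [Set.mem_ofPred_eq, map_sub] at hij
    lia
  exact ⟨_, (Submodule.mem_bot 𝕜).1 (hbot ▸ hpow _)⟩

variable [CompleteSpace 𝕜] [FiniteDimensional 𝕜 V]

/-- The component of degree `d` of an endomorphism of `V = ⨁ J i`. -/
def component (d : ι) (α : V →L[𝕜] V) : V →L[𝕜] V :=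
  LinearMap.toContinuousLinearMap
    (lift h fun i => proj h (i + d) ∘ₗ (α : V →ₗ[𝕜] V) ∘ₗ (J i).subtype)

theorem component_apply (d : ι) (α : V →L[𝕜] V) {i : ι} {x : V} (hx : x ∈ J i) :
    component h d α x = proj h (i + d) (α x) :=
  lift_of_mem h _ hx

theorem component_mem_endOfDegree_singleton (d : ι) (α : V →L[𝕜] V) :
    component h d α ∈ endOfDegree J {d} :=
  mem_endOfDegree_singleton.2 fun _ _ hx => component_apply h d α hx ▸ proj_mem h _ _

theorem component_eq_zero {A : Set ι} {d : ι} (hd : d ∉ A) {α : V →L[𝕜] V}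
    (hα : α ∈ endOfDegree J A) : component h d α = 0 := by
  refine ContinuousLinearMap.coe_injective (ext_pieces h fun i x hx => ?_)
  exact (component_apply h d α hx).trans
    (proj_of_mem_part h (hα i x hx) (by simpa using hd))

theorem component_mem_endOfDegree (d : ι) {A : Set ι} {α : V →L[𝕜] V}
    (hα : α ∈ endOfDegree J A) : component h d α ∈ endOfDegree J A := by
  by_cases hd : d ∈ A
  · exact endOfDegree_mono (by simpa using hd) (component_mem_endOfDegree_singleton h d α)
  · exact component_eq_zero h hd hα ▸ zero_mem _

theorem exists_sum_component (α : V →L[𝕜] V) : ∃ s : Finset ι, ∑ d ∈ s, component h d α = α := by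
  obtain ⟨t, ht⟩ := exists_finset_eq_bot h.submodule_iSupIndep
  refine ⟨(t ×ˢ t).image fun ij => ij.2 - ij.1,
    ContinuousLinearMap.coe_injective (ext_pieces h fun i x hx => ?_)⟩
  by_cases hi : i ∈ t
  · have hsum := sum_proj h (s := ((t ×ˢ t).image fun ij => ij.2 - ij.1).image (i + ·))
      (fun j hj => ht j fun hjt => hj (Finset.mem_image.2
        ⟨j - i, Finset.mem_image_of_mem (fun ij : ι × ι => ij.2 - ij.1)
          (Finset.mk_mem_product hi hjt), add_sub_cancel i j⟩)) (α x)
    rw [Finset.sum_image (add_right_injective i).injOn] at hsum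
    simpa only [ContinuousLinearMap.coe_coe, sum_apply, component_apply h _ α hx] using hsum
  · rw [(Submodule.eq_bot_iff _).1 (ht i hi) x hx, map_zero, map_zero]

theorem endOfDegree_inf_eq_iSup (A : Set ι) {P : Submodule 𝕜 (V →L[𝕜] V)}
    (hP : ∀ d, ∀ α ∈ P, component h d α ∈ P) :
    endOfDegree J A ⊓ P = ⨆ d ∈ A, endOfDegree J {d} ⊓ P := by
  refine le_antisymm (fun α hα => ?_) (iSup₂_le fun d hd =>
    inf_le_inf_right _ (endOfDegree_mono (by simpa using hd)))
  obtain ⟨s, hs⟩ := exists_sum_component h α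
  rw [← hs]
  refine Submodule.sum_mem _ fun d _ => ?_
  by_cases hd : d ∈ A
  · exact Submodule.mem_iSup_of_mem d (Submodule.mem_iSup_of_mem hd
      ⟨component_mem_endOfDegree_singleton h d α, hP d α hα.2⟩)
  · exact component_eq_zero h hd hα.1 ▸ zero_mem _

theorem isCompl_endOfDegree {A B : Set ι} (hAB : IsCompl A B) :
    IsCompl (endOfDegree J A) (endOfDegree J B) := by
  constructor
  · rw [disjoint_iff, endOfDegree_inf h.submodule_iSupIndep,
      hAB.disjoint.inter_eq]
    exact endOfDegree_eq_bot h fun _ _ _ _ => Set.notMem_empty _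
  · have hiSup := endOfDegree_inf_eq_iSup h (P := ⊤) (A ∪ B) fun _ _ _ => Submodule.mem_top
    simp only [inf_top_eq] at hiSup
    rw [codisjoint_iff, eq_top_iff, ← endOfDegree_univ h,
      ← show A ∪ B = Set.univ from hAB.sup_eq_top, hiSup, iSup_union]
    exact sup_le_sup (iSup₂_le fun d hd => endOfDegree_mono (by simpa using hd))
      (iSup₂_le fun d hd => endOfDegree_mono (by simpa using hd))

end Endomorphisms

end BigradedSum

/-! ### The Deligne bigrading of opposed filtrations -/

/-- Three finite filtrations of `V` such that `F` and `G` are `m`-opposed on `Gr^W_m`, that is,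
`Gr^W_m = F^p ⊕ G^{m+1-p}` for all `m` and `p`. For a mixed Hodge structure, `G = conj F`. The
conditions are written as inclusions of subspaces of `V`. -/
structure OpposedFiltrations {R V : Type*} [Ring R] [AddCommGroup V] [Module R V]
    (F G W : ℤ → Submodule R V) : Prop where
  left_antitone : Antitone F
  right_antitone : Antitone G
  weight_monotone : Monotone W
  left_bot : ∃ p, F p = ⊥
  left_top : ∃ p, F p = ⊤
  right_bot : ∃ p, G p = ⊥
  right_top : ∃ p, G p = ⊤
  weight_bot : ∃ k, W k = ⊥
  weight_top : ∃ k, W k = ⊤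
  inf_le : ∀ {p q m}, p + q = m + 1 → F p ⊓ W m ⊓ (G q ⊓ W m ⊔ W (m - 1)) ≤ W (m - 1)
  le_sup : ∀ {p q m}, p + q = m + 1 → W m ≤ F p ⊓ W m ⊔ (G q ⊓ W m ⊔ W (m - 1))

namespace BigradedSum

variable {R V : Type*} [Ring R] [AddCommGroup V] [Module R V]

/-- The subspaces `I^{p,q}` of a bigrading as a family indexed by pairs. -/
abbrev pieces (I : ℤ → ℤ → Submodule R V) (rs : ℤ × ℤ) : Submodule R V :=
  I rs.1 rs.2

theorem part_pieces_eq_iSup (I : ℤ → ℤ → Submodule R V) (P : ℤ × ℤ → Prop) :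
    part (pieces I) {rs | P rs} = ⨆ (r : ℤ) (s : ℤ) (_ : P (r, s)), I r s :=
  iSup_prod

theorem part_pieces_eq_iSup_and (I : ℤ → ℤ → Submodule R V) (p q : ℤ) :
    part (pieces I) {rs | rs.1 < p ∧ rs.2 < q} =
      ⨆ (r : ℤ) (s : ℤ) (_ : r < p) (_ : s < q), I r s := by
  simp only [part_pieces_eq_iSup I fun rs => rs.1 < p ∧ rs.2 < q, iSup_and]

end BigradedSum

namespace OpposedFiltrations

open BigradedSum

variable {R V : Type*} [Ring R] [AddCommGroup V] [Module R V] {F G W : ℤ → Submodule R V}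

/-- The sum `∑_{n ≤ m} G^{n+1-p} ∩ W_n`, which is the complement
`⨁_{r < p, r + s ≤ m} I^{r,s}` of `F^p ∩ W_m` in `W_m`, see `tail_eq_part`. -/
def tail (G W : ℤ → Submodule R V) (p m : ℤ) : Submodule R V :=
  ⨆ (n) (_ : n ≤ m), G (n + 1 - p) ⊓ W n

/-- Deligne's subspaces
`I^{p,q} = F^p ∩ W_{p+q} ∩ (G^q ∩ W_{p+q} + ∑_{i ≥ 0} G^{q-1-i} ∩ W_{p+q-2-i})`. -/
def deligne (F G W : ℤ → Submodule R V) (p q : ℤ) : Submodule R V :=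
  F p ⊓ W (p + q) ⊓ (G q ⊓ W (p + q) ⊔ tail G W p (p + q - 2))

theorem deligne_le_left (p q : ℤ) : deligne F G W p q ≤ F p := inf_le_left.trans inf_le_left

theorem deligne_le_weight (p q : ℤ) : deligne F G W p q ≤ W (p + q) :=
  inf_le_left.trans inf_le_right

theorem tail_mono (p : ℤ) : Monotone (tail G W p) := fun _ _ hm =>
  biSup_mono fun _ hn => hn.trans hm

theorem tail_le_tail (hG : Antitone G) {p p' m m' : ℤ} (hp : p ≤ p') (hm : m ≤ m') :
    tail G W p m ≤ tail G W p' m' :=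
  (tail_mono p hm).trans (iSup₂_mono fun _ _ => inf_le_inf_right _ (hG (by lia)))

theorem tail_le_weight (hW : Monotone W) (p m : ℤ) : tail G W p m ≤ W m :=
  iSup₂_le fun _ hn => inf_le_right.trans (hW hn)

theorem inf_weight_le_tail {p q m n : ℤ} (hn : n ≤ m) (hq : q = n + 1 - p) :
    G q ⊓ W n ≤ tail G W p m :=
  hq ▸ le_iSup₂_of_le n hn le_rfl

theorem tail_eq_sup (G W : ℤ → Submodule R V) {p q m : ℤ} (h : p + q = m + 1) :
    tail G W p m = G q ⊓ W m ⊔ tail G W p (m - 1) := by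
  refine le_antisymm (iSup₂_le fun n hn => ?_)
    (sup_le (inf_weight_le_tail le_rfl (by lia)) (tail_mono p (by lia)))
  rcases hn.eq_or_lt with rfl | hn
  · exact le_sup_of_le_left (by rw [show n + 1 - p = q by lia])
  · exact le_sup_of_le_right (inf_weight_le_tail (by lia) rfl)

theorem tail_inf_weight_le (hG : Antitone G) (hW : Monotone W) (p m : ℤ) :
    tail G W p m ⊓ W (m - 1) ≤ tail G W p (m - 1) := by
  rw [tail_eq_sup G W (q := m + 1 - p) (by lia), sup_comm,
    sup_inf_assoc_of_le _ (tail_le_weight hW p (m - 1))]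
  refine sup_le le_rfl ?_
  calc G (m + 1 - p) ⊓ W m ⊓ W (m - 1) ≤ G (m - p) ⊓ W (m - 1) :=
        inf_le_inf_right _ (inf_le_left.trans (hG (by lia)))
    _ ≤ tail G W p (m - 1) := inf_weight_le_tail le_rfl (by lia)

theorem deligne_le_right_sup (hW : Monotone W) (p q : ℤ) :
    deligne F G W p q ≤ G q ⊓ W (p + q) ⊔ W (p + q - 1) :=
  inf_le_right.trans (sup_le_sup_left ((tail_le_weight hW _ _).trans (hW (by lia))) _)

variable (H : OpposedFiltrations F G W)

include H

@[elab_as_elim]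
theorem weight_induction {P : ℤ → Prop} (bot : ∀ m, W m = ⊥ → P m)
    (step : ∀ m, P (m - 1) → P m) (m : ℤ) : P m := by
  obtain ⟨k, hk⟩ := H.weight_bot
  have hbot (n : ℤ) (hn : n ≤ k) : P n := bot n (le_bot_iff.1 (hk ▸ H.weight_monotone hn))
  induction m using Int.inductionOn' (b := k) with
  | zero => exact hbot k le_rfl
  | succ n _ ih => exact step _ (by rwa [add_sub_cancel_right])
  | pred n hn _ => exact hbot _ (by lia)

@[elab_as_elim]
theorem left_induction {P : ℤ → Prop} (bot : ∀ p, F p = ⊥ → P p)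
    (step : ∀ p, P (p + 1) → P p) (p : ℤ) : P p := by
  obtain ⟨k, hk⟩ := H.left_bot
  have hbot (n : ℤ) (hn : k ≤ n) : P n := bot n (le_bot_iff.1 (hk ▸ H.left_antitone hn))
  induction p using Int.inductionOn' (b := k) with
  | zero => exact hbot k le_rfl
  | succ n hn _ => exact hbot _ (by lia)
  | pred n _ ih => exact step _ (by rwa [sub_add_cancel])

theorem weight_le_sup_tail (p m : ℤ) : W m ≤ F p ⊓ W m ⊔ tail G W p m := by
  induction m using H.weight_induction with
  | bot m hm => exact hm.trans_le bot_le
  | step m ih =>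
    have hq : p + (m + 1 - p) = m + 1 := by lia
    have ih' : W (m - 1) ≤ F p ⊓ W m ⊔ tail G W p (m - 1) :=
      ih.trans (sup_le_sup_right (inf_le_inf_left _ (H.weight_monotone (by lia))) _)
    calc W m ≤ F p ⊓ W m ⊔ (G (m + 1 - p) ⊓ W m ⊔ W (m - 1)) := H.le_sup hq
      _ ≤ F p ⊓ W m ⊔ (G (m + 1 - p) ⊓ W m ⊔ (F p ⊓ W m ⊔ tail G W p (m - 1))) := by gcongr
      _ = F p ⊓ W m ⊔ tail G W p m := by
        rw [tail_eq_sup G W hq, sup_left_comm (G _ ⊓ W m), ← sup_assoc, sup_idem]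

theorem disjoint_left_tail (p m : ℤ) : Disjoint (F p) (tail G W p m) := by
  induction m using H.weight_induction with
  | bot m hm => exact disjoint_bot_right.mono_right (hm ▸ tail_le_weight H.weight_monotone p m)
  | step m ih =>
    have hq : p + (m + 1 - p) = m + 1 := by lia
    have hW : F p ⊓ tail G W p m ≤ W (m - 1) :=
      calc F p ⊓ tail G W p m ≤ F p ⊓ W m ⊓ (G (m + 1 - p) ⊓ W m ⊔ W (m - 1)) :=
            le_inf (inf_le_inf_left _ (tail_le_weight H.weight_monotone p m)) <|
              inf_le_right.trans <| (tail_eq_sup G W hq).trans_le <|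
                sup_le_sup_left (tail_le_weight H.weight_monotone p (m - 1)) _
        _ ≤ W (m - 1) := H.inf_le hq
    exact disjoint_iff_inf_le.2 <| (le_inf inf_le_left <| (le_inf inf_le_right hW).trans <|
      tail_inf_weight_le H.right_antitone H.weight_monotone p m).trans ih.le_bot

theorem disjoint_deligne_weight (p q : ℤ) : Disjoint (deligne F G W p q) (W (p + q - 1)) := by
  have htail : (G q ⊓ W (p + q) ⊔ tail G W p (p + q - 2)) ⊓ W (p + q - 1) ≤
      tail G W p (p + q - 1) := by
    rw [sup_comm, sup_inf_assoc_of_le _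
      ((tail_le_weight H.weight_monotone p _).trans (H.weight_monotone (by lia)))]
    exact sup_le (tail_mono p (by lia)) <|
      (inf_le_inf_right _ inf_le_left).trans (inf_weight_le_tail le_rfl (by lia))
  exact disjoint_iff_inf_le.2 <| (le_inf (inf_le_left.trans (deligne_le_left p q)) <|
    (inf_le_inf_right _ inf_le_right).trans htail).trans (H.disjoint_left_tail p _).le_bot

theorem disjoint_deligne_sup (p q : ℤ) :
    Disjoint (deligne F G W p q) (W (p + q - 1) ⊔ F (p + 1) ⊓ W (p + q)) := by
  rw [Submodule.disjoint_def]
  intro x hx hx'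
  obtain ⟨w, hw, f, hf, rfl⟩ := Submodule.mem_sup.1 hx'
  have hfG : f ∈ G q ⊓ W (p + q) ⊔ W (p + q - 1) := by
    simpa using Submodule.sub_mem _ (deligne_le_right_sup H.weight_monotone p q hx)
      (Submodule.mem_sup_right hw)
  have hfW : f ∈ W (p + q - 1) := H.inf_le (p := p + 1) (by lia) ⟨hf, hfG⟩
  exact Submodule.disjoint_def.1 (H.disjoint_deligne_weight p q) _ hx (add_mem hw hfW)

theorem inf_sup_le_deligne_sup (p q : ℤ) :
    F p ⊓ W (p + q) ⊓ (G q ⊓ W (p + q) ⊔ W (p + q - 1)) ≤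
      deligne F G W p q ⊔ F p ⊓ W (p + q - 1) := by
  have hFW : F p ⊓ W (p + q - 1) ≤ F p ⊓ W (p + q) :=
    inf_le_inf_left _ (H.weight_monotone (by lia))
  have hW : G q ⊓ W (p + q) ⊔ W (p + q - 1) ≤
      G q ⊓ W (p + q) ⊔ tail G W p (p + q - 2) ⊔ F p ⊓ W (p + q - 1) := by
    refine sup_le (le_sup_left.trans le_sup_left) ((H.weight_le_sup_tail p _).trans ?_)
    rw [tail_eq_sup G W (q := q) (by lia), show p + q - 1 - 1 = p + q - 2 by lia, sup_comm]
    gcongr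
    exact H.weight_monotone (by lia)
  refine (inf_le_inf_left _ hW).trans ?_
  rw [deligne, inf_sup_assoc_of_le _ hFW]

theorem left_inf_weight_le (p k : ℤ) :
    F p ⊓ W k ≤ F (p + 1) ⊓ W k ⊔ (deligne F G W p (k - p) ⊔ F p ⊓ W (k - 1)) := by
  have hF : F (p + 1) ⊓ W k ≤ F p ⊓ W k := inf_le_inf_right _ (H.left_antitone (by lia))
  have hlift := H.inf_sup_le_deligne_sup p (k - p)
  rw [add_sub_cancel] at hlift
  calc F p ⊓ W k ≤ F p ⊓ W k ⊓ (F (p + 1) ⊓ W k ⊔ (G (k - p) ⊓ W k ⊔ W (k - 1))) :=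
        le_inf le_rfl (inf_le_right.trans (H.le_sup (by lia)))
    _ = F (p + 1) ⊓ W k ⊔ F p ⊓ W k ⊓ (G (k - p) ⊓ W k ⊔ W (k - 1)) := by
        rw [inf_comm, sup_inf_assoc_of_le _ hF, inf_comm (F p ⊓ W k)]
    _ ≤ _ := sup_le_sup_left hlift _

theorem left_inf_weight_eq_part (p k : ℤ) :
    F p ⊓ W k = part (pieces (deligne F G W)) {rs | p ≤ rs.1 ∧ rs.1 + rs.2 ≤ k} := by
  refine le_antisymm ?_ (part_le fun rs h => le_inf
    ((deligne_le_left _ _).trans (H.left_antitone h.1))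
    ((deligne_le_weight _ _).trans (H.weight_monotone h.2)))
  induction k using H.weight_induction generalizing p with
  | bot k hk => simp [hk]
  | step k ihk =>
    induction p using H.left_induction with
    | bot p hp => simp [hp]
    | step p ihp =>
      refine (H.left_inf_weight_le p k).trans (sup_le (ihp.trans ?_) (sup_le ?_ ((ihk p).trans ?_)))
      · exact part_mono fun rs h => ⟨(Int.le_add_one le_rfl).trans h.1, h.2⟩
      · exact le_part (J := pieces (deligne F G W)) (i := (p, k - p)) ⟨le_rfl, by simp⟩
      · exact part_mono fun rs h => ⟨h.1, h.2.trans (by lia)⟩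

theorem left_eq_part (p : ℤ) : F p = part (pieces (deligne F G W)) {rs | p ≤ rs.1} := by
  obtain ⟨k, hk⟩ := H.weight_top
  refine le_antisymm ?_ (part_le fun rs h => (deligne_le_left _ _).trans (H.left_antitone h))
  rw [← inf_top_eq (F p), ← hk, H.left_inf_weight_eq_part]
  exact part_mono fun rs h => h.1

theorem weight_eq_part (k : ℤ) : W k = part (pieces (deligne F G W)) {rs | rs.1 + rs.2 ≤ k} := by
  obtain ⟨p, hp⟩ := H.left_top
  refine le_antisymm ?_ (part_le fun rs h => (deligne_le_weight _ _).trans (H.weight_monotone h))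
  rw [← top_inf_eq (W k), ← hp, H.left_inf_weight_eq_part]
  exact part_mono fun rs h => h.2

theorem iSupIndep_deligne : iSupIndep (pieces (deligne F G W)) := by
  rw [iSupIndep_iff_finsetSum_eq_zero_imp_eq_zero]
  intro s
  -- Induct on the largest index for the order by increasing weight, then by decreasing `p`.
  induction s using Finset.induction_on_max_value
    (fun rs : ℤ × ℤ => toLex (rs.1 + rs.2, -rs.1)) with
  | empty => simp
  | insert a s ha hmax ih =>
    intro v hv hsum
    rw [Finset.sum_insert ha] at hsum
    have hlower : ∑ i ∈ s, v i ∈ W (a.1 + a.2 - 1) ⊔ F (a.1 + 1) ⊓ W (a.1 + a.2) := by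
      refine Submodule.sum_mem _ fun j hj => ?_
      have hvj := hv j (Finset.mem_insert_of_mem hj)
      rcases (Prod.Lex.toLex_le_toLex).1 (hmax j hj) with hlt | ⟨heq, hle⟩
      · exact Submodule.mem_sup_left <|
          H.weight_monotone (Int.le_sub_one_of_lt hlt) (deligne_le_weight _ _ hvj)
      · have hne : j.1 ≠ a.1 := fun h => ha <| by
          rwa [show a = j from Prod.ext h.symm (by simp only at heq; lia)]
        exact Submodule.mem_sup_right ⟨H.left_antitone (by simp only at hle; lia)
          (deligne_le_left _ _ hvj), H.weight_monotone heq.le (deligne_le_weight _ _ hvj)⟩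
    have hva : v a = 0 := by
      refine Submodule.disjoint_def.1 (H.disjoint_deligne_sup a.1 a.2) _
        (hv a (Finset.mem_insert_self _ _)) ?_
      rw [eq_neg_of_add_eq_zero_left hsum]
      exact Submodule.neg_mem _ hlower
    rw [hva, zero_add] at hsum
    exact (Finset.forall_mem_insert _ _ _).2
      ⟨hva, ih v (fun i hi => hv i (Finset.mem_insert_of_mem hi)) hsum⟩

theorem isInternal_deligne : DirectSum.IsInternal (pieces (deligne F G W)) := by
  obtain ⟨p, hp⟩ := H.left_top
  refine DirectSum.isInternal_submodule_of_iSupIndep_of_iSup_eq_top H.iSupIndep_deligne ?_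
  rw [eq_top_iff, ← hp, H.left_eq_part]
  exact part_le fun i _ => le_iSup (pieces (deligne F G W)) i

theorem tail_left_le_part (q m : ℤ) :
    tail F W q m ≤ part (pieces (deligne F G W)) {rs | rs.2 < q ∧ rs.1 + rs.2 ≤ m} :=
  iSup₂_le fun n hn => (H.left_inf_weight_eq_part _ _).trans_le <|
    part_mono fun _ h => ⟨by have := h.1; have := h.2; lia, h.2.trans hn⟩

theorem tail_eq_part (p m : ℤ) :
    tail G W p m = part (pieces (deligne F G W)) {rs | rs.1 < p ∧ rs.1 + rs.2 ≤ m} := by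
  have hle : part (pieces (deligne F G W)) {rs | rs.1 < p ∧ rs.1 + rs.2 ≤ m} ≤ tail G W p m :=
    part_le fun rs h => inf_le_right.trans <| sup_le
      ((inf_weight_le_tail (p := rs.1 + 1) le_rfl (by lia)).trans
        (tail_le_tail H.right_antitone h.1 h.2))
      (tail_le_tail H.right_antitone h.1.le (by have := h.2; lia))
  refine le_antisymm ?_ hle
  have hsup : tail G W p m ≤
      part (pieces (deligne F G W)) {rs | rs.1 < p ∧ rs.1 + rs.2 ≤ m} ⊔ F p := by
    rw [H.left_eq_part p, ← part_union]
    refine ((tail_le_weight H.weight_monotone p m).trans_eq (H.weight_eq_part m)).trans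
      (part_mono fun rs h => ?_)
    exact (lt_or_ge rs.1 p).imp (fun hlt => ⟨hlt, h⟩) id
  rw [← inf_eq_left.2 hsup, inf_comm, sup_inf_assoc_of_le _ hle, (H.disjoint_left_tail p m).eq_bot,
    sup_bot_eq]

theorem symm : OpposedFiltrations G F W where
  left_antitone := H.right_antitone
  right_antitone := H.left_antitone
  weight_monotone := H.weight_monotone
  left_bot := H.right_bot
  left_top := H.right_top
  right_bot := H.left_bot
  right_top := H.left_top
  weight_bot := H.weight_bot
  weight_top := H.weight_top
  inf_le {p q m} h := by
    rintro x ⟨hxG, hx⟩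
    obtain ⟨f, hf, w, hw, rfl⟩ := Submodule.mem_sup.1 hx
    refine add_mem (H.inf_le (add_comm q p ▸ h) ⟨hf, ?_⟩) hw
    simpa using Submodule.sub_mem _ (Submodule.mem_sup_left hxG) (Submodule.mem_sup_right hw)
  le_sup {p q m} h := (H.le_sup (add_comm q p ▸ h)).trans_eq (sup_left_comm _ _ _)

theorem sub_mem_part {p q : ℤ} {x y : V} (hx : x ∈ deligne F G W p q)
    (hy : y ∈ deligne G F W q p) (hxy : x - y ∈ W (p + q - 1)) :
    x - y ∈ part (pieces (deligne F G W)) {rs | rs.1 < p ∧ rs.2 < q} := by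
  obtain ⟨v, ⟨hvG, -⟩, t, ht, rfl⟩ := Submodule.mem_sup.1 hx.2
  obtain ⟨w, ⟨hwF, -⟩, t', ht', rfl⟩ := Submodule.mem_sup.1 hy.2
  rw [add_comm q p] at ht'
  have htW := tail_le_weight H.weight_monotone _ _ ht
  have htW' := tail_le_weight H.weight_monotone _ _ ht'
  have hmono : W (p + q - 2) ≤ W (p + q - 1) := H.weight_monotone (by lia)
  -- The vector `a` lies in `F^p`, the vector `b` in `G^q`, and both represent `x - y`.
  set a := v + t - w
  set b := v - (w + t')
  have haF : a ∈ F p := sub_mem (deligne_le_left _ _ hx) hwF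
  have hbG : b ∈ G q := sub_mem hvG (deligne_le_left _ _ hy)
  have hxa : v + t - (w + t') = a - t' := by simp only [a]; abel
  have hxb : v + t - (w + t') = b + t := by simp only [b]; abel
  have haW : a ∈ W (p + q - 1) := by
    simpa [hxa] using add_mem hxy (hmono htW')
  have hbW : b ∈ W (p + q - 1) := by
    simpa [hxb] using sub_mem hxy (hmono htW)
  have hab : a - b = t + t' := by simp only [a, b]; abel
  have haW' : a ∈ W (p + q - 2) := by
    have := H.inf_le (p := p) (q := q) (m := p + q - 1) (by lia) (x := a) ⟨⟨haF, haW⟩, by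
      rw [← add_sub_cancel b a, hab]
      exact add_mem (Submodule.mem_sup_left ⟨hbG, hbW⟩) (Submodule.mem_sup_right
        (H.weight_monotone (by lia) (add_mem htW htW')))⟩
    exact H.weight_monotone (by lia) this
  have hbW' : b ∈ W (p + q - 2) := by
    rw [← sub_sub_cancel a b, hab]
    exact sub_mem haW' (add_mem htW htW')
  have hG : v + t - (w + t') ∈ tail G W p (p + q - 2) := hxb ▸
    add_mem (inf_weight_le_tail le_rfl rfl ⟨H.right_antitone (by lia) hbG, hbW'⟩) ht
  have hF : v + t - (w + t') ∈ tail F W q (p + q - 2) := hxa ▸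
    sub_mem (inf_weight_le_tail le_rfl rfl ⟨H.left_antitone (by lia) haF, haW'⟩) ht'
  rw [H.tail_eq_part] at hG
  have hmem := Submodule.mem_inf.2 (And.intro hG (H.tail_left_le_part _ _ hF))
  rw [part_inf_part H.iSupIndep_deligne] at hmem
  refine part_mono (fun rs h => ?_) hmem
  exact ⟨h.1.1, h.2.1⟩

theorem deligne_le_deligne_swap_sup_weight (p q : ℤ) :
    deligne F G W p q ≤ deligne G F W q p ⊔ W (p + q - 1) := by
  intro x hx
  obtain ⟨v, hv, w, hw, rfl⟩ := Submodule.mem_sup.1 (deligne_le_right_sup H.weight_monotone p q hx)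
  have hvF : v ∈ F p ⊓ W (p + q) ⊔ W (p + q - 1) := by
    simpa using sub_mem (Submodule.mem_sup_left hx.1) (Submodule.mem_sup_right hw)
  have hlift := H.symm.inf_sup_le_deligne_sup q p
  rw [add_comm q p] at hlift
  exact add_mem ((hlift.trans (sup_le_sup_left inf_le_right _)) ⟨hv, hvF⟩)
    (Submodule.mem_sup_right hw)

theorem deligne_sup_part_eq (p q : ℤ) :
    deligne F G W p q ⊔ part (pieces (deligne F G W)) {rs | rs.1 < p ∧ rs.2 < q} =
      deligne G F W q p ⊔ part (pieces (deligne F G W)) {rs | rs.1 < p ∧ rs.2 < q} := by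
  refine le_antisymm (sup_le (fun x hx => ?_) le_sup_right) (sup_le (fun y hy => ?_) le_sup_right)
  · obtain ⟨y, hy, w, hw, rfl⟩ :=
      Submodule.mem_sup.1 (H.deligne_le_deligne_swap_sup_weight p q hx)
    have hsub := H.sub_mem_part hx hy (by simpa using hw)
    exact Submodule.mem_sup.2 ⟨y, hy, w, by simpa using hsub, rfl⟩
  · obtain ⟨x, hx, w, hw, rfl⟩ :=
      Submodule.mem_sup.1 (H.symm.deligne_le_deligne_swap_sup_weight q p hy)
    rw [add_comm q p] at hw
    have hsub := H.sub_mem_part hx hy (by simpa using neg_mem hw)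
    exact Submodule.mem_sup.2 ⟨x, hx, w, by simpa using hsub, rfl⟩

end OpposedFiltrations

namespace GradedPolarizationData

open BigradedSum OpposedFiltrations

variable {V : Type*} [AddCommGroup V] [Module ℂ V] [Module ℚ V] (D : GradedPolarizationData V)

@[simp]
theorem conjTensor_conjTensor (t : ℂ ⊗[ℚ] D.VQ) : D.conjTensor (D.conjTensor t) = t := by
  induction t with
  | zero => simp only [map_zero]
  | tmul a b => simp [conjTensor]
  | add a b ha hb => simp only [map_add, ha, hb]

@[simp]
theorem conj_conj (x : V) : D.conj (D.conj x) = x := by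
  simp [conj]

theorem conj_rational {x : V} (hx : x ∈ D.VQ) : D.conj x = x := by
  simpa using D.conj_smul_rational 1 hx

theorem conj_mem_W_iff {k : ℤ} {x : V} : D.conj x ∈ D.W k ↔ x ∈ D.W k :=
  ⟨fun h => D.conj_conj x ▸ D.conj_mem_W k _ h, D.conj_mem_W k x⟩

theorem conj_injective : Function.Injective D.conj :=
  Function.LeftInverse.injective D.conj_conj

theorem mem_map_conj {P : Submodule ℂ V} {x : V} : x ∈ P.map D.conj ↔ D.conj x ∈ P :=
  ⟨fun ⟨y, hy, hyx⟩ => by rwa [← hyx, conj_conj], fun h => ⟨_, h, D.conj_conj x⟩⟩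

@[simp]
theorem map_conj_map_conj (P : Submodule ℂ V) : (P.map D.conj).map D.conj = P := by
  ext x
  simp only [mem_map_conj, conj_conj]

@[simp]
theorem map_conj_W (k : ℤ) : (D.W k).map D.conj = D.W k := by
  ext x
  rw [mem_map_conj, conj_mem_W_iff]

theorem map_conj_deligne (F G : ℤ → Submodule ℂ V) (p q : ℤ) :
    (deligne F G D.W p q).map D.conj =
      deligne (fun p => (F p).map D.conj) (fun q => (G q).map D.conj) D.W p q := by
  simp only [deligne, tail, Submodule.map_inf _ D.conj_injective, Submodule.map_sup,
    Submodule.map_iSup, map_conj_W]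

/-- The preimage in `W_k` of the subspace of `Gr^W_k` that is induced by `P`. -/
def grPre (k : ℤ) (P : Submodule ℂ V) : Submodule ℂ V :=
  P ⊓ D.W k ⊔ D.W (k - 1)

theorem conj_mem_grPre {k : ℤ} {P : Submodule ℂ V} {x : V} :
    D.conj x ∈ D.grPre k P ↔ x ∈ D.grPre k (P.map D.conj) := by
  rw [← mem_map_conj, grPre, grPre, Submodule.map_sup, Submodule.map_inf _ D.conj_injective,
    map_conj_W, map_conj_W]

variable {D}

theorem exists_mk {k : ℤ} (x : GrW D.W k) : ∃ y : D.W k, GrW.mk D.W k y = x :=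
  Submodule.mkQ_surjective _ x

theorem mk_eq_zero_iff {k : ℤ} {x : D.W k} : GrW.mk D.W k x = 0 ↔ (x : V) ∈ D.W (k - 1) :=
  Submodule.Quotient.mk_eq_zero _

theorem mk_eq_mk_iff {k : ℤ} {x y : D.W k} :
    GrW.mk D.W k x = GrW.mk D.W k y ↔ (x : V) - y ∈ D.W (k - 1) :=
  Submodule.Quotient.eq _

theorem mk_mem_grF {F : DecFiltration V} {k p : ℤ} {x : D.W k} :
    GrW.mk D.W k x ∈ D.grF F k p ↔ (x : V) ∈ D.grPre k (F p) := by
  rw [grPre, Submodule.mem_sup]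
  constructor
  · rintro ⟨f, hf, hfx⟩
    exact ⟨f, ⟨hf, f.2⟩, x - f, mk_eq_mk_iff.1 hfx.symm, add_sub_cancel _ _⟩
  · rintro ⟨f, ⟨hf, hfW⟩, w, hw, hfw⟩
    exact ⟨⟨f, hfW⟩, hf, (mk_eq_mk_iff.2 (by simpa [← hfw] using hw)).symm⟩

theorem grConj_mk {k : ℤ} (x : D.W k) :
    D.grConj k (GrW.mk D.W k x) = GrW.mk D.W k ⟨D.conj x, D.conj_mem_W k x x.2⟩ := rfl

theorem grConj_grConj {k : ℤ} (x : GrW D.W k) : D.grConj k (D.grConj k x) = x := by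
  obtain ⟨x, rfl⟩ := exists_mk x
  simp only [grConj_mk, conj_conj]

theorem mem_map_grConj {k : ℤ} {P : Submodule ℂ (GrW D.W k)} {x : GrW D.W k} :
    x ∈ P.map (D.grConj k) ↔ D.grConj k x ∈ P :=
  ⟨fun ⟨y, hy, hyx⟩ => by rwa [← hyx, grConj_grConj], fun h => ⟨_, h, grConj_grConj x⟩⟩

theorem mk_mem_map_grF {F : DecFiltration V} {k p : ℤ} {x : D.W k} :
    GrW.mk D.W k x ∈ (D.grF F k p).map (D.grConj k) ↔
      (x : V) ∈ D.grPre k ((F p).map D.conj) := by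
  rw [mem_map_grConj, grConj_mk, mk_mem_grF, conj_mem_grPre]

theorem IsMixedHodge.opposedFiltrations {F : DecFiltration V} (h : D.IsMixedHodge F) :
    OpposedFiltrations F.toFun (fun q => (F q).map D.conj) D.W where
  left_antitone := F.antitone'
  right_antitone _ _ hab := Submodule.map_mono (F.antitone' hab)
  weight_monotone := D.W_mono
  left_bot := h.2.1
  left_top := h.1
  right_bot := h.2.1.imp fun p hp => by rw [hp, Submodule.map_bot]
  right_top := h.1.imp fun p hp => eq_top_iff.2 fun x _ =>
    D.mem_map_conj.2 (by rw [hp]; exact Submodule.mem_top)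
  weight_bot := D.W_bot
  weight_top := D.W_top
  inf_le {p q m} hpq x hx := by
    have hdisj := ((h.2.2 m).2.2.2 p).disjoint
    rw [show m - p + 1 = q by lia, Submodule.disjoint_def] at hdisj
    exact mk_eq_zero_iff.1 (hdisj (GrW.mk D.W m ⟨x, hx.1.2⟩)
      (mk_mem_grF.2 (Submodule.mem_sup_left hx.1)) (mk_mem_map_grF.2 hx.2))
  le_sup {p q m} hpq x hx := by
    have hcodisj := ((h.2.2 m).2.2.2 p).codisjoint
    rw [show m - p + 1 = q by lia, codisjoint_iff] at hcodisj
    obtain ⟨f, hf, g, hg, hfg⟩ := Submodule.mem_sup.1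
      (hcodisj ▸ Submodule.mem_top (x := GrW.mk D.W m ⟨x, hx⟩))
    obtain ⟨f, rfl⟩ := exists_mk f
    obtain ⟨g, rfl⟩ := exists_mk g
    have hx' : x - (f + g) ∈ D.W (m - 1) :=
      (mk_eq_mk_iff (x := ⟨x, hx⟩) (y := f + g)).1 (by rw [map_add, hfg])
    have hle : D.grPre m (F p) ⊔ D.grPre m ((F q).map D.conj) ≤
        F p ⊓ D.W m ⊔ ((F q).map D.conj ⊓ D.W m ⊔ D.W (m - 1)) :=
      sup_le (sup_le_sup_left le_sup_right _) le_sup_right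
    rw [← add_sub_cancel ((f : V) + g) x]
    exact add_mem (hle (Submodule.add_mem_sup (mk_mem_grF.1 hf) (mk_mem_map_grF.1 hg)))
      (Submodule.mem_sup_right (Submodule.mem_sup_right hx'))

theorem isDeligneBigrading_deligne [FiniteDimensional ℂ V] {F : DecFiltration V}
    (h : D.IsMixedHodge F) :
    D.IsDeligneBigrading F (deligne F.toFun (fun q => (F q).map D.conj) D.W) where
  isInternal := h.opposedFiltrations.isInternal_deligne
  hodge p := (h.opposedFiltrations.left_eq_part p).trans
    (part_pieces_eq_iSup _ fun rs => p ≤ rs.1)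
  weight k := (h.opposedFiltrations.weight_eq_part k).trans
    (part_pieces_eq_iSup _ fun rs => rs.1 + rs.2 ≤ k)
  conj p q := by
    rw [map_conj_deligne, ← part_pieces_eq_iSup_and]
    simpa using h.opposedFiltrations.deligne_sup_part_eq p q

theorem IsMixedHodge.isDeligneBigrading [FiniteDimensional ℂ V] {F : DecFiltration V}
    (h : D.IsMixedHodge F) : D.IsDeligneBigrading F (D.I F) :=
  Classical.epsilon_spec ⟨_, isDeligneBigrading_deligne h⟩

namespace IsDeligneBigrading

variable {F : DecFiltration V} {I : ℤ → ℤ → Submodule ℂ V} (hI : D.IsDeligneBigrading F I)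
include hI

theorem internal : DirectSum.IsInternal (pieces I) := hI.isInternal

theorem F_eq (p : ℤ) : F p = part (pieces I) {rs | p ≤ rs.1} :=
  (hI.hodge p).trans (part_pieces_eq_iSup I fun rs => p ≤ rs.1).symm

theorem W_eq (k : ℤ) : D.W k = part (pieces I) {rs | rs.1 + rs.2 ≤ k} :=
  (hI.weight k).trans (part_pieces_eq_iSup I fun rs => rs.1 + rs.2 ≤ k).symm

theorem F_inf_W_eq (p k : ℤ) :
    F p ⊓ D.W k = part (pieces I) {rs | p ≤ rs.1 ∧ rs.1 + rs.2 ≤ k} := by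
  rw [hI.F_eq, hI.W_eq, part_inf_part hI.internal.submodule_iSupIndep]
  rfl

theorem le_F (p q : ℤ) : I p q ≤ F p :=
  hI.F_eq p ▸ le_part (J := pieces I) (i := (p, q)) (le_refl p)

theorem le_W (p q : ℤ) : I p q ≤ D.W (p + q) :=
  hI.W_eq (p + q) ▸ le_part (J := pieces I) (i := (p, q)) (le_refl (p + q))

theorem exists_conj_mem {p q : ℤ} {x : V} (hx : x ∈ I p q) :
    ∃ y ∈ F q ⊓ D.W (p + q), x - D.conj y ∈ D.W (p + q - 1) := by
  have hconj := hI.conj p q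
  rw [← part_pieces_eq_iSup_and] at hconj
  obtain ⟨_, ⟨y, hy, rfl⟩, w, hw, rfl⟩ := Submodule.mem_sup.1
    (hconj.le (Submodule.mem_sup_left hx))
  refine ⟨y, ⟨hI.le_F q p hy, add_comm q p ▸ hI.le_W q p hy⟩, ?_⟩
  rw [add_sub_cancel_left, hI.W_eq]
  refine part_mono (fun rs h => ?_) hw
  have := h.1
  have := h.2
  exact (by lia : rs.1 + rs.2 ≤ p + q - 1)

end IsDeligneBigrading

end GradedPolarizationData

/-! ### The Lie algebra of `G_ℂ` and its bigrading -/

namespace BigradedSum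

theorem bilin_eq_zero_of_mem_part {ι R V M : Type*} [CommRing R] [AddCommGroup V] [Module R V]
    [AddCommGroup M] [Module R M] {J : ι → Submodule R V} {A B : Set ι} {b : V →ₗ[R] V →ₗ[R] M}
    (h : ∀ i ∈ A, ∀ j ∈ B, ∀ x ∈ J i, ∀ y ∈ J j, b x y = 0) {x y : V} (hx : x ∈ part J A)
    (hy : y ∈ part J B) : b x y = 0 := by
  have hker (i : ι) (hi : i ∈ A) : J i ≤ LinearMap.ker (b.flip y) := fun z hz =>
    (part_le fun j hj w hw => h i hi j hj z hz w hw : part J B ≤ LinearMap.ker (b z)) hy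
  exact part_le hker hx

end BigradedSum

namespace GradedPolarizationData

open BigradedSum

section Form

variable {V : Type*} [AddCommGroup V] [Module ℂ V] [Module ℚ V] (D : GradedPolarizationData V)

/-- A linear projection of `V` onto `W_k`. -/
def projW (k : ℤ) : V →ₗ[ℂ] D.W k :=
  (LinearMap.exists_leftInverse_of_injective (D.W k).subtype (Submodule.ker_subtype _)).choose

theorem projW_apply {k : ℤ} {x : V} (hx : x ∈ D.W k) : D.projW k x = ⟨x, hx⟩ :=
  LinearMap.congr_fun (LinearMap.exists_leftInverse_of_injective (D.W k).subtype
    (Submodule.ker_subtype _)).choose_spec ⟨x, hx⟩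

/-- A bilinear form on `V` that induces `S_k` on `Gr^W_k`. Only its values on `W_k` are
canonical; it saves the coercions to `W_k` in computations with `S_k`. -/
def form (k : ℤ) : V →ₗ[ℂ] V →ₗ[ℂ] ℂ :=
  (D.S k).compl₁₂ (GrW.mk D.W k ∘ₗ D.projW k) (GrW.mk D.W k ∘ₗ D.projW k)

theorem form_apply {k : ℤ} {x y : V} (hx : x ∈ D.W k) (hy : y ∈ D.W k) :
    D.form k x y = D.S k (GrW.mk D.W k ⟨x, hx⟩) (GrW.mk D.W k ⟨y, hy⟩) := by
  simp only [form, LinearMap.compl₁₂_apply, LinearMap.comp_apply, projW_apply D hx,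
    projW_apply D hy]

variable {D}

theorem form_eq_zero_of_left_mem {k : ℤ} {x y : V} (hx : x ∈ D.W (k - 1)) (hy : y ∈ D.W k) :
    D.form k x y = 0 := by
  have hxk : x ∈ D.W k := D.W_mono (by lia) hx
  rw [form_apply D hxk hy, mk_eq_zero_iff.2 hx, LinearMap.map_zero₂]

theorem form_eq_zero_of_right_mem {k : ℤ} {x y : V} (hx : x ∈ D.W k) (hy : y ∈ D.W (k - 1)) :
    D.form k x y = 0 := by
  have hyk : y ∈ D.W k := D.W_mono (by lia) hy
  rw [form_apply D hx hyk, (mk_eq_zero_iff (x := ⟨y, hyk⟩)).2 hy, map_zero]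

theorem form_swap {k : ℤ} {x y : V} (hx : x ∈ D.W k) (hy : y ∈ D.W k) :
    D.form k x y = (-1 : ℂ) ^ k * D.form k y x := by
  rw [form_apply D hx hy, form_apply D hy hx, D.S_parity]

theorem form_conj_conj {k : ℤ} {x y : V} (hx : x ∈ D.W k) (hy : y ∈ D.W k) :
    D.form k (D.conj x) (D.conj y) = starRingEnd ℂ (D.form k x y) := by
  rw [← D.W_rational k] at hx hy
  induction hx using Submodule.span_induction with
  | mem x hx =>
    induction hy using Submodule.span_induction with
    | mem y hy =>
      obtain ⟨r, hr⟩ := D.S_rational k ⟨x, hx.2⟩ ⟨y, hy.2⟩ hx.1 hy.1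
      rw [D.conj_rational hx.1, D.conj_rational hy.1, form_apply D hx.2 hy.2, hr, map_ratCast]
    | zero => simp only [map_zero]
    | add y z _ _ hy hz => simp only [map_add, hy, hz]
    | smul c y _ hy => simp only [LinearMap.map_smulₛₗ, map_smul, smul_eq_mul, map_mul, hy]
  | zero => simp only [map_zero, LinearMap.zero_apply]
  | add x z _ _ hx hz => simp only [map_add, LinearMap.add_apply, hx, hz]
  | smul c x _ hx =>
    simp only [LinearMap.map_smulₛₗ, map_smul, LinearMap.smul_apply, smul_eq_mul, map_mul, hx]

variable (D) in
/-- The first Riemann bilinear relation `S_k(F^p Gr^W_k, F^{k-p+1} Gr^W_k) = 0`, in terms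
of `V`. -/
def FirstRelation (F : DecFiltration V) : Prop :=
  ∀ k p, ∀ x ∈ F p, ∀ y ∈ F (k - p + 1), x ∈ D.W k → y ∈ D.W k → D.form k x y = 0

theorem firstRelation_iff {F : DecFiltration V} : D.FirstRelation F ↔
    ∀ k p, ∀ u ∈ D.grF F k p, ∀ v ∈ D.grF F k (k - p + 1), D.S k u v = 0 := by
  refine forall₂_congr fun k p => ⟨?_, fun h x hx y hy hxW hyW => ?_⟩
  · rintro h u ⟨x, hx, rfl⟩ v ⟨y, hy, rfl⟩
    exact (form_apply D x.2 y.2).symm.trans (h x hx y hy x.2 y.2)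
  · rw [form_apply D hxW hyW]
    exact h _ ⟨⟨x, hxW⟩, hx, rfl⟩ _ ⟨⟨y, hyW⟩, hy, rfl⟩

namespace IsDeligneBigrading

variable {F : DecFiltration V} {I : ℤ → ℤ → Submodule ℂ V} (hI : D.IsDeligneBigrading F I)
include hI

theorem bilin_eq_zero {k : ℤ} {b : V →ₗ[ℂ] V →ₗ[ℂ] ℂ}
    (hleft : ∀ x ∈ D.W (k - 1), ∀ y ∈ D.W k, b x y = 0)
    (hright : ∀ x ∈ D.W k, ∀ y ∈ D.W (k - 1), b x y = 0)
    (hpieces : ∀ i j : ℤ × ℤ, i.1 + i.2 = k → j.1 + j.2 = k →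
      ∀ x ∈ I i.1 i.2, ∀ y ∈ I j.1 j.2, b x y = 0)
    {x y : V} (hx : x ∈ D.W k) (hy : y ∈ D.W k) : b x y = 0 := by
  rw [hI.W_eq] at hx hy
  refine bilin_eq_zero_of_mem_part (fun i hi j hj x hx y hy => ?_) hx hy
  have hxW : x ∈ D.W k := D.W_mono hi (hI.le_W _ _ hx)
  have hyW : y ∈ D.W k := D.W_mono hj (hI.le_W _ _ hy)
  rcases (show i.1 + i.2 ≤ k from hi).lt_or_eq with hik | hik
  · exact hleft x (D.W_mono (by lia) (hI.le_W _ _ hx)) y hyW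
  rcases (show j.1 + j.2 ≤ k from hj).lt_or_eq with hjk | hjk
  · exact hright x hxW y (D.W_mono (by lia) (hI.le_W _ _ hy))
  exact hpieces i j hik hjk x hx y hy

theorem form_eq_zero (hS : D.FirstRelation F) {k p q r s : ℤ} (hpq : p + q = k) (hrs : r + s = k)
    (hne : p + r ≠ k) {x y : V} (hx : x ∈ I p q) (hy : y ∈ I r s) : D.form k x y = 0 := by
  rcases lt_or_gt_of_ne hne with hlt | hgt
  · obtain ⟨x', ⟨hx'F, hx'W⟩, hxx'⟩ := hI.exists_conj_mem hx
    obtain ⟨y', ⟨hy'F, hy'W⟩, hyy'⟩ := hI.exists_conj_mem hy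
    rw [hpq] at hx'W hxx'
    rw [hrs] at hy'W hyy'
    have hyW : y ∈ D.W k := hrs ▸ hI.le_W r s hy
    calc D.form k x y
        = D.form k (x - D.conj x') y + D.form k (D.conj x') (y - D.conj y') +
            D.form k (D.conj x') (D.conj y') := by
          simp only [map_sub, LinearMap.sub_apply]
          ring
      _ = starRingEnd ℂ (D.form k x' y') := by
          rw [form_eq_zero_of_left_mem hxx' hyW,
            form_eq_zero_of_right_mem (D.conj_mem_W k x' hx'W) hyy', form_conj_conj hx'W hy'W,
            zero_add, zero_add]
      _ = 0 := by
          rw [hS k q x' hx'F y' (F.antitone' (by lia) hy'F) hx'W hy'W, map_zero]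
  · exact hS k p x (hI.le_F p q hx) y (F.antitone' (by lia) (hI.le_F r s hy))
      (hpq ▸ hI.le_W p q hx) (hrs ▸ hI.le_W r s hy)

theorem form_proj_eq_zero (hS : D.FirstRelation F) {k r s : ℤ} (hrs : r + s = k) {v y : V}
    (hv : v ∈ D.W k) (hy : y ∈ I r s) {l : ℤ × ℤ} (hl : l ≠ (s, r)) :
    D.form k (proj hI.internal l v) y = 0 := by
  have hl_mem : proj hI.internal l v ∈ I l.1 l.2 := proj_mem hI.internal l v
  rcases lt_trichotomy (l.1 + l.2) k with hlt | heq | hgt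
  · exact form_eq_zero_of_left_mem (D.W_mono (by lia) (hI.le_W _ _ hl_mem))
      (hrs ▸ hI.le_W _ _ hy)
  · exact hI.form_eq_zero hS heq hrs (fun hlr => hl (Prod.ext (by lia) (by lia))) hl_mem hy
  · rw [hI.W_eq] at hv
    rw [proj_of_mem_part hI.internal hv (by simpa using hgt), LinearMap.map_zero₂]

theorem form_proj [IsNoetherian ℂ V] (hS : D.FirstRelation F) {k r s : ℤ} (hrs : r + s = k)
    {v y : V} (hv : v ∈ D.W k) (hy : y ∈ I r s) (l : ℤ × ℤ) :
    D.form k (proj hI.internal l v) y = if l = (s, r) then D.form k v y else 0 := by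
  split_ifs with hl
  · obtain ⟨t, ht⟩ := exists_finset_eq_bot hI.internal.submodule_iSupIndep
    have hsum := sum_proj hI.internal (s := insert l t)
      (fun i hi => ht i fun hit => hi (Finset.mem_insert_of_mem hit)) v
    conv_rhs => rw [← hsum, map_sum, LinearMap.sum_apply]
    exact (Finset.sum_eq_single_of_mem l (Finset.mem_insert_self l t) fun j _ hj =>
      hI.form_proj_eq_zero hS hrs hv hy (hl ▸ hj)).symm
  · exact hI.form_proj_eq_zero hS hrs hv hy hl

end IsDeligneBigrading

end Form

section Endomorphisms

variable {V : Type*} [NormedAddCommGroup V] [NormedSpace ℂ V]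

/-- The endomorphisms that lower the first index of the bigrading `I`, a complement of the
stabilizer of `F` in `End V`. -/
def lowering (I : ℤ → ℤ → Submodule ℂ V) : Submodule ℂ (V →L[ℂ] V) :=
  endOfDegree (pieces I) {d | d.1 < 0}

/-- The Lie algebra of the stabilizer of `F`: the endomorphisms of `V` that preserve `F`. -/
def stabilizer (F : DecFiltration V) : Submodule ℂ (V →L[ℂ] V) where
  carrier := {α | ∀ p, ∀ x ∈ F p, α x ∈ F p}
  add_mem' ha hb p x hx := Submodule.add_mem _ (ha p x hx) (hb p x hx)
  zero_mem' p x _ := by simp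
  smul_mem' c _ ha p x hx := Submodule.smul_mem _ c (ha p x hx)

theorem mul_mem_lowering {I : ℤ → ℤ → Submodule ℂ V} {α β : V →L[ℂ] V} (hα : α ∈ lowering I)
    (hβ : β ∈ lowering I) : α * β ∈ lowering I :=
  mul_mem_endOfDegree hα hβ fun _ ha _ hb => Set.mem_ofPred_eq ▸ add_neg ha hb

end Endomorphisms

section LieAlgebra

variable {V : Type*} [NormedAddCommGroup V] [NormedSpace ℂ V] [Module ℚ V]
  {D : GradedPolarizationData V}

theorem mem_lieGC_iff {α : V →L[ℂ] V} : α ∈ D.lieGC ↔ (∀ k, ∀ x ∈ D.W k, α x ∈ D.W k) ∧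
    ∀ k, ∀ x ∈ D.W k, ∀ y ∈ D.W k, D.form k (α x) y + D.form k x (α y) = 0 := by
  constructor
  · rintro ⟨hW, hskew⟩
    refine ⟨hW, fun k x hx y hy => ?_⟩
    rw [form_apply D (hW k x hx) hy, form_apply D hx (hW k y hy)]
    exact hskew k ⟨x, hx⟩ ⟨y, hy⟩
  · rintro ⟨hW, hskew⟩
    refine ⟨hW, fun k x y => ?_⟩
    rw [← form_apply D (hW k x x.2) y.2, ← form_apply D x.2 (hW k y y.2)]
    exact hskew k x x.2 y y.2

theorem commutator_mem_lieGC {α β : V →L[ℂ] V} (hα : α ∈ D.lieGC) (hβ : β ∈ D.lieGC) :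
    α * β - β * α ∈ D.lieGC := by
  rw [mem_lieGC_iff] at *
  refine ⟨fun k x hx => sub_mem (hα.1 k _ (hβ.1 k x hx)) (hβ.1 k _ (hα.1 k x hx)),
    fun k x hx y hy => ?_⟩
  have hαβx := hα.2 k _ (hβ.1 k x hx) y hy
  have hαβy := hα.2 k x hx _ (hβ.1 k y hy)
  have hβαx := hβ.2 k _ (hα.1 k x hx) y hy
  have hβαy := hβ.2 k x hx _ (hα.1 k y hy)
  simp only [sub_apply, mul_apply_eq_comp, map_sub, LinearMap.sub_apply]
  linear_combination hαβx - hβαx + hαβy - hβαy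

namespace IsDeligneBigrading

variable {F : DecFiltration V} {I : ℤ → ℤ → Submodule ℂ V} (hI : D.IsDeligneBigrading F I)
include hI

theorem mem_endOfDegree_weight_iff {α : V →L[ℂ] V} :
    α ∈ endOfDegree (pieces I) {d | d.1 + d.2 ≤ 0} ↔ ∀ k, ∀ x ∈ D.W k, α x ∈ D.W k := by
  have hiff := mem_endOfDegree_le_iff (J := pieces I) (α := α)
    (-(AddMonoidHom.fst ℤ ℤ + AddMonoidHom.snd ℤ ℤ)) 0
  simp only [AddMonoidHom.neg_apply, AddMonoidHom.add_apply, AddMonoidHom.coe_fst,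
    AddMonoidHom.coe_snd, zero_add, le_neg (b := _ + _), neg_zero] at hiff
  simp only [hiff, hI.W_eq]
  exact ⟨fun h k => by simpa only [neg_neg] using h (-k), fun h k => h (-k)⟩

theorem mem_endOfDegree_left_iff (c : ℤ) {α : V →L[ℂ] V} :
    α ∈ endOfDegree (pieces I) {d | c ≤ d.1} ↔ ∀ p, ∀ x ∈ F p, α x ∈ F (c + p) := by
  simp only [hI.F_eq]
  exact mem_endOfDegree_le_iff (AddMonoidHom.fst ℤ ℤ) c

variable [FiniteDimensional ℂ V]

theorem component_mem_lieGC (hS : D.FirstRelation F) (d : ℤ × ℤ) {α : V →L[ℂ] V}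
    (hα : α ∈ D.lieGC) : component hI.internal d α ∈ D.lieGC := by
  rw [mem_lieGC_iff] at hα ⊢
  set γ := component hI.internal d α with hγ
  have hW : ∀ k, ∀ x ∈ D.W k, γ x ∈ D.W k := hI.mem_endOfDegree_weight_iff.1
    (component_mem_endOfDegree hI.internal d (hI.mem_endOfDegree_weight_iff.2 hα.1))
  refine ⟨hW, fun k x hx y hy => hI.bilin_eq_zero
    (b := D.form k ∘ₗ γ.toLinearMap + (D.form k).compl₂ γ.toLinearMap)
    (fun x hx y hy => ?_) (fun x hx y hy => ?_) (fun i j hi hj x hx y hy => ?_) hx hy⟩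
  · change D.form k (γ x) y + D.form k x (γ y) = 0
    rw [form_eq_zero_of_left_mem (hW _ x hx) hy, form_eq_zero_of_left_mem hx (hW _ y hy), add_zero]
  · change D.form k (γ x) y + D.form k x (γ y) = 0
    rw [form_eq_zero_of_right_mem (hW _ x hx) hy, form_eq_zero_of_right_mem hx (hW _ y hy),
      add_zero]
  · change D.form k (γ x) y + D.form k x (γ y) = 0
    have hxW : x ∈ D.W k := hi ▸ hI.le_W _ _ hx
    have hyW : y ∈ D.W k := hj ▸ hI.le_W _ _ hy
    have hiff : i + d = (j.2, j.1) ↔ j + d = (i.2, i.1) := by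
      simp only [Prod.ext_iff, Prod.fst_add, Prod.snd_add]
      lia
    rw [form_swap hxW (hW _ _ hyW), hγ, component_apply hI.internal d α hx,
      component_apply hI.internal d α hy, hI.form_proj hS hj (hα.1 _ _ hxW) hy,
      hI.form_proj hS hi (hα.1 _ _ hyW) hx]
    simp only [hiff]
    split_ifs
    · rw [← form_swap hxW (hα.1 _ _ hyW)]
      exact hα.2 k x hxW y hyW
    · rw [mul_zero, add_zero]

end IsDeligneBigrading

theorem gl_eq (F : DecFiltration V) (r s : ℤ) :
    D.gl F r s = endOfDegree (pieces (D.I F)) {(r, s)} := by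
  ext α
  rw [mem_endOfDegree_singleton, Prod.forall]
  rfl

variable {F : DecFiltration V} {I : ℤ → ℤ → Submodule ℂ V} (hI : D.IsDeligneBigrading F I)

namespace IsDeligneBigrading
include hI

theorem stabilizer_eq : stabilizer F = endOfDegree (pieces I) {d | 0 ≤ d.1} := by
  ext α
  simp only [hI.mem_endOfDegree_left_iff, zero_add]
  rfl

theorem lieGC_le : D.lieGC ≤ endOfDegree (pieces I) {d | d.1 + d.2 ≤ 0} :=
  fun _ hα => hI.mem_endOfDegree_weight_iff.2 (mem_lieGC_iff.1 hα).1

variable [FiniteDimensional ℂ V]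

theorem isCompl_lowering_stabilizer : IsCompl (lowering I) (stabilizer F) := by
  rw [hI.stabilizer_eq]
  refine isCompl_endOfDegree hI.internal (IsCompl.of_eq ?_ ?_)
  · ext d
    simp
  · ext d
    simpa using lt_or_ge d.1 0

theorem isNilpotent_of_mem_lowering {α : V →L[ℂ] V} (hα : α ∈ lowering I) : IsNilpotent α :=
  isNilpotent_of_mem_endOfDegree hI.internal (AddMonoidHom.fst ℤ ℤ) (fun _ hd => hd) hα

end IsDeligneBigrading

end LieAlgebra

section Subalgebras

variable {V : Type*} [NormedAddCommGroup V] [NormedSpace ℂ V] [Module ℚ V]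
  {D : GradedPolarizationData V} {F : DecFiltration V} (hI : D.IsDeligneBigrading F (D.I F))
include hI

theorem iSupIndep_g : iSupIndep fun rs : ℤ × ℤ => D.g F rs.1 rs.2 := by
  refine (iSupIndep_endOfDegree hI.internal).mono fun rs => ?_
  rw [g, gl_eq]
  exact inf_le_left

variable [FiniteDimensional ℂ V] (hS : D.FirstRelation F)
include hS

theorem iSup_g_eq (A : Set (ℤ × ℤ)) :
    ⨆ rs ∈ A, D.g F rs.1 rs.2 = endOfDegree (pieces (D.I F)) A ⊓ D.lieGC := by
  simp only [g, gl_eq]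
  exact (endOfDegree_inf_eq_iSup hI.internal A fun d _ => hI.component_mem_lieGC hS d).symm

theorem q_eq : D.q F = lowering (D.I F) ⊓ D.lieGC := by
  have hq : D.q F = ⨆ rs ∈ {d : ℤ × ℤ | d.1 < 0 ∧ d.1 + d.2 ≤ 0}, D.g F rs.1 rs.2 := by
    simp only [q, iSup_prod, Set.mem_ofPred_eq, iSup_and]
  rw [hq, iSup_g_eq hI hS, lowering, ← inf_eq_right.2 hI.lieGC_le, ← inf_assoc, ← inf_assoc,
    endOfDegree_inf hI.internal.submodule_iSupIndep,
    endOfDegree_inf hI.internal.submodule_iSupIndep]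
  congr 2
  ext d
  simp only [Set.mem_inter_iff, Set.mem_ofPred_eq]
  tauto

theorem mem_horizontal {α : V →L[ℂ] V} (hα : α ∈ D.q F)
    (hF : ∀ p, ∀ x ∈ F p, α x ∈ F (p - 1)) : α ∈ D.horizontal F := by
  have hhor : ⨆ rs ∈ {d : ℤ × ℤ | d.1 = -1 ∧ d.2 ≤ 1}, D.g F rs.1 rs.2 ≤ D.horizontal F := by
    refine iSup₂_le ?_
    rintro ⟨_, k⟩ ⟨rfl, hk⟩
    exact le_iSup₂_of_le k hk le_rfl
  have hdeg : α ∈ endOfDegree (pieces (D.I F)) {d | -1 ≤ d.1} :=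
    (hI.mem_endOfDegree_left_iff (-1)).2 fun p x hx => neg_add_eq_sub 1 p ▸ hF p x hx
  rw [q_eq hI hS] at hα
  have hinf := Submodule.mem_inf.2 ⟨hdeg, Submodule.mem_inf.2 ⟨hα.1, hI.lieGC_le hα.2⟩⟩
  rw [lowering, endOfDegree_inf hI.internal.submodule_iSupIndep,
    endOfDegree_inf hI.internal.submodule_iSupIndep] at hinf
  refine hhor ((iSup_g_eq hI hS _).ge ⟨endOfDegree_mono (fun d hd => ?_) hinf, hα.2⟩)
  simp only [Set.mem_inter_iff, Set.mem_ofPred_eq] at hd ⊢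
  lia

attribute [local instance 100] LieRing.ofAssociativeRing

theorem isNilpotentLieSubalgebra_q : IsNilpotentLieSubalgebra (D.q F) := by
  let L : LieSubalgebra ℂ (V →L[ℂ] V) :=
    { D.q F with
      lie_mem' {α β} hα hβ := by
        change α ∈ D.q F at hα
        change β ∈ D.q F at hβ
        change ⁅α, β⁆ ∈ D.q F
        rw [q_eq hI hS] at *
        rw [Ring.lie_def]
        exact ⟨sub_mem (mul_mem_lowering hα.1 hβ.1) (mul_mem_lowering hβ.1 hα.1),
          commutator_mem_lieGC hα.2 hβ.2⟩ }
  refine ⟨L, rfl, (LieAlgebra.isNilpotent_iff_forall (R := ℂ)).2 fun α => ?_⟩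
  have hα : (α : V →L[ℂ] V) ∈ D.q F := α.2
  rw [q_eq hI hS] at hα
  exact LieAlgebra.isNilpotent_ad_of_isNilpotent (L := L) (hI.isNilpotent_of_mem_lowering hα.1)

end Subalgebras

end GradedPolarizationData

/-! ### Exponentials of endomorphisms -/

namespace EndExp

section BanachAlgebra

variable {A : Type*} [NormedRing A] [NormedAlgebra ℂ A] [CompleteSpace A]

theorem exp_neg_mul (u : A) : NormedSpace.exp (-u) * NormedSpace.exp u = 1 := by
  let _ : NormedAlgebra ℚ A := NormedAlgebra.restrictScalars ℚ ℂ A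
  rw [← NormedSpace.exp_add_of_commute (Commute.refl u).neg_left, neg_add_cancel,
    NormedSpace.exp_zero]

theorem exp_mul_neg (u : A) : NormedSpace.exp u * NormedSpace.exp (-u) = 1 := by
  simpa only [neg_neg] using exp_neg_mul (-u)

/-- `exp u` as a unit. -/
def expUnit (u : A) : Aˣ :=
  ⟨NormedSpace.exp u, NormedSpace.exp (-u), exp_mul_neg u, exp_neg_mul u⟩

theorem continuous_exp : Continuous (NormedSpace.exp : A → A) := by
  let _ : NormedAlgebra ℚ A := NormedAlgebra.restrictScalars ℚ ℂ A
  exact NormedSpace.exp_continuous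

theorem exp_natCast_smul (n : ℕ) (u : A) :
    NormedSpace.exp ((n : ℂ) • u) = NormedSpace.exp u ^ n := by
  let _ : NormedAlgebra ℚ A := NormedAlgebra.restrictScalars ℚ ℂ A
  rw [Nat.cast_smul_eq_nsmul, NormedSpace.exp_nsmul]

theorem exists_polynomial_exp_smul {u : A} (hu : IsNilpotent u) (f : A →ₗ[ℂ] ℂ) :
    ∃ P : Polynomial ℂ, (∀ t, P.eval t = f (NormedSpace.exp (t • u))) ∧ P.coeff 1 = f u := by
  obtain ⟨N, hN⟩ := hu
  have hexp (t : ℂ) : NormedSpace.exp (t • u) =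
      ∑ n ∈ Finset.range (N + 2), (n.factorial : ℂ)⁻¹ • (t • u) ^ n :=
    (NormedSpace.exp_series_hasSum_exp' (𝕂 := ℂ) (t • u)).unique <|
      hasSum_sum_of_ne_finset_zero fun n hn => by
        rw [smul_pow, pow_eq_zero_of_le (by simp at hn; lia) hN, smul_zero, smul_zero]
  refine ⟨∑ n ∈ Finset.range (N + 2), Polynomial.monomial n (f ((n.factorial : ℂ)⁻¹ • u ^ n)),
    fun t => ?_, ?_⟩
  · simp only [hexp, smul_pow, map_sum, map_smul, smul_eq_mul, Polynomial.eval_finsetSum,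
      Polynomial.eval_monomial]
    exact Finset.sum_congr rfl fun n _ => by ring
  · simp [Polynomial.coeff_monomial]

/-- `exp (t u)` and `exp (t v)` are polynomials in `t`, so linear functionals that agree on them at
the natural numbers agree on them for every `t`, and hence on the derivatives at `t = 0`. -/
theorem apply_eq_apply_of_exp_pow {u v : A} (hu : IsNilpotent u) (hv : IsNilpotent v)
    {f g : A →ₗ[ℂ] ℂ} (h : ∀ n : ℕ, f (NormedSpace.exp u ^ n) = g (NormedSpace.exp v ^ n)) :
    f u = g v := by
  obtain ⟨P, hP, hPu⟩ := exists_polynomial_exp_smul hu f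
  obtain ⟨Q, hQ, hQv⟩ := exists_polynomial_exp_smul hv g
  rw [← hPu, ← hQv, Polynomial.eq_of_infinite_eval_eq P Q <|
    (Set.infinite_range_of_injective (Nat.cast_injective (R := ℂ))).mono ?_]
  rintro _ ⟨n, rfl⟩
  rw [Set.mem_ofPred_eq, hP, hQ, exp_natCast_smul, exp_natCast_smul, h]

end BanachAlgebra

section Apply

variable {V : Type*} [NormedAddCommGroup V] [NormedSpace ℂ V]

theorem pow_apply_mem {u : V →L[ℂ] V} {P : Submodule ℂ V} (hu : ∀ x ∈ P, u x ∈ P) (n : ℕ) {x : V}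
    (hx : x ∈ P) : (u ^ n) x ∈ P := by
  have hmaps : Set.MapsTo u P P := fun _ hy => hu _ hy
  rw [FunLike.coe_pow_eq_iterate]
  exact hmaps.iterate n hx

variable [CompleteSpace V]

theorem exp_neg_apply (u : V →L[ℂ] V) (x : V) :
    NormedSpace.exp (-u) (NormedSpace.exp u x) = x :=
  DFunLike.congr_fun (exp_neg_mul u) x

theorem exp_apply_neg (u : V →L[ℂ] V) (x : V) :
    NormedSpace.exp u (NormedSpace.exp (-u) x) = x :=
  DFunLike.congr_fun (exp_mul_neg u) x

theorem finrank_map_exp (u : V →L[ℂ] V) (P : Submodule ℂ V) :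
    Module.finrank ℂ (P.map (NormedSpace.exp u : V →L[ℂ] V).toLinearMap) =
      Module.finrank ℂ P :=
  (P.equivMapOfInjective _ (Function.LeftInverse.injective (exp_neg_apply u))).finrank_eq.symm

theorem hasSum_exp_apply (u : V →L[ℂ] V) (x : V) :
    HasSum (fun n : ℕ => (n.factorial : ℂ)⁻¹ • (u ^ n) x) (NormedSpace.exp u x) :=
  (NormedSpace.exp_series_hasSum_exp' (𝕂 := ℂ) u).mapL (ContinuousLinearMap.apply ℂ V x)

theorem hasDerivAt_exp_smul_apply (u : V →L[ℂ] V) (x : V) (t : ℂ) :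
    HasDerivAt (fun t : ℂ => NormedSpace.exp (t • u) x) (u (NormedSpace.exp (t • u) x)) t :=
  (ContinuousLinearMap.apply ℂ V x).hasFDerivAt.comp_hasDerivAt t
    (hasDerivAt_exp_smul_const' (𝕂 := ℂ) u t)

end Apply

variable {V : Type*} [NormedAddCommGroup V] [NormedSpace ℂ V] [FiniteDimensional ℂ V]
  {u : V →L[ℂ] V} {P : Submodule ℂ V}

theorem exp_apply_sub_mem (hu : ∀ x ∈ P, u x ∈ P) {x : V} (hx : u x ∈ P) :
    NormedSpace.exp u x - x ∈ P := by
  have hsum := (hasSum_nat_add_iff' 1).2 (hasSum_exp_apply u x)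
  simp only [Finset.sum_range_one, Nat.factorial_zero, Nat.cast_one, inv_one, pow_zero, one_smul,
    one_apply_eq_self] at hsum
  refine P.closed_of_finiteDimensional.mem_of_tendsto hsum
    (Filter.Eventually.of_forall fun s => P.sum_mem fun n _ => P.smul_mem _ ?_)
  rw [pow_succ]
  exact pow_apply_mem hu n hx

theorem exp_apply_mem (hu : ∀ x ∈ P, u x ∈ P) {x : V} (hx : x ∈ P) :
    NormedSpace.exp u x ∈ P := by
  simpa only [sub_add_cancel] using P.add_mem (exp_apply_sub_mem hu (hu x hx)) hx

theorem bilin_exp (b : V →ₗ[ℂ] V →ₗ[ℂ] ℂ) (hP : ∀ x ∈ P, u x ∈ P)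
    (h : ∀ x ∈ P, ∀ y ∈ P, b (u x) y + b x (u y) = 0) :
    ∀ x ∈ P, ∀ y ∈ P, b (NormedSpace.exp u x) (NormedSpace.exp u y) = b x y := by
  intro x hx y hy
  have hmem (t : ℂ) {z : V} (hz : z ∈ P) : NormedSpace.exp (t • u) z ∈ P :=
    exp_apply_mem (fun w hw => P.smul_mem t (hP w hw)) hz
  have hderiv (t : ℂ) :
      HasDerivAt (fun t : ℂ => b (NormedSpace.exp (t • u) x) (NormedSpace.exp (t • u) y)) 0 t := by
    have hbilin := ((LinearMap.toContinuousBilinearMap b).hasFDerivAt_of_bilinear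
      (hasDerivAt_exp_smul_apply u x t).hasFDerivAt
      (hasDerivAt_exp_smul_apply u y t).hasFDerivAt).hasDerivAt
    refine hbilin.congr_deriv ?_
    simpa [add_comm] using h _ (hmem t hx) _ (hmem t hy)
  simpa using is_const_of_deriv_eq_zero (fun t => (hderiv t).differentiableAt)
    (fun t => (hderiv t).deriv) 1 0

theorem apply_mem_of_exp_apply_mem (hu : IsNilpotent u) (h : ∀ x ∈ P, NormedSpace.exp u x ∈ P) :
    ∀ x ∈ P, u x ∈ P := by
  intro x hx
  rw [← Submodule.Quotient.mk_eq_zero, ← Module.forall_dual_apply_eq_zero_iff ℂ]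
  intro φ
  refine apply_eq_apply_of_exp_pow (A := V →L[ℂ] V) hu hu (g := 0)
    (f := φ ∘ₗ P.mkQ ∘ₗ (ContinuousLinearMap.apply ℂ V x).toLinearMap) fun n => ?_
  have hzero : P.mkQ ((NormedSpace.exp u ^ n) x) = 0 :=
    (Submodule.Quotient.mk_eq_zero P).2 (pow_apply_mem h n hx)
  exact (congr_arg φ hzero).trans (map_zero φ)

theorem bilin_of_exp (hu : IsNilpotent u) (b : V →ₗ[ℂ] V →ₗ[ℂ] ℂ)
    (hP : ∀ x ∈ P, NormedSpace.exp u x ∈ P)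
    (h : ∀ x ∈ P, ∀ y ∈ P, b (NormedSpace.exp u x) (NormedSpace.exp u y) = b x y) :
    ∀ x ∈ P, ∀ y ∈ P, b (u x) y + b x (u y) = 0 := by
  intro x hx y hy
  have hinv : ∀ z ∈ P, NormedSpace.exp (-u) z ∈ P := fun z hz =>
    exp_apply_mem (fun w hw => P.neg_mem (apply_mem_of_exp_apply_mem hu hP w hw)) hz
  have hadj : ∀ n : ℕ, ∀ z ∈ P,
      b ((NormedSpace.exp u ^ n) x) z = b x ((NormedSpace.exp (-u) ^ n) z) := by
    intro n
    induction n with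
    | zero => exact fun z _ => rfl
    | succ n ih =>
      intro z hz
      rw [pow_succ' (NormedSpace.exp u), pow_succ (NormedSpace.exp (-u)), mul_apply_eq_comp,
        mul_apply_eq_comp, ← ih _ (hinv z hz), ← h _ (pow_apply_mem hP n hx) _ (hinv z hz),
        exp_apply_neg]
  have hskew := apply_eq_apply_of_exp_pow (A := V →L[ℂ] V) hu hu.neg
    (f := b.flip y ∘ₗ (ContinuousLinearMap.apply ℂ V x).toLinearMap)
    (g := b x ∘ₗ (ContinuousLinearMap.apply ℂ V y).toLinearMap) fun n => hadj n y hy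
  change b (u x) y = b x ((-u) y) at hskew
  rw [hskew, ← map_add, neg_apply, neg_add_cancel, map_zero]

end EndExp

namespace GradedPolarizationData

open BigradedSum

section Dimension

variable {V : Type*} [AddCommGroup V] [Module ℂ V] [Module ℚ V] {D : GradedPolarizationData V}
  {F F' : DecFiltration V} {I I' : ℤ → ℤ → Submodule ℂ V}

theorem firstRelation_of_mem_M (hF : F ∈ D.M) : D.FirstRelation F :=
  firstRelation_iff.2 fun k => (hF.2.1 k).1

variable [FiniteDimensional ℂ V]

theorem finrank_F_inf_W (F : DecFiltration V) (p k : ℤ) :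
    Module.finrank ℂ ↥(F p ⊓ D.W k) =
      Module.finrank ℂ (D.grF F k p) + Module.finrank ℂ ↥(F p ⊓ D.W (k - 1)) := by
  set φ : ↥(F p ⊓ D.W k) →ₗ[ℂ] GrW D.W k :=
    GrW.mk D.W k ∘ₗ Submodule.inclusion inf_le_right
  have hrange : LinearMap.range φ = D.grF F k p := by
    ext x
    constructor
    · rintro ⟨y, rfl⟩
      exact ⟨Submodule.inclusion inf_le_right y, y.2.1, rfl⟩
    · rintro ⟨y, hy, rfl⟩
      exact ⟨⟨y, hy, y.2⟩, rfl⟩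
  have hker : (LinearMap.ker φ).map (F p ⊓ D.W k).subtype = F p ⊓ D.W (k - 1) := by
    ext x
    constructor
    · rintro ⟨y, hy, rfl⟩
      exact ⟨y.2.1, mk_eq_zero_iff.1 hy⟩
    · rintro ⟨hx, hxW⟩
      exact ⟨⟨x, hx, D.W_mono (by lia) hxW⟩, mk_eq_zero_iff.2 hxW, rfl⟩
  rw [← φ.finrank_range_add_finrank_ker, hrange,
    ← Submodule.finrank_map_subtype_eq _ (LinearMap.ker φ), hker]

theorem finrank_grF_congr
    (h : ∀ p k, Module.finrank ℂ ↥(F p ⊓ D.W k) = Module.finrank ℂ ↥(F' p ⊓ D.W k)) (p k : ℤ) :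
    Module.finrank ℂ (D.grF F k p) = Module.finrank ℂ (D.grF F' k p) := by
  have hF := finrank_F_inf_W (D := D) F p k
  rw [h, h p (k - 1), finrank_F_inf_W F'] at hF
  lia

theorem finrank_F_inf_W_congr
    (h : ∀ p k, Module.finrank ℂ (D.grF F k p) = Module.finrank ℂ (D.grF F' k p)) (p k : ℤ) :
    Module.finrank ℂ ↥(F p ⊓ D.W k) = Module.finrank ℂ ↥(F' p ⊓ D.W k) := by
  obtain ⟨k₀, hk₀⟩ := D.W_bot
  rcases le_total k k₀ with hk | hk
  · rw [eq_bot_mono (D.W_mono hk) hk₀, inf_bot_eq, inf_bot_eq]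
  induction k, hk using Int.leInduction with
  | base => rw [hk₀, inf_bot_eq, inf_bot_eq]
  | succ k _ ih =>
    rw [← add_sub_cancel_right k 1] at ih
    rw [finrank_F_inf_W, finrank_F_inf_W F', h, ih]

namespace IsDeligneBigrading

theorem finrank_grF (hI : D.IsDeligneBigrading F I) (k p : ℤ) :
    Module.finrank ℂ (D.grF F k p) =
      Module.finrank ℂ (part (pieces I) {rs | p ≤ rs.1 ∧ rs.1 + rs.2 = k}) := by
  have hunion : {rs : ℤ × ℤ | p ≤ rs.1 ∧ rs.1 + rs.2 ≤ k} =
      {rs | p ≤ rs.1 ∧ rs.1 + rs.2 = k} ∪ {rs | p ≤ rs.1 ∧ rs.1 + rs.2 ≤ k - 1} := by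
    ext rs
    simp only [Set.mem_union, Set.mem_ofPred_eq]
    lia
  have hF := finrank_F_inf_W (D := D) F p k
  rw [hI.F_inf_W_eq, hI.F_inf_W_eq, hunion,
    finrank_part_union hI.internal.submodule_iSupIndep] at hF
  · exact (Nat.add_right_cancel hF).symm
  · exact Set.disjoint_left.2 fun rs hrs hrs' => by
      simp only [Set.mem_ofPred_eq] at hrs hrs'
      lia

theorem finrank_add_finrank_grF (hI : D.IsDeligneBigrading F I) (p q : ℤ) :
    Module.finrank ℂ (I p q) + Module.finrank ℂ (D.grF F (p + q) (p + 1)) =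
      Module.finrank ℂ (D.grF F (p + q) p) := by
  have hunion : {rs : ℤ × ℤ | p ≤ rs.1 ∧ rs.1 + rs.2 = p + q} =
      {(p, q)} ∪ {rs | p + 1 ≤ rs.1 ∧ rs.1 + rs.2 = p + q} := by
    ext rs
    simp only [Set.mem_union, Set.mem_singleton_iff, Set.mem_ofPred_eq, Prod.ext_iff]
    lia
  have hsingleton : part (pieces I) {(p, q)} = I p q := iSup_singleton
  rw [hI.finrank_grF, hI.finrank_grF, hunion,
    finrank_part_union hI.internal.submodule_iSupIndep (by simp), hsingleton]

theorem finrank_congr (hI : D.IsDeligneBigrading F I) (hI' : D.IsDeligneBigrading F' I')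
    (h : ∀ p k, Module.finrank ℂ (D.grF F k p) = Module.finrank ℂ (D.grF F' k p)) (p q : ℤ) :
    Module.finrank ℂ (I p q) = Module.finrank ℂ (I' p q) := by
  have hF := hI.finrank_add_finrank_grF p q
  rw [h, h p, ← hI'.finrank_add_finrank_grF] at hF
  exact Nat.add_right_cancel hF

theorem mem_compactDual (hI : D.IsDeligneBigrading F I) (hS : D.FirstRelation F)
    (hh : ∀ p q, Module.finrank ℂ (I p q) = D.h (p, q)) : F ∈ D.compactDual := by
  have hsum (P : ℤ × ℤ → Prop) [DecidablePred P] :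
      Module.finrank ℂ (part (pieces I) {rs | P rs}) = ∑ rs ∈ D.h.support with P rs, D.h rs := by
    classical
    rw [finrank_part hI.internal.submodule_iSupIndep {rs | P rs} (s := D.h.support)
      fun rs hrs => ?_]
    · exact Finset.sum_congr (Finset.filter_congr fun _ _ => Iff.rfl) fun rs _ => hh rs.1 rs.2
    · rw [Finsupp.notMem_support_iff] at hrs
      exact Submodule.finrank_eq_zero.1 ((hh rs.1 rs.2).trans hrs)
  refine ⟨fun p => ?_, fun k p => ?_, firstRelation_iff.1 hS⟩
  · rw [hI.F_eq, hsum]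
  · rw [hI.finrank_grF, hsum]

end IsDeligneBigrading

theorem M_subset_compactDual : D.M ⊆ D.compactDual := fun _ hF =>
  hF.1.isDeligneBigrading.mem_compactDual (firstRelation_of_mem_M hF) hF.2.2

end Dimension

end GradedPolarizationData

namespace GradedPolarizationData

open BigradedSum EndExp

section Endomorphisms

variable {V : Type*} [NormedAddCommGroup V] [NormedSpace ℂ V] {F : DecFiltration V}
  {I : ℤ → ℤ → Submodule ℂ V} {u : V →L[ℂ] V}

theorem mem_map_exp [CompleteSpace V] {p : ℤ} {y : V} :
    y ∈ F.map (NormedSpace.exp u) p ↔ NormedSpace.exp (-u) y ∈ F p := by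
  constructor
  · rintro ⟨x, hx, rfl⟩
    rw [ContinuousLinearMap.coe_coe, exp_neg_apply]
    exact hx
  · exact fun h => ⟨_, h, exp_apply_neg u y⟩

theorem lowering_apply_mem_part (hu : u ∈ lowering I) {p : ℤ} {x : V}
    (hx : x ∈ part (pieces I) {rs | rs.1 ≤ p}) :
    u x ∈ part (pieces I) {rs | rs.1 < p} :=
  apply_mem_part hu (fun a ha b hb => by
    simp only [Set.mem_ofPred_eq, Prod.fst_add] at *
    lia) hx

theorem lowering_apply_mem_part_of_lt (hu : u ∈ lowering I) {p : ℤ} {x : V}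
    (hx : x ∈ part (pieces I) {rs | rs.1 < p}) :
    u x ∈ part (pieces I) {rs | rs.1 < p} :=
  lowering_apply_mem_part hu (part_mono (fun _ hrs => Set.mem_ofPred_eq ▸ le_of_lt hrs) hx)

theorem exp_sub_one_mem_lowering [FiniteDimensional ℂ V] (hu : u ∈ lowering I) :
    NormedSpace.exp u - 1 ∈ lowering I := by
  intro i x hx
  have hset : {j : ℤ × ℤ | j - i ∈ {d : ℤ × ℤ | d.1 < 0}} = {rs | rs.1 < i.1} := by
    ext
    simp
  rw [hset]
  exact exp_apply_sub_mem (fun y => lowering_apply_mem_part_of_lt hu)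
    (lowering_apply_mem_part hu (le_part (J := pieces I) (Set.mem_ofPred_eq ▸ le_refl i.1) hx))

end Endomorphisms

variable {V : Type*} [NormedAddCommGroup V] [NormedSpace ℂ V] [Module ℚ V]
  {D : GradedPolarizationData V}

variable (D) in
/-- `g` preserves `W` and acts on each `Gr^W_k` by an isometry of `S_k`. For invertible `g`, this
says that `g ∈ G_ℂ`. -/
structure IsGradedIsometry (g : V →L[ℂ] V) : Prop where
  mem_W : ∀ k, ∀ x ∈ D.W k, g x ∈ D.W k
  form : ∀ k, ∀ x ∈ D.W k, ∀ y ∈ D.W k, D.form k (g x) (g y) = D.form k x y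

variable {F : DecFiltration V} {I : ℤ → ℤ → Submodule ℂ V} {u : V →L[ℂ] V}

theorem IsDeligneBigrading.form_part_eq_zero (hI : D.IsDeligneBigrading F I)
    (hS : D.FirstRelation F) {k a b : ℤ} (hab : a + b < k) {x y : V}
    (hx : x ∈ part (pieces I) {rs | rs.1 ≤ a ∧ rs.1 + rs.2 ≤ k})
    (hy : y ∈ part (pieces I) {rs | rs.1 ≤ b ∧ rs.1 + rs.2 ≤ k}) : D.form k x y = 0 := by
  refine bilin_eq_zero_of_mem_part (fun i hi j hj x hx y hy => ?_) hx hy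
  obtain ⟨hia, hik⟩ := Set.mem_ofPred_eq ▸ hi
  obtain ⟨hjb, hjk⟩ := Set.mem_ofPred_eq ▸ hj
  have hxW : x ∈ D.W (i.1 + i.2) := hI.le_W _ _ hx
  have hyW : y ∈ D.W (j.1 + j.2) := hI.le_W _ _ hy
  rcases hik.lt_or_eq with hik' | hik'
  · exact form_eq_zero_of_left_mem (D.W_mono (by lia) hxW) (D.W_mono hjk hyW)
  rcases hjk.lt_or_eq with hjk' | hjk'
  · exact form_eq_zero_of_right_mem (D.W_mono hik hxW) (D.W_mono (by lia) hyW)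
  exact hI.form_eq_zero hS hik' hjk' (by lia) hx hy

/-- On `I^{p,q} × I^{r,s}`, either `p + r > k` and both sides vanish by the first relation, or
`p + r ≤ k` and all terms of the expansion involving `g - 1` vanish by `form_part_eq_zero`. -/
theorem IsDeligneBigrading.form_apply_apply (hI : D.IsDeligneBigrading F I)
    {g : V →L[ℂ] V} (hg : g - 1 ∈ endOfDegree (pieces I) {d | d.1 < 0 ∧ d.1 + d.2 ≤ 0})
    (hS : D.FirstRelation F) (hS' : D.FirstRelation (F.map g)) {k : ℤ} {x y : V}
    (hx : x ∈ D.W k) (hy : y ∈ D.W k) : D.form k (g x) (g y) = D.form k x y := by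
  rw [← sub_eq_zero]
  rw [hI.W_eq] at hx hy
  refine bilin_eq_zero_of_mem_part
    (b := (D.form k).compl₁₂ g.toLinearMap g.toLinearMap - D.form k) (fun i hi j hj x hx y hy => ?_)
    hx hy
  change D.form k (g x) (g y) - D.form k x y = 0
  have hmem {l : ℤ × ℤ} (hl : l.1 + l.2 ≤ k) {z : V} (hz : z ∈ I l.1 l.2) :
      z ∈ part (pieces I) {rs | rs.1 ≤ l.1 ∧ rs.1 + rs.2 ≤ k} :=
    le_part (J := pieces I) (Set.mem_ofPred_eq ▸ ⟨le_refl l.1, hl⟩) hz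
  have hlower {l : ℤ × ℤ} (hl : l.1 + l.2 ≤ k) {z : V} (hz : z ∈ I l.1 l.2) :
      g z - z ∈ part (pieces I) {rs | rs.1 ≤ l.1 - 1 ∧ rs.1 + rs.2 ≤ k} :=
    apply_mem_part hg (fun a ha b hb => by
      simp only [Set.mem_ofPred_eq, Prod.fst_add, Prod.snd_add] at *
      lia) (hmem hl hz)
  by_cases hij : i.1 + j.1 ≤ k
  · have hleft := hI.form_part_eq_zero hS (by lia) (hlower hi hx) (hmem hj hy)
    have hright := hI.form_part_eq_zero hS (by lia) (hmem hi hx) (hlower hj hy)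
    have hboth := hI.form_part_eq_zero hS (by lia) (hlower hi hx) (hlower hj hy)
    simp only [map_sub, LinearMap.sub_apply] at hleft hright hboth
    linear_combination hleft + hright + hboth
  · have hpart (l : ℤ × ℤ) (hl : l.1 + l.2 ≤ k) {z : V} (hz : z ∈ I l.1 l.2) :
        z ∈ D.W k ∧ g z ∈ D.W k := by
      have hzW : z ∈ D.W k := D.W_mono hl (hI.le_W _ _ hz)
      have hsub : g z - z ∈ D.W k := by
        rw [hI.W_eq]
        exact part_mono (fun rs hrs => hrs.2) (hlower hl hz)
      exact ⟨hzW, by simpa only [sub_add_cancel] using add_mem hsub hzW⟩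
    have hyF : y ∈ F (k - i.1 + 1) := F.antitone' (by lia) (hI.le_F _ _ hy)
    have hzero : D.form k (g x) (g y) = 0 := hS' k i.1 _ ⟨x, hI.le_F _ _ hx, rfl⟩ _ ⟨y, hyF, rfl⟩
      (hpart i hi hx).2 (hpart j hj hy).2
    rw [hzero, hS k i.1 x (hI.le_F _ _ hx) y hyF (hpart i hi hx).1 (hpart j hj hy).1, sub_zero]

variable [FiniteDimensional ℂ V]

section Orbit

variable (hu : u ∈ D.lieGC)
include hu

theorem isGradedIsometry_exp : D.IsGradedIsometry (NormedSpace.exp u) := by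
  rw [mem_lieGC_iff] at hu
  exact ⟨fun k _ => exp_apply_mem (hu.1 k), fun k => bilin_exp (D.form k) (hu.1 k) (hu.2 k)⟩

theorem map_exp_inf_W (p k : ℤ) : F.map (NormedSpace.exp u) p ⊓ D.W k =
    (F p ⊓ D.W k).map (NormedSpace.exp u : V →L[ℂ] V).toLinearMap := by
  ext y
  constructor
  · rintro ⟨hy, hyW⟩
    exact ⟨NormedSpace.exp (-u) y, ⟨mem_map_exp.1 hy,
      (isGradedIsometry_exp (neg_mem hu)).mem_W k y hyW⟩, exp_apply_neg u y⟩
  · rintro ⟨x, ⟨hx, hxW⟩, rfl⟩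
    exact ⟨⟨x, hx, rfl⟩, (isGradedIsometry_exp hu).mem_W k x hxW⟩

theorem finrank_map_exp_inf_W (p k : ℤ) :
    Module.finrank ℂ ↥(F.map (NormedSpace.exp u) p ⊓ D.W k) =
      Module.finrank ℂ ↥(F p ⊓ D.W k) := by
  rw [map_exp_inf_W hu, finrank_map_exp]

theorem firstRelation_map_exp (hS : D.FirstRelation F) :
    D.FirstRelation (F.map (NormedSpace.exp u)) := by
  intro k p x hx y hy hxW hyW
  have hinv := isGradedIsometry_exp (neg_mem hu)
  rw [← hinv.form k x hxW y hyW]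
  exact hS k p _ (mem_map_exp.1 hx) _ (mem_map_exp.1 hy) (hinv.mem_W k x hxW) (hinv.mem_W k y hyW)

theorem map_exp_mem_compactDual (hF : F ∈ D.compactDual) :
    F.map (NormedSpace.exp u) ∈ D.compactDual :=
  ⟨fun p => (finrank_map_exp u (F p)).trans (hF.1 p),
    fun k p => (finrank_grF_congr (finrank_map_exp_inf_W hu) p k).trans (hF.2.1 k p),
    firstRelation_iff.1 (firstRelation_map_exp hu (firstRelation_iff.2 hF.2.2))⟩

end Orbit

theorem mem_lieGC_of_exp (hu : IsNilpotent u) (h : D.IsGradedIsometry (NormedSpace.exp u)) :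
    u ∈ D.lieGC :=
  mem_lieGC_iff.2 ⟨fun k => apply_mem_of_exp_apply_mem hu (h.mem_W k),
    fun k => bilin_of_exp hu (D.form k) (h.mem_W k) (h.form k)⟩

section Lowering

variable (hu : u ∈ lowering I)
include hu

namespace IsDeligneBigrading

variable (hI : D.IsDeligneBigrading F I)
include hI

theorem disjoint_map_exp_part (p : ℤ) :
    Disjoint (F.map (NormedSpace.exp u) p) (part (pieces I) {rs | rs.1 < p}) := by
  refine Submodule.disjoint_def.2 fun x hx hx' => ?_
  have hdisj : Disjoint (F p) (part (pieces I) {rs | rs.1 < p}) := by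
    rw [hI.F_eq]
    exact disjoint_part hI.internal.submodule_iSupIndep
      (Set.disjoint_left.2 fun _ hrs hrs' => not_lt_of_ge (Set.mem_ofPred_eq ▸ hrs) hrs')
  have hexp : NormedSpace.exp (-u) x = 0 := Submodule.disjoint_def.1 hdisj _ (mem_map_exp.1 hx)
    (exp_apply_mem (fun y => lowering_apply_mem_part_of_lt (neg_mem hu)) hx')
  rw [← exp_apply_neg u x, hexp, map_zero]

theorem map_exp_inf_W_sup_part {p k : ℤ} (hdim : Module.finrank ℂ ↥(F p ⊓ D.W k) =
      Module.finrank ℂ ↥(F.map (NormedSpace.exp u) p ⊓ D.W k)) :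
    F.map (NormedSpace.exp u) p ⊓ D.W k ⊔ part (pieces I) {rs | rs.1 < p ∧ rs.1 + rs.2 ≤ k} =
      D.W k := by
  have hunion : {rs : ℤ × ℤ | rs.1 + rs.2 ≤ k} =
      {rs | p ≤ rs.1 ∧ rs.1 + rs.2 ≤ k} ∪ {rs | rs.1 < p ∧ rs.1 + rs.2 ≤ k} := by
    ext rs
    simp only [Set.mem_union, Set.mem_ofPred_eq]
    lia
  have hW : Module.finrank ℂ (D.W k) = Module.finrank ℂ ↥(F p ⊓ D.W k) +
      Module.finrank ℂ (part (pieces I) {rs | rs.1 < p ∧ rs.1 + rs.2 ≤ k}) := by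
    rw [hI.F_inf_W_eq, hI.W_eq, hunion, finrank_part_union hI.internal.submodule_iSupIndep]
    exact Set.disjoint_left.2 fun rs hrs hrs' => by
      simp only [Set.mem_ofPred_eq] at hrs hrs'
      lia
  have hle : part (pieces I) {rs | rs.1 < p ∧ rs.1 + rs.2 ≤ k} ≤ D.W k := by
    rw [hI.W_eq]
    exact part_mono fun _ hrs => hrs.2
  have hdisj : Disjoint (F.map (NormedSpace.exp u) p ⊓ D.W k)
      (part (pieces I) {rs | rs.1 < p ∧ rs.1 + rs.2 ≤ k}) :=
    (hI.disjoint_map_exp_part hu p).mono inf_le_left (part_mono fun _ hrs => hrs.1)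
  refine Submodule.eq_of_le_of_finrank_eq (sup_le inf_le_right hle) ?_
  rw [hW, hdim, ← Submodule.finrank_sup_add_finrank_inf_eq, hdisj.eq_bot, finrank_bot, add_zero]

theorem exp_apply_mem_W {k : ℤ} (hdim : ∀ p, Module.finrank ℂ ↥(F p ⊓ D.W k) =
      Module.finrank ℂ ↥(F.map (NormedSpace.exp u) p ⊓ D.W k)) {x : V} (hx : x ∈ D.W k) :
    NormedSpace.exp u x ∈ D.W k := by
  rw [hI.W_eq] at hx
  refine (part_le fun i hi x hx => ?_ : _ ≤ (D.W k).comap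
    (NormedSpace.exp u : V →L[ℂ] V).toLinearMap) hx
  change NormedSpace.exp u x ∈ D.W k
  have hxW : x ∈ D.W k := D.W_mono hi (hI.le_W _ _ hx)
  rw [← hI.map_exp_inf_W_sup_part hu (hdim i.1)] at hxW
  obtain ⟨y, ⟨hyF, hyW⟩, c, hc, hyc⟩ := Submodule.mem_sup.1 hxW
  have hlower : NormedSpace.exp u x - x ∈ part (pieces I) {rs | rs.1 < i.1} :=
    lowering_apply_mem_part (exp_sub_one_mem_lowering hu)
      (le_part (J := pieces I) (Set.mem_ofPred_eq ▸ le_refl i.1) hx)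
  have hsub : NormedSpace.exp u x - y = NormedSpace.exp u x - x + c := by
    rw [← hyc]
    abel
  have hzero : NormedSpace.exp u x - y = 0 :=
    Submodule.disjoint_def.1 (hI.disjoint_map_exp_part hu i.1) _
      (sub_mem ⟨x, hI.le_F _ _ hx, rfl⟩ hyF)
      (hsub ▸ add_mem hlower (part_mono (fun _ hrs => hrs.1) hc))
  rwa [sub_eq_zero.1 hzero]

theorem isGradedIsometry_of_map_exp_mem (hF : F ∈ D.compactDual)
    (hF' : F.map (NormedSpace.exp u) ∈ D.compactDual) : D.IsGradedIsometry (NormedSpace.exp u) := by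
  have hmem_W (k : ℤ) : ∀ x ∈ D.W k, NormedSpace.exp u x ∈ D.W k := fun x =>
    hI.exp_apply_mem_W hu fun p =>
      finrank_F_inf_W_congr (fun p k => (hF.2.1 k p).trans (hF'.2.1 k p).symm) p k
  have hweight : NormedSpace.exp u - 1 ∈ endOfDegree (pieces I) {d | d.1 + d.2 ≤ 0} :=
    hI.mem_endOfDegree_weight_iff.2 fun k x hx => sub_mem (hmem_W k x hx) hx
  have hdeg : NormedSpace.exp u - 1 ∈ endOfDegree (pieces I) {d | d.1 < 0 ∧ d.1 + d.2 ≤ 0} :=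
    (endOfDegree_inf hI.internal.submodule_iSupIndep _ _).le
      ⟨exp_sub_one_mem_lowering hu, hweight⟩
  exact ⟨hmem_W, fun k x hx y hy => hI.form_apply_apply hdeg (firstRelation_iff.2 hF.2.2)
    (firstRelation_iff.2 hF'.2.2) hx hy⟩

theorem mem_lieGC_of_map_exp_mem (hF : F ∈ D.compactDual)
    (hF' : F.map (NormedSpace.exp u) ∈ D.compactDual) : u ∈ D.lieGC :=
  mem_lieGC_of_exp (hI.isNilpotent_of_mem_lowering hu)
    (hI.isGradedIsometry_of_map_exp_mem hu hF hF')

end IsDeligneBigrading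

end Lowering

end GradedPolarizationData

/-! ### Openness of the polarized mixed Hodge structures -/

theorem DecFiltration.map_eq_bot {V : Type*} [NormedAddCommGroup V] [NormedSpace ℂ V]
    (A : V →L[ℂ] V) {F : DecFiltration V} {p : ℤ} (h : F p = ⊥) : F.map A p = ⊥ :=
  (congrArg (Submodule.map A.toLinearMap) h).trans (Submodule.map_bot _)

theorem eventually_forall_mem_of_isCompact {X Y Z : Type*} [TopologicalSpace X]
    [TopologicalSpace Y] [TopologicalSpace Z] {f : X × Y → Z} (hf : Continuous f) {K : Set Y}
    (hK : IsCompact K) {C : Set Z} (hC : IsClosed C) {O : Set Y} (hO : IsOpen O) {x₀ : X}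
    (h : ∀ y ∈ K, f (x₀, y) ∈ C → y ∈ O) :
    ∀ᶠ x in 𝓝 x₀, ∀ y ∈ K, f (x, y) ∈ C → y ∈ O := by
  have hopen : IsOpen {xy : X × Y | f xy ∈ C → xy.2 ∈ O} := by
    simp only [imp_iff_not_or]
    exact (hC.isOpen_compl.preimage hf).union (hO.preimage continuous_snd)
  exact hK.eventually_forall_of_forall_eventually fun y hy => hopen.mem_nhds (h y hy)

namespace GradedPolarizationData

open EndExp

section HodgeLift

variable {V : Type*} [AddCommGroup V] [Module ℂ V] [Module ℚ V] {D : GradedPolarizationData V}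
  {F : DecFiltration V}

theorem antitone_grF (F : DecFiltration V) (k : ℤ) : Antitone (D.grF F k) := fun _ _ h =>
  Submodule.map_mono (Submodule.comap_mono (F.antitone' h))

theorem grF_eq_top {p : ℤ} (h : F p = ⊤) (k : ℤ) : D.grF F k p = ⊤ := by
  rw [eq_top_iff]
  intro v _
  obtain ⟨x, rfl⟩ := exists_mk v
  exact ⟨x, h ▸ Submodule.mem_top, rfl⟩

theorem grF_eq_bot {p : ℤ} (h : F p = ⊥) (k : ℤ) : D.grF F k p = ⊥ := by
  rw [eq_bot_iff]
  rintro _ ⟨x, hx, rfl⟩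
  have hx0 : (x : V) = 0 := (Submodule.mem_bot ℂ).1 (h ▸ hx)
  exact mk_eq_zero_iff.2 (hx0 ▸ zero_mem _)

theorem finrank_map_grConj {k : ℤ} (P : Submodule ℂ (GrW D.W k)) :
    Module.finrank ℂ (P.map (D.grConj k)) = Module.finrank ℂ P := by
  let e : P ≃+ P.map (D.grConj k) :=
    { toFun := fun x => ⟨D.grConj k x, x, x.2, rfl⟩
      invFun := fun x => ⟨D.grConj k x, mem_map_grConj.1 x.2⟩
      left_inv := fun x => Subtype.ext (grConj_grConj x.1)
      right_inv := fun x => Subtype.ext (grConj_grConj x.1)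
      map_add' := fun x y => Subtype.ext (map_add (D.grConj k) x.1 y.1) }
  have hrank := rank_eq_of_equiv_equiv (starRingEnd ℂ) e
    (Function.Involutive.bijective Complex.conj_conj)
    fun c x => Subtype.ext (LinearMap.map_smulₛₗ (D.grConj k) c x.1)
  rw [Module.finrank, Module.finrank, hrank]

theorem im_form_conj_eq_zero {p q k : ℤ} (hpq : p + q = k) {z : V} (hz : z ∈ D.W k) :
    (Complex.I ^ (p - q) * D.form k z (D.conj z)).im = 0 := by
  have hz' := D.conj_mem_W k z hz
  have hconj : starRingEnd ℂ (D.form k z (D.conj z)) = (-1) ^ k * D.form k z (D.conj z) := by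
    rw [← form_conj_conj hz hz', conj_conj, form_swap hz' hz]
  have hI : (-Complex.I) ^ (p - q) * (-1) ^ k = Complex.I ^ (p - q) := by
    rw [neg_eq_neg_one_mul, mul_zpow, mul_right_comm, ← zpow_add₀ (neg_ne_zero.2 one_ne_zero),
      ← hpq, show p - q + (p + q) = 2 * p by lia, zpow_mul]
    simp
  rw [← Complex.conj_eq_iff_im, map_mul, map_zpow₀, Complex.conj_I, hconj, ← mul_assoc, hI]

variable (D) in
/-- A complement of `W_{k-1}` in `W_k`, on which `Gr^W_k` can be represented independently of
the filtration `F`. -/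
def grLift (k : ℤ) : Submodule ℂ V :=
  (D.W (k - 1)).exists_isCompl.choose ⊓ D.W k

theorem grLift_le_W (k : ℤ) : D.grLift k ≤ D.W k := inf_le_right

theorem disjoint_grLift (k : ℤ) : Disjoint (D.grLift k) (D.W (k - 1)) :=
  (D.W (k - 1)).exists_isCompl.choose_spec.disjoint.symm.mono_left inf_le_left

theorem W_le_grLift_sup (k : ℤ) : D.W k ≤ D.grLift k ⊔ D.W (k - 1) := by
  have hle : D.W (k - 1) ≤ D.W k := D.W_mono (by lia)
  rw [sup_comm, grLift, ← sup_inf_assoc_of_le _ hle,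
    (D.W (k - 1)).exists_isCompl.choose_spec.sup_eq_top, top_inf_eq]

theorem exists_mk_grLift {k : ℤ} (v : GrW D.W k) :
    ∃ z : D.grLift k, GrW.mk D.W k ⟨z, grLift_le_W k z.2⟩ = v := by
  obtain ⟨x, rfl⟩ := exists_mk v
  obtain ⟨z, hz, w, hw, hzw⟩ := Submodule.mem_sup.1 (W_le_grLift_sup k x.2)
  exact ⟨⟨z, hz⟩, (mk_eq_mk_iff.2 (by simpa [← hzw] using hw)).symm⟩

variable (D) in
/-- The space of representatives in `grLift k` of the elements of
`F^p Gr^W_k ∩ conj (F^q Gr^W_k)`. -/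
def hodgeLift (F : DecFiltration V) (k p q : ℤ) : Submodule ℂ V :=
  D.grLift k ⊓ (D.grPre k (F p) ⊓ (D.grPre k (F q)).comap D.conj)

theorem hodgeLift_le_W (F : DecFiltration V) (k p q : ℤ) : D.hodgeLift F k p q ≤ D.W k :=
  inf_le_left.trans (grLift_le_W k)

theorem mk_mem_hodgePiece {k p q : ℤ} {z : V} (hz : z ∈ D.grLift k) :
    GrW.mk D.W k ⟨z, grLift_le_W k hz⟩ ∈ hodgePiece (D.grConj k) (D.grF F k) p q ↔
      z ∈ D.hodgeLift F k p q := by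
  rw [hodgePiece, Submodule.mem_inf, mem_map_grConj, grConj_mk, mk_mem_grF, mk_mem_grF]
  exact ⟨fun h => ⟨hz, h⟩, fun h => h.2⟩

theorem eq_zero_of_mem_hodgeLift_of_mem_W {k p q : ℤ} {z : V} (hz : z ∈ D.hodgeLift F k p q)
    (hzW : z ∈ D.W (k - 1)) : z = 0 :=
  Submodule.disjoint_def.1 (disjoint_grLift k) z hz.1 hzW

theorem hodgePiece_eq_bot_iff {k p q : ℤ} :
    hodgePiece (D.grConj k) (D.grF F k) p q = ⊥ ↔ D.hodgeLift F k p q = ⊥ := by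
  constructor <;> intro h <;> rw [eq_bot_iff] at h ⊢
  · intro z hz
    exact eq_zero_of_mem_hodgeLift_of_mem_W hz
      (mk_eq_zero_iff.1 (h ((mk_mem_hodgePiece hz.1).2 hz)))
  · intro v hv
    obtain ⟨z, rfl⟩ := exists_mk_grLift v
    have hz : (z : V) = 0 := h ((mk_mem_hodgePiece z.2).1 hv)
    exact mk_eq_zero_iff.2 (by simp [hz])

theorem lt_of_mem_hodgeLift {b k₀ k p q : ℤ} (hb : F b = ⊥) (hk₀ : D.W k₀ = ⊥) {z : V}
    (hz : z ∈ D.hodgeLift F k p q) (hz0 : z ≠ 0) : p < b ∧ q < b ∧ k₀ < k := by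
  have hgrPre {r : ℤ} (hr : b ≤ r) : D.grPre k (F r) = D.W (k - 1) := by
    rw [grPre, eq_bot_mono (F.antitone' hr) hb, bot_inf_eq, bot_sup_eq]
  have hzW : z ∉ D.W (k - 1) := fun h => hz0 (eq_zero_of_mem_hodgeLift_of_mem_W hz h)
  refine ⟨lt_of_not_ge fun hp => hzW (hgrPre hp ▸ hz.2.1), lt_of_not_ge fun hq => hzW ?_,
    lt_of_not_ge fun hk => hz0 ?_⟩
  · exact (conj_mem_W_iff D).1 (hgrPre hq ▸ hz.2.2)
  · exact (Submodule.mem_bot ℂ).1 (eq_bot_mono (D.W_mono hk) hk₀ ▸ hodgeLift_le_W F k p q hz)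

theorem isPolarizedBy_iff {k : ℤ} (hS : D.FirstRelation F) :
    IsPolarizedBy (D.grConj k) k (D.grF F k) (D.S k) ↔
      ∀ p q, p + q = k → ∀ z ∈ D.hodgeLift F k p q, z ≠ 0 →
        0 < (Complex.I ^ (p - q) * D.form k z (D.conj z)).re := by
  refine ⟨fun h p q hpq z hz hz0 => ?_,
    fun h => ⟨firstRelation_iff.1 hS k, fun p q hpq v hv hv0 => ?_⟩⟩
  · have hzW := hodgeLift_le_W F k p q hz
    rw [form_apply D hzW (D.conj_mem_W k z hzW)]
    exact (h.2 p q hpq _ ((mk_mem_hodgePiece hz.1).2 hz) fun h0 =>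
      hz0 (eq_zero_of_mem_hodgeLift_of_mem_W hz (mk_eq_zero_iff.1 h0))).2
  · obtain ⟨z, rfl⟩ := exists_mk_grLift v
    have hzW := grLift_le_W k z.2
    rw [grConj_mk, ← form_apply D hzW (D.conj_mem_W k z hzW)]
    refine ⟨im_form_conj_eq_zero hpq hzW, h p q hpq z ((mk_mem_hodgePiece z.2).1 hv) fun h0 => ?_⟩
    exact hv0 (mk_eq_zero_iff.2 (by simp [h0]))

theorem IsMixedHodge.hodgeLift_eq_bot (hF : D.IsMixedHodge F) {k p q : ℤ} (hpq : p + q = k + 1) :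
    D.hodgeLift F k p q = ⊥ := by
  rw [← hodgePiece_eq_bot_iff, hodgePiece, ← disjoint_iff, show q = k - p + 1 by lia]
  exact ((hF.2.2 k).2.2.2 p).disjoint

/-- As `F^p Gr^W_k` and `conj (F^{k-p+1} Gr^W_k)` are disjoint, they are complementary for dimension
reasons. -/
theorem IsMixedHodge.of_hodgeLift_eq_bot [FiniteDimensional ℂ V] (hF : D.IsMixedHodge F)
    {F' : DecFiltration V} (htop : ∃ p, F' p = ⊤) (hbot : ∃ p, F' p = ⊥)
    (hdim : ∀ p k, Module.finrank ℂ (D.grF F' k p) = Module.finrank ℂ (D.grF F k p))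
    (h : ∀ p q k, p + q = k + 1 → D.hodgeLift F' k p q = ⊥) : D.IsMixedHodge F' := by
  refine ⟨htop, hbot, fun k => ⟨antitone_grF F' k, htop.imp fun p hp => grF_eq_top hp k,
    hbot.imp fun p hp => grF_eq_bot hp k, fun p => ?_⟩⟩
  have hdisj : Disjoint (D.grF F' k p) ((D.grF F' k (k - p + 1)).map (D.grConj k)) :=
    disjoint_iff.2 (hodgePiece_eq_bot_iff.2 (h p (k - p + 1) k (by lia)))
  refine ⟨hdisj, codisjoint_iff.2 (Submodule.eq_top_of_disjoint _ _ ?_ hdisj)⟩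
  rw [finrank_map_grConj, hdim, hdim, ← finrank_map_grConj (D.grF F k (k - p + 1))]
  exact (Submodule.finrank_add_eq_of_isCompl ((hF.2.2 k).2.2.2 p)).ge

theorem mem_M_of_hodgeLift [FiniteDimensional ℂ V] (hF : F ∈ D.M) {F' : DecFiltration V}
    (htop : ∃ p, F' p = ⊤) (hbot : ∃ p, F' p = ⊥)
    (hdim : ∀ p k, Module.finrank ℂ (D.grF F' k p) = Module.finrank ℂ (D.grF F k p))
    (hS : D.FirstRelation F') (h : ∀ p q k, p + q = k + 1 → D.hodgeLift F' k p q = ⊥)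
    (hpos : ∀ k p q, p + q = k → ∀ z ∈ D.hodgeLift F' k p q, z ≠ 0 →
      0 < (Complex.I ^ (p - q) * D.form k z (D.conj z)).re) : F' ∈ D.M := by
  have hF' : D.IsMixedHodge F' := hF.1.of_hodgeLift_eq_bot htop hbot hdim h
  refine ⟨hF', fun k => (isPolarizedBy_iff hS).2 (hpos k), fun p q => ?_⟩
  rw [← hF.2.2 p q]
  exact hF'.isDeligneBigrading.finrank_congr hF.1.isDeligneBigrading hdim p q

theorem re_form_pos_of_smul {c : ℂ} {k : ℤ} {z : V} {r : ℝ}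
    (h : 0 < (c * D.form k ((r : ℂ) • z) (D.conj ((r : ℂ) • z))).re) :
    0 < (c * D.form k z (D.conj z)).re := by
  have hsmul : c * D.form k ((r : ℂ) • z) (D.conj ((r : ℂ) • z)) =
      (r * r : ℝ) * (c * D.form k z (D.conj z)) := by
    simp only [LinearMap.map_smulₛₗ, map_smul, LinearMap.smul_apply, smul_eq_mul,
      Complex.conj_ofReal, Complex.ofReal_mul]
    ring
  rw [hsmul, Complex.re_ofReal_mul] at h
  exact pos_of_mul_pos_right h (mul_self_nonneg r)

end HodgeLift

variable {V : Type*} [NormedAddCommGroup V] [NormedSpace ℂ V] [Module ℚ V]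
  {D : GradedPolarizationData V} [FiniteDimensional ℂ V] {F : DecFiltration V}

theorem continuous_conj : Continuous D.conj := by
  let c : V →ₗ[ℝ] V :=
    { toFun := D.conj
      map_add' := map_add D.conj
      map_smul' := fun r x => by
        rw [← Complex.coe_smul, LinearMap.map_smulₛₗ, Complex.conj_ofReal, Complex.coe_smul,
          RingHom.id_apply] }
  have := FiniteDimensional.complexToReal V
  exact c.continuous_of_finiteDimensional

theorem exp_neg_mem_grPre {u : V →L[ℂ] V} (hu : u ∈ D.lieGC) {k p : ℤ} {z : V}
    (hz : z ∈ D.grPre k (F.map (NormedSpace.exp u) p)) :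
    NormedSpace.exp (-u) z ∈ D.grPre k (F p) := by
  have hiso := isGradedIsometry_exp (neg_mem hu)
  obtain ⟨f, ⟨hf, hfW⟩, w, hw, rfl⟩ := Submodule.mem_sup.1 hz
  rw [map_add]
  exact Submodule.add_mem_sup ⟨mem_map_exp.1 hf, hiso.mem_W k f hfW⟩ (hiso.mem_W _ w hw)

/-- The unit sphere of `grLift k` is compact and the conditions that define `hodgeLift` are
closed. -/
theorem eventually_hodgeLift_subset {k p q : ℤ} {O : Set V} (hO : IsOpen O)
    (hsmul : ∀ (z : V) (r : ℝ), r ≠ 0 → (r : ℂ) • z ∈ O → z ∈ O)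
    (h : ∀ z ∈ D.hodgeLift F k p q, z ≠ 0 → z ∈ O) :
    ∀ᶠ u : V →L[ℂ] V in 𝓝 0, u ∈ D.lieGC →
      ∀ z ∈ D.hodgeLift (F.map (NormedSpace.exp u)) k p q, z ≠ 0 → z ∈ O := by
  have := FiniteDimensional.proper ℂ V
  have hcompact : IsCompact (Metric.sphere (0 : V) 1 ∩ D.grLift k) :=
    (isCompact_sphere 0 1).inter_right (Submodule.closed_of_finiteDimensional _)
  have hclosed : IsClosed ((D.grPre k (F p) : Set V) ×ˢ (D.grPre k (F q) : Set V)) :=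
    (Submodule.closed_of_finiteDimensional _).prod (Submodule.closed_of_finiteDimensional _)
  have hexp : Continuous fun uz : (V →L[ℂ] V) × V => NormedSpace.exp (-uz.1) :=
    continuous_exp.comp continuous_fst.neg
  have hcont : Continuous fun uz : (V →L[ℂ] V) × V =>
      (NormedSpace.exp (-uz.1) uz.2, NormedSpace.exp (-uz.1) (D.conj uz.2)) :=
    (hexp.clm_apply continuous_snd).prodMk
      (hexp.clm_apply (continuous_conj.comp continuous_snd))
  have hsphere := eventually_forall_mem_of_isCompact hcont hcompact hclosed hO (x₀ := 0)
    fun z hz hzP => h z ⟨hz.2, by simpa [NormedSpace.exp_zero] using hzP⟩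
      (Metric.ne_of_mem_sphere hz.1 one_ne_zero)
  filter_upwards [hsphere] with u hu huL z hz hz0
  have hnorm : ‖z‖⁻¹ ≠ 0 := inv_ne_zero (norm_ne_zero_iff.2 hz0)
  have hscaled := Submodule.smul_mem _ (‖z‖⁻¹ : ℂ) hz
  refine hsmul z ‖z‖⁻¹ hnorm ?_
  rw [Complex.ofReal_inv]
  refine hu _ ⟨?_, hscaled.1⟩ ⟨exp_neg_mem_grPre huL hscaled.2.1,
    exp_neg_mem_grPre huL hscaled.2.2⟩
  rw [mem_sphere_zero_iff_norm, norm_smul, norm_inv, Complex.norm_real, norm_norm,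
    inv_mul_cancel₀ (norm_ne_zero_iff.2 hz0)]

/-- For fixed `e`, only finitely many `(p, q)` with `k = p + q - e` give a nonzero space. -/
theorem eventually_forall_hodgeLift_subset (hbot : ∃ b, F b = ⊥) (e : ℤ) {O : ℤ → ℤ → ℤ → Set V}
    (hO : ∀ k p q, IsOpen (O k p q))
    (hsmul : ∀ k p q (z : V) (r : ℝ), r ≠ 0 → (r : ℂ) • z ∈ O k p q → z ∈ O k p q)
    (h : ∀ k p q, p + q = k + e → ∀ z ∈ D.hodgeLift F k p q, z ≠ 0 → z ∈ O k p q) :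
    ∀ᶠ u : V →L[ℂ] V in 𝓝 0, u ∈ D.lieGC → ∀ k p q, p + q = k + e →
      ∀ z ∈ D.hodgeLift (F.map (NormedSpace.exp u)) k p q, z ≠ 0 → z ∈ O k p q := by
  obtain ⟨b, hb⟩ := hbot
  obtain ⟨k₀, hk₀⟩ := D.W_bot
  have hbox := (Filter.eventually_all_finset
    (Finset.Ioo (k₀ + e - b) b ×ˢ Finset.Ioo (k₀ + e - b) b)).2 fun pq _ =>
      eventually_hodgeLift_subset (hO _ _ _) (hsmul _ _ _) (h (pq.1 + pq.2 - e) pq.1 pq.2 (by lia))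
  filter_upwards [hbox] with u hu huL k p q hpq z hz hz0
  obtain rfl : k = p + q - e := by lia
  have hlt := lt_of_mem_hodgeLift (DecFiltration.map_eq_bot _ hb) hk₀ hz hz0
  refine hu (p, q) ?_ huL z hz hz0
  simp only [Finset.mem_product, Finset.mem_Ioo]
  lia

theorem isOpen_re_form_pos (c : ℂ) (k : ℤ) :
    IsOpen {z : V | 0 < (c * D.form k z (D.conj z)).re} :=
  isOpen_lt continuous_const <| Complex.continuous_re.comp <| continuous_const.mul <|
    (LinearMap.toContinuousBilinearMap (D.form k)).continuous.clm_apply continuous_conj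

theorem eventually_map_exp_mem_M (hF : F ∈ D.M) :
    ∀ᶠ u : V →L[ℂ] V in 𝓝 0, u ∈ D.lieGC → F.map (NormedSpace.exp u) ∈ D.M := by
  have hS := firstRelation_of_mem_M hF
  have hopposed := eventually_forall_hodgeLift_subset (D := D) hF.1.2.1 1
    (O := fun _ _ _ => ∅) (fun _ _ _ => isOpen_empty) (fun _ _ _ _ _ _ hz => hz)
    fun k p q hpq z hz hz0 => hz0 ((Submodule.mem_bot ℂ).1 (hF.1.hodgeLift_eq_bot hpq ▸ hz))
  have hpolarized := eventually_forall_hodgeLift_subset (D := D) hF.1.2.1 0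
    (fun k p q => isOpen_re_form_pos (Complex.I ^ (p - q)) k)
    (fun _ _ _ _ _ _ => re_form_pos_of_smul)
    fun k p q hpq => (isPolarizedBy_iff hS).1 (hF.2.1 k) p q (by lia)
  filter_upwards [hopposed, hpolarized] with u hu hu' huL
  refine mem_M_of_hodgeLift hF (hF.1.1.imp fun p hp => ?_) (hF.1.2.1.imp fun p hp => ?_)
    (finrank_grF_congr (finrank_map_exp_inf_W huL)) (firstRelation_map_exp huL hS)
    (fun p q k hpq => ?_) fun k p q hpq => hu' huL k p q (by lia)
  · exact eq_top_iff.2 fun x _ => mem_map_exp.2 (by rw [hp]; exact Submodule.mem_top)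
  · exact DecFiltration.map_eq_bot _ hp
  · exact (Submodule.eq_bot_iff _).2 fun z hz => by_contra (hu huL k p q hpq z hz)

end GradedPolarizationData

/-! ### Exponential charts of the flag variety -/

namespace EndExp

variable {A : Type*} [NormedRing A] [NormedAlgebra ℂ A]

theorem analyticAt_exp_subtype [CompleteSpace A] (P : Submodule ℂ A) (u : P) :
    AnalyticAt ℂ (fun u : P => NormedSpace.exp (u : A)) u :=
  AnalyticAt.comp (f := P.subtypeL) (NormedSpace.exp_analytic (u : A)) (P.subtypeL.analyticAt u)

/-- The map `(a, b) ↦ exp(a) (1 + b)`. -/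
def expMulOneAdd (P Q : Submodule ℂ A) (ab : P × Q) : A :=
  NormedSpace.exp (ab.1 : A) * (1 + (ab.2 : A))

theorem expMulOneAdd_zero (P Q : Submodule ℂ A) : expMulOneAdd P Q 0 = 1 := by
  simp [expMulOneAdd, NormedSpace.exp_zero]

theorem expMulOneAdd_left {P : Submodule ℂ A} (Q : Submodule ℂ A) (a : P) :
    expMulOneAdd P Q (a, 0) = NormedSpace.exp (a : A) := by
  simp [expMulOneAdd]

variable [FiniteDimensional ℂ A]

theorem analyticAt_expMulOneAdd (P Q : Submodule ℂ A) (ab : P × Q) :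
    AnalyticAt ℂ (expMulOneAdd P Q) ab := by
  have := FiniteDimensional.complete ℂ A
  exact ((analyticAt_exp_subtype P ab.1).comp analyticAt_fst).mul
    (analyticAt_const.add ((Q.subtypeL ∘L ContinuousLinearMap.snd ℂ P Q).analyticAt ab))

theorem hasStrictFDerivAt_expMulOneAdd {P Q : Submodule ℂ A} (h : IsCompl P Q) :
    HasStrictFDerivAt (expMulOneAdd P Q)
      ((Submodule.prodEquivOfIsCompl P Q h).toContinuousLinearEquiv : P × Q →L[ℂ] A) 0 := by
  have := FiniteDimensional.complete ℂ A
  let left : P × Q →L[ℂ] A := P.subtypeL ∘L ContinuousLinearMap.fst ℂ P Q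
  let right : P × Q →L[ℂ] A := Q.subtypeL ∘L ContinuousLinearMap.snd ℂ P Q
  have hexp : HasStrictFDerivAt (NormedSpace.exp : A → A) (1 : A →L[ℂ] A) (left 0) := by
    rw [map_zero]
    exact hasStrictFDerivAt_exp_zero
  refine ((HasStrictFDerivAt.comp (f := left) 0 hexp left.hasStrictFDerivAt).mul'
    (right.hasStrictFDerivAt.const_add 1)).congr_fderiv (ContinuousLinearMap.ext fun ab => ?_)
  change NormedSpace.exp (left 0) * right ab + left ab * (1 + right 0) = left ab + right ab
  rw [map_zero, map_zero, NormedSpace.exp_zero, one_mul, add_zero, mul_one, add_comm]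

theorem exists_analyticAt_exp_mul_one_add_eq {P Q : Submodule ℂ A} (h : IsCompl P Q) :
    ∃ l : A → P, AnalyticAt ℂ l 1 ∧ (∀ᶠ a : P in 𝓝 0, l (NormedSpace.exp (a : A)) = a) ∧
      ∀ᶠ t in 𝓝 1, ∃ b : Q, IsUnit (1 + (b : A)) ∧
        NormedSpace.exp (l t : A) * (1 + (b : A)) = t := by
  have := FiniteDimensional.complete ℂ A
  have := FiniteDimensional.complete ℂ (P × Q)
  have hderiv := hasStrictFDerivAt_expMulOneAdd h
  let f := hderiv.toOpenPartialHomeomorph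
  have hf0 : f 0 = 1 := expMulOneAdd_zero P Q
  have h0 : (0 : P × Q) ∈ f.source := hderiv.mem_toOpenPartialHomeomorph_source
  have h1 : (1 : A) ∈ f.target := hf0 ▸ f.map_source h0
  have hsymm : f.symm 1 = 0 := hf0 ▸ f.left_inv h0
  have hanalytic : AnalyticAt ℂ f.symm 1 := f.analyticAt_symm h1
    (hsymm ▸ analyticAt_expMulOneAdd P Q _) (hsymm ▸ hderiv.hasFDerivAt.fderiv)
  refine ⟨fun t => (f.symm t).1, analyticAt_fst.comp hanalytic, ?_, ?_⟩
  · have hsource : ∀ᶠ a : P in 𝓝 0, (a, (0 : Q)) ∈ f.source :=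
      (Continuous.prodMk_left (0 : Q)).continuousAt.eventually_mem (f.open_source.mem_nhds h0)
    filter_upwards [hsource] with a ha
    rw [← expMulOneAdd_left Q a]
    exact congrArg Prod.fst (f.left_inv ha)
  · have hunit : ∀ᶠ t in 𝓝 1, IsUnit (1 + ((f.symm t).2 : A)) := by
      have hcont : ContinuousAt (fun t => 1 + ((f.symm t).2 : A)) 1 :=
        continuousAt_const.add (Q.subtypeL.continuous.comp continuous_snd |>.continuousAt.comp
          hanalytic.continuousAt)
      exact hcont.eventually_mem (Units.isOpen.mem_nhds (by simp [hsymm]))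
    filter_upwards [hunit, f.open_target.mem_nhds h1] with t ht ht'
    exact ⟨(f.symm t).2, ht, f.right_inv ht'⟩

end EndExp

namespace DecFiltration

variable {V : Type*} [NormedAddCommGroup V] [NormedSpace ℂ V] {F : DecFiltration V}

theorem map_map (F : DecFiltration V) (A B : V →L[ℂ] V) : (F.map A).map B = F.map (B * A) :=
  DecFiltration.ext (funext fun p => (Submodule.map_comp A.toLinearMap B.toLinearMap (F p)).symm)

theorem map_one (F : DecFiltration V) : F.map 1 = F :=
  DecFiltration.ext (funext fun p => Submodule.map_id (F p))

theorem isOpen_iff {N : Set (DecFiltration V)} :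
    IsOpen N ↔ ∀ F : DecFiltration V, IsOpen {g : (V →L[ℂ] V)ˣ | F.map (g : V →L[ℂ] V) ∈ N} :=
  isOpen_iSup_iff

theorem isOpen_image_map (F : DecFiltration V) {T : Set (V →L[ℂ] V)} (hT : IsOpen T) :
    IsOpen ((fun A => F.map A) '' T) := by
  rw [isOpen_iff]
  intro F'
  rw [isOpen_iff_mem_nhds]
  rintro g₀ ⟨t₀, ht₀, hFt₀⟩
  have hcont : Continuous fun g : (V →L[ℂ] V)ˣ => (g : V →L[ℂ] V) * (↑g₀⁻¹ * t₀) :=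
    Units.continuous_val.mul continuous_const
  have hmem : ∀ᶠ g : (V →L[ℂ] V)ˣ in 𝓝 g₀, (g : V →L[ℂ] V) * (↑g₀⁻¹ * t₀) ∈ T :=
    hcont.continuousAt.eventually_mem (hT.mem_nhds (by rwa [Units.mul_inv_cancel_left]))
  filter_upwards [hmem] with g hg
  refine ⟨_, hg, ?_⟩
  change F.map t₀ = _ at hFt₀
  change F.map _ = F'.map _
  rw [← mul_assoc, ← map_map, hFt₀, map_map, mul_assoc, Units.inv_mul, mul_one]

theorem continuousAt_map [CompleteSpace V] (F : DecFiltration V) (g : (V →L[ℂ] V)ˣ) :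
    ContinuousAt (fun A : V →L[ℂ] V => F.map A) g := by
  rw [← Units.isOpenEmbedding_val.continuousAt_iff]
  exact (continuous_def.2 fun N hN => isOpen_iff.1 hN F).continuousAt

theorem map_eq_self [FiniteDimensional ℂ V] {A : V →L[ℂ] V} (hA : IsUnit A)
    (hAF : ∀ p, ∀ x ∈ F p, A x ∈ F p) : F.map A = F := by
  have hinj : Function.Injective A := by
    obtain ⟨g, rfl⟩ := hA
    exact Function.LeftInverse.injective (g := (↑g⁻¹ : V →L[ℂ] V)) fun x =>
      DFunLike.congr_fun (Units.inv_mul g) x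
  exact DecFiltration.ext <| funext fun p => Submodule.eq_of_le_of_finrank_eq
    (Submodule.map_le_iff_le_comap.2 (hAF p))
    (Submodule.equivMapOfInjective A.toLinearMap hinj (F p)).finrank_eq.symm

/-- A function on `GL(V)` that is constant on the fibers of `g ↦ g.F` descends to the orbit. -/
theorem exists_holomorphicAt_of_factorsThrough {E : Type*} [NormedAddCommGroup E] [NormedSpace ℂ E]
    {T : Set (V →L[ℂ] V)} (hT : IsOpen T) {l : (V →L[ℂ] V) → E}
    (hl : ∀ t ∈ T, AnalyticAt ℂ l t)
    (hfactors : ∀ t ∈ T, ∀ t' ∈ T, F.map t = F.map t' → l t = l t') :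
    ∃ ψ : DecFiltration V → E, (∀ t ∈ T, ψ (F.map t) = l t) ∧
      ∀ F' ∈ ((fun A => F.map A) '' T), ContinuousAt ψ F' ∧ HolomorphicAt ψ F' := by
  let ψ : DecFiltration V → E := Function.extend (fun t : T => F.map t) (fun t : T => l t) 0
  have hψ (t : V →L[ℂ] V) (ht : t ∈ T) : ψ (F.map t) = l t :=
    Function.FactorsThrough.extend_apply (f := fun t : T => F.map t) (g := fun t : T => l t)
      (fun t t' h => hfactors t t.2 t' t'.2 h) 0 ⟨t, ht⟩
  refine ⟨ψ, hψ, ?_⟩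
  rintro _ ⟨t, ht, rfl⟩
  constructor
  · rw [ContinuousAt, hψ t ht]
    refine fun B hB => ?_
    obtain ⟨B', hB'B, hB', htB'⟩ := mem_nhds_iff.1 hB
    have hcont : ContinuousOn l T := fun t ht => (hl t ht).continuousAt.continuousWithinAt
    have hopen := isOpen_image_map F (hcont.isOpen_inter_preimage hT hB')
    refine Filter.mem_map.2 (Filter.mem_of_superset (hopen.mem_nhds ⟨t, ⟨ht, htB'⟩, rfl⟩) ?_)
    rintro _ ⟨t', ⟨ht', ht'B⟩, rfl⟩
    exact hB'B (by rwa [hψ t' ht'])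
  · have hmul : AnalyticAt ℂ (fun A : V →L[ℂ] V => A * t) 1 := analyticAt_id.mul analyticAt_const
    have hmem : ∀ᶠ A : V →L[ℂ] V in 𝓝 1, A * t ∈ T :=
      hmul.continuousAt.eventually_mem (hT.mem_nhds (by rwa [one_mul]))
    refine (AnalyticAt.comp (g := l) (by rw [one_mul]; exact hl t ht) hmul).congr ?_
    filter_upwards [hmem] with A hA
    rw [Function.comp_apply, map_map, hψ _ hA]

end DecFiltration

namespace DecFiltration

open EndExp

variable {V : Type*} [NormedAddCommGroup V] [NormedSpace ℂ V]
  {E : Submodule ℂ (V →L[ℂ] V)} {X : Set (DecFiltration V)} {F : DecFiltration V}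

variable (E F) in
/-- The map `u ↦ exp(u).F` on a subspace `E` of `gl(V)`. -/
abbrev expMap (u : E) : DecFiltration V := F.map (NormedSpace.exp (u : V →L[ℂ] V))

theorem expMap_zero : expMap E F 0 = F := by
  rw [expMap, ZeroMemClass.coe_zero, NormedSpace.exp_zero, map_one]

variable (E X F) in
/-- `u ↦ exp(u).F` maps the neighborhood `U` of `0` in `E` bijectively onto `N ∩ X`, and the inverse
map is the restriction of the holomorphic function `ψ` on `N`. -/
structure IsExpChart (U : Set E) (N : Set (DecFiltration V)) (ψ : DecFiltration V → E) : Prop where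
  isOpen_source : IsOpen U
  isOpen_target : IsOpen N
  zero_mem : 0 ∈ U
  map_mem : ∀ u ∈ U, expMap E F u ∈ N ∩ X
  left_inv : ∀ u ∈ U, ψ (expMap E F u) = u
  symm_mem : ∀ F' ∈ N ∩ X, ψ F' ∈ U
  right_inv : ∀ F' ∈ N ∩ X, expMap E F (ψ F') = F'
  continuousOn : ContinuousOn ψ N
  holomorphicAt : ∀ F' ∈ N, HolomorphicAt ψ F'

theorem IsExpChart.restrict [FiniteDimensional ℂ V] {U : Set E} {N : Set (DecFiltration V)}
    {ψ : DecFiltration V → E} (h : IsExpChart E X F U N ψ)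
    {E' : Submodule ℂ (V →L[ℂ] V)} (hE : E' ≤ E) {X' : Set (DecFiltration V)} (hX : X' ⊆ X)
    (hmem : ∀ u ∈ U, expMap E F u ∈ X' ↔ (u : V →L[ℂ] V) ∈ E') :
    ∃ P : E →ₗ[ℂ] E', IsExpChart E' X' F (Submodule.inclusion hE ⁻¹' U) N (P ∘ ψ) := by
  obtain ⟨P, hP⟩ := (Submodule.inclusion hE).exists_leftInverse_of_injective
    (LinearMap.ker_eq_bot.2 (Submodule.inclusion_injective hE))
  have hsymm : ∀ F' ∈ N ∩ X', Submodule.inclusion hE (P (ψ F')) = ψ F' := fun F' hF' => by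
    have hmem' : (ψ F' : V →L[ℂ] V) ∈ E' := (hmem _ (h.symm_mem F' ⟨hF'.1, hX hF'.2⟩)).1 <| by
      rw [h.right_inv F' ⟨hF'.1, hX hF'.2⟩]
      exact hF'.2
    exact congrArg (Submodule.inclusion hE) (DFunLike.congr_fun hP ⟨ψ F', hmem'⟩)
  have hcont : Continuous (Submodule.inclusion hE) :=
    (Submodule.inclusion hE).continuous_of_finiteDimensional
  have hanalytic (e : E) : AnalyticAt ℂ P e :=
    ContinuousLinearMap.analyticAt (𝕜 := ℂ) (E := E) (F := E') P.toContinuousLinearMap e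
  refine ⟨P, h.isOpen_source.preimage hcont, h.isOpen_target, ?_,
    fun u hu => ⟨(h.map_mem _ hu).1, (hmem _ hu).2 u.2⟩, fun u hu => ?_, fun F' hF' => ?_,
    fun F' hF' => ?_, P.continuous_of_finiteDimensional.comp_continuousOn h.continuousOn,
    fun F' hF' => (hanalytic _).comp (h.holomorphicAt F' hF')⟩
  · rw [Set.mem_preimage, map_zero]
    exact h.zero_mem
  · exact (congrArg P (h.left_inv _ hu)).trans (DFunLike.congr_fun hP u)
  · rw [Set.mem_preimage, Function.comp_apply, hsymm F' hF']
    exact h.symm_mem F' ⟨hF'.1, hX hF'.2⟩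
  · exact (congrArg (expMap E F) (hsymm F' hF')).trans (h.right_inv F' ⟨hF'.1, hX hF'.2⟩)

variable [CompleteSpace V]

theorem continuous_expMap : Continuous (expMap E F) :=
  continuous_iff_continuousAt.2 fun u =>
    ContinuousAt.comp (f := fun u : E => NormedSpace.exp (u : V →L[ℂ] V))
      (continuousAt_map F (expUnit (u : V →L[ℂ] V)))
      (continuous_exp.comp continuous_subtype_val).continuousAt

theorem analyticAt_comp_expMap {E₁ : Type*} [NormedAddCommGroup E₁] [NormedSpace ℂ E₁]
    {ζ : DecFiltration V → E₁} {u : E} (hu : ∀ᶠ u' in 𝓝 u, expMap E F u' ∈ X)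
    (hζ : HolomorphicOnAt X ζ (expMap E F u)) :
    AnalyticAt ℂ (fun u' => ζ (expMap E F u')) u := by
  obtain ⟨ζ', hζ', heq⟩ := hζ
  have htranslate : AnalyticAt ℂ (fun u' : E =>
      NormedSpace.exp (u' : V →L[ℂ] V) * NormedSpace.exp (-(u : V →L[ℂ] V))) u :=
    (analyticAt_exp_subtype E u).mul analyticAt_const
  have hcomp : AnalyticAt ℂ (fun u' : E => ζ' ((expMap E F u).map
      (NormedSpace.exp (u' : V →L[ℂ] V) * NormedSpace.exp (-(u : V →L[ℂ] V))))) u :=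
    AnalyticAt.comp (g := fun A => ζ' ((expMap E F u).map A)) (by rwa [exp_mul_neg]) htranslate
  have hlim : Filter.Tendsto (expMap E F) (𝓝 u) (𝓝[X] (expMap E F u)) :=
    tendsto_nhdsWithin_iff.2 ⟨continuous_expMap.continuousAt, hu⟩
  refine hcomp.congr ?_
  filter_upwards [hlim.eventually heq] with u' hu'
  rw [hu', expMap, map_map, mul_assoc, exp_neg_mul, mul_one]

theorem IsExpChart.isBiholomorphicOn {U : Set E} {N : Set (DecFiltration V)}
    {ψ : DecFiltration V → E} (h : IsExpChart E X F U N ψ) :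
    IsBiholomorphicOn X (expMap E F) U N := by
  have hinv : Set.InvOn ψ (expMap E F) U (N ∩ X) := ⟨h.left_inv, h.right_inv⟩
  refine ⟨h.isOpen_source, h.isOpen_target, hinv.bijOn h.map_mem h.symm_mem, fun u hu => ?_, ψ,
    hinv, h.continuousOn.mono Set.inter_subset_left,
    fun F' hF' => ⟨ψ, h.holomorphicAt F' hF'.1, Filter.Eventually.of_forall fun _ => rfl⟩⟩
  have hX : ∀ᶠ u' in 𝓝 u, expMap E F u' ∈ X := by
    filter_upwards [h.isOpen_source.mem_nhds hu] with u' hu'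
    exact (h.map_mem u' hu').2
  refine ⟨continuous_expMap.continuousAt, hX, fun ζ hζ => ?_⟩
  rw [contMDiffAt_iff_contDiffAt]
  exact (analyticAt_comp_expMap hX hζ).contDiffAt

end DecFiltration

namespace GradedPolarizationData

open DecFiltration EndExp

variable {V : Type*} [NormedAddCommGroup V] [NormedSpace ℂ V] [FiniteDimensional ℂ V]
  [Module ℚ V] {D : GradedPolarizationData V} {F : DecFiltration V}

namespace IsDeligneBigrading

variable {I : ℤ → ℤ → Submodule ℂ V} (hI : D.IsDeligneBigrading F I)

include hI

theorem exp_eq_of_map_exp_eq {a b : V →L[ℂ] V} (ha : a ∈ lowering I) (hb : b ∈ lowering I)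
    (h : F.map (NormedSpace.exp a) = F.map (NormedSpace.exp b)) :
    NormedSpace.exp a = NormedSpace.exp b := by
  have ha' := exp_sub_one_mem_lowering ha
  have hb' := exp_sub_one_mem_lowering (neg_mem hb)
  have hlowering : NormedSpace.exp (-b) * NormedSpace.exp a - 1 ∈ lowering I := by
    convert add_mem (mul_mem_lowering hb' ha') (add_mem hb' ha') using 1
    noncomm_ring
  have hstabilizer : NormedSpace.exp (-b) * NormedSpace.exp a - 1 ∈ stabilizer F := fun p x hx =>
    sub_mem (mem_map_exp.1 (h ▸ Submodule.mem_map_of_mem hx)) hx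
  have hzero : NormedSpace.exp (-b) * NormedSpace.exp a = 1 := sub_eq_zero.1 <|
    Submodule.disjoint_def.1 hI.isCompl_lowering_stabilizer.disjoint _ hlowering hstabilizer
  calc NormedSpace.exp a = NormedSpace.exp b * (NormedSpace.exp (-b) * NormedSpace.exp a) := by
        rw [← mul_assoc, exp_mul_neg, one_mul]
    _ = NormedSpace.exp b := by rw [hzero, mul_one]

theorem exists_isExpChart_lowering {O₀ : Set (lowering I)} (hO₀ : O₀ ∈ 𝓝 0) :
    ∃ U ⊆ O₀, ∃ N ψ, IsExpChart (lowering I) Set.univ F U N ψ := by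
  obtain ⟨l, hl, hlexp, hlmul⟩ :=
    exists_analyticAt_exp_mul_one_add_eq hI.isCompl_lowering_stabilizer
  have hmap : ∀ᶠ t in 𝓝 1, F.map t = F.map (NormedSpace.exp (l t : V →L[ℂ] V)) := by
    filter_upwards [hlmul] with t ⟨b, hb, hbt⟩
    have hfix : F.map (1 + (b : V →L[ℂ] V)) = F :=
      map_eq_self hb fun p x hx => add_mem hx (b.2 p x hx)
    calc F.map t = (F.map (1 + (b : V →L[ℂ] V))).map (NormedSpace.exp (l t : V →L[ℂ] V)) := by
          rw [map_map, hbt]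
      _ = F.map (NormedSpace.exp (l t : V →L[ℂ] V)) := by rw [hfix]
  obtain ⟨T₁, hT₁, hT₁open, h1T₁⟩ := eventually_nhds_iff.1 (hmap.and hl.eventually_analyticAt)
  have hexp : ∀ᶠ a : lowering I in 𝓝 0, NormedSpace.exp (a : V →L[ℂ] V) ∈ T₁ :=
    (continuous_exp.comp continuous_subtype_val).continuousAt.eventually_mem <|
      hT₁open.mem_nhds (by simpa using h1T₁)
  obtain ⟨O, hO, hOopen, h0O⟩ := eventually_nhds_iff.1 (hlexp.and (hexp.and hO₀))
  let T : Set (V →L[ℂ] V) := T₁ ∩ l ⁻¹' O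
  have hTopen : IsOpen T := ContinuousOn.isOpen_inter_preimage
    (fun t ht => (hT₁ t ht).2.continuousAt.continuousWithinAt) hT₁open hOopen
  have hexpT (a) (ha : a ∈ O) : NormedSpace.exp (a : V →L[ℂ] V) ∈ T :=
    ⟨(hO a ha).2.1, Set.mem_preimage.2 ((hO a ha).1.symm ▸ ha)⟩
  obtain ⟨ψ, hψ, hψhol⟩ := exists_holomorphicAt_of_factorsThrough hTopen
    (fun t ht => (hT₁ t ht.1).2) fun t ht t' ht' heq => by
      rw [(hT₁ t ht.1).1, (hT₁ t' ht'.1).1] at heq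
      rw [← (hO _ ht.2).1, ← (hO _ ht'.2).1, hI.exp_eq_of_map_exp_eq (l t).2 (l t').2 heq]
  refine ⟨O, fun a ha => (hO a ha).2.2, _, ψ, hOopen, isOpen_image_map F hTopen, h0O,
    fun a ha => ⟨⟨_, hexpT a ha, rfl⟩, Set.mem_univ _⟩,
    fun a ha => (hψ _ (hexpT a ha)).trans (hO a ha).1, ?_, ?_,
    fun F' hF' => (hψhol F' hF').1.continuousWithinAt, fun F' hF' => (hψhol F' hF').2⟩
  · rintro _ ⟨⟨t, ht, rfl⟩, -⟩
    exact (hψ t ht).symm ▸ ht.2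
  · rintro _ ⟨⟨t, ht, rfl⟩, -⟩
    exact (congrArg (expMap (lowering I) F) (hψ t ht)).trans (hT₁ t ht.1).1.symm

end IsDeligneBigrading

theorem exists_isExpChart (hF : F ∈ D.M) : ∃ U N ψ, IsExpChart (D.q F) D.M F U N ψ := by
  have hI := hF.1.isDeligneBigrading
  have hq : D.q F = lowering (D.I F) ⊓ D.lieGC := q_eq hI (firstRelation_of_mem_M hF)
  have hmem_M : ∀ᶠ a : lowering (D.I F) in 𝓝 0,
      (a : V →L[ℂ] V) ∈ D.lieGC → expMap (lowering (D.I F)) F a ∈ D.M :=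
    (continuous_subtype_val.continuousAt (x := (0 : lowering (D.I F)))).eventually
      (eventually_map_exp_mem_M hF)
  obtain ⟨U, hU, N, ψ, hψ⟩ := hI.exists_isExpChart_lowering hmem_M
  obtain ⟨P, hP⟩ := hψ.restrict (hq.le.trans inf_le_left) (Set.subset_univ D.M) fun a ha =>
    ⟨fun haM => hq ▸ ⟨a.2, hI.mem_lieGC_of_map_exp_mem a.2 (M_subset_compactDual hF)
      (M_subset_compactDual haM)⟩, fun haq => hU ha (hq ▸ haq : _ ∈ lowering _ ⊓ D.lieGC).2⟩
  exact ⟨_, _, _, hP⟩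

end GradedPolarizationData

/-! ### Tangent vectors and horizontal maps -/

section Analytic

variable {E G : Type*} [NormedAddCommGroup E] [NormedSpace ℂ E] [NormedAddCommGroup G]
  [NormedSpace ℂ G]

/-- **Hadamard's lemma** -/
theorem exists_analyticAt_eq_add_apply [CompleteSpace G] {f : E → G} (hf : AnalyticAt ℂ f 0) :
    ∃ g : E → E →L[ℂ] G, AnalyticAt ℂ g 0 ∧ ∀ᶠ y in 𝓝 0, f y = f 0 + g y y := by
  obtain ⟨p, r, hp⟩ := hf
  have hr : 0 < p.shift.radius := by
    rw [FormalMultilinearSeries.radius_shift]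
    exact hp.r_pos.trans_le hp.r_le
  have hshift := p.shift.hasFPowerSeriesOnBall hr
  refine ⟨p.shift.sum, hshift.analyticAt, ?_⟩
  have hball : Metric.eball (0 : E) (min r p.shift.radius) ∈ 𝓝 0 :=
    Metric.eball_mem_nhds _ (lt_min hp.r_pos hr)
  filter_upwards [hball] with y hy
  have hsum := hp.hasSum (y := y) (Metric.eball_subset_eball (min_le_left _ _) hy)
  have hsum_shift := hshift.hasSum (y := y) (Metric.eball_subset_eball (min_le_right _ _) hy)
  rw [zero_add] at hsum hsum_shift
  have hsnoc (n : ℕ) : (fun _ : Fin (n + 1) => y) = Fin.snoc (fun _ : Fin n => y) y :=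
    (Fin.snoc_init_self fun _ => y).symm
  have htail : HasSum (fun n => p (n + 1) fun _ => y) (p.shift.sum y y) :=
    ((ContinuousLinearMap.apply ℂ G y).hasSum hsum_shift).congr_fun fun n =>
      congrArg (p (n + 1)) (hsnoc n)
  rw [← ((hasSum_nat_add_iff' 1).2 hsum).unique htail, Finset.sum_range_one, hp.coeff_zero]
  abel

theorem exists_analyticAt_eq_add_sum_mul_repr [FiniteDimensional ℂ E] {ι : Type*} [Fintype ι]
    (b : Module.Basis ι ℂ E) {f : E → ℂ} (hf : AnalyticAt ℂ f 0) :
    ∃ g : ι → E → ℂ, (∀ i, AnalyticAt ℂ (g i) 0) ∧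
      ∀ᶠ y in 𝓝 0, f y = f 0 + ∑ i, g i y * b.repr y i := by
  obtain ⟨g, hg, hfg⟩ := exists_analyticAt_eq_add_apply hf
  refine ⟨fun i y => g y (b i),
    fun i => ((ContinuousLinearMap.apply ℂ ℂ (b i)).analyticAt _).comp hg, ?_⟩
  filter_upwards [hfg] with y hy
  rw [hy]
  conv_lhs => rw [← b.sum_repr y, map_sum]
  simp only [map_smul, smul_eq_mul, mul_comm, b.sum_repr]

theorem mfderiv_comp_apply_of_hasFDerivAt {E' S : Type*} [NormedAddCommGroup E']
    [NormedSpace ℂ E'] [TopologicalSpace S] [ChartedSpace E S] {k : S → E'} {f : E' → G}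
    {f' : E' →L[ℂ] G} {s : S} (hf : HasFDerivAt f f' (k s))
    (hk : MDifferentiableAt 𝓘(ℂ, E) 𝓘(ℂ, E') k s) (v : TangentSpace 𝓘(ℂ, E) s) :
    (mfderiv 𝓘(ℂ, E) 𝓘(ℂ, G) (fun s' => f (k s')) s v : G) =
      f' (mfderiv 𝓘(ℂ, E) 𝓘(ℂ, E') k s v : E') :=
  DFunLike.congr_fun (hf.hasMFDerivAt.comp s hk.hasMFDerivAt).mfderiv v

theorem contMDiffAt_of_forall_clm_comp {E' S : Type*} [NormedAddCommGroup E'] [NormedSpace ℂ E']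
    [FiniteDimensional ℂ E'] [TopologicalSpace S] [ChartedSpace E S] {k : S → E'} {s : S}
    (hk : ∀ l : E' →L[ℂ] ℂ, ContMDiffAt 𝓘(ℂ, E) 𝓘(ℂ, ℂ) ω (fun s' => l (k s')) s) :
    ContMDiffAt 𝓘(ℂ, E) 𝓘(ℂ, E') ω k s := by
  let e := (Module.finBasis ℂ E').equivFun.toContinuousLinearEquiv
  have he : ContMDiffAt 𝓘(ℂ, E) 𝓘(ℂ, Fin (Module.finrank ℂ E') → ℂ) ω (fun s' => e (k s')) s :=
    contMDiffAt_pi_space.2 fun i => hk <|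
      (ContinuousLinearMap.proj (R := ℂ) (φ := fun _ => ℂ) i).comp
        (e : E' →L[ℂ] (Fin (Module.finrank ℂ E') → ℂ))
  refine ((e.symm : (Fin (Module.finrank ℂ E') → ℂ) →L[ℂ] E').contMDiff.contMDiffAt.comp s he
    (n := ω)).congr_of_eventuallyEq (Filter.Eventually.of_forall fun s' => ?_)
  exact (e.symm_apply_apply _).symm

end Analytic

namespace DecFiltration

variable {V : Type*} [NormedAddCommGroup V] [NormedSpace ℂ V] {X : Set (DecFiltration V)}
  {F : DecFiltration V}

theorem tangentSpaceAt_leibniz (δ : tangentSpaceAt X F) (ζ η : holomorphicFunctions X F) :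
    δ.1 (ζ * η) = ζ.1 F * δ.1 η + η.1 F * δ.1 ζ :=
  δ.2 ζ η

theorem tangentSpaceAt_congr (hF : F ∈ X) (δ : tangentSpaceAt X F)
    {ζ η : holomorphicFunctions X F} (h : ∀ᶠ F' in 𝓝[X] F, ζ.1 F' = η.1 F') :
    δ.1 ζ = δ.1 η := by
  classical
  let Z : Set (DecFiltration V) := {F' | ζ.1 F' = η.1 F'}
  let χ : holomorphicFunctions X F := ⟨Z.indicator 1, fun _ => 1, analyticAt_const, by
    filter_upwards [h] with F' hF'
    exact Set.indicator_of_mem (s := Z) hF' 1⟩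
  have hζη : ζ.1 F = η.1 F := h.self_of_nhdsWithin hF
  have hχ : χ.1 F = 1 := Set.indicator_of_mem (s := Z) hζη 1
  have hmul : (ζ - η) * χ = 0 := by
    ext F'
    change (ζ.1 F' - η.1 F') * Z.indicator 1 F' = 0
    by_cases hF' : F' ∈ Z
    · rw [show ζ.1 F' = η.1 F' from hF', sub_self, zero_mul]
    · rw [Set.indicator_of_notMem hF', mul_zero]
  have hleibniz := tangentSpaceAt_leibniz δ (ζ - η) χ
  rw [hmul, map_zero, hχ, one_mul, map_sub, show (ζ - η).1 F = 0 from sub_eq_zero.2 hζη, zero_mul,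
    zero_add] at hleibniz
  exact sub_eq_zero.1 hleibniz.symm

theorem tangentSpaceAt_algebraMap (δ : tangentSpaceAt X F) (c : ℂ) :
    δ.1 (algebraMap ℂ (holomorphicFunctions X F) c) = 0 := by
  have hleibniz := tangentSpaceAt_leibniz δ 1 1
  rw [mul_one, show (1 : holomorphicFunctions X F).1 F = 1 from rfl, one_mul] at hleibniz
  rw [Algebra.algebraMap_eq_smul_one, map_smul, left_eq_add.1 hleibniz, smul_zero]

/-- `φ` parametrizes `X` near `F = φ 0` holomorphically, with holomorphic inverse `ψ`. -/
structure IsParametrizationAt {E : Type*} [NormedAddCommGroup E] [NormedSpace ℂ E]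
    (X : Set (DecFiltration V)) (F : DecFiltration V) (φ : E → DecFiltration V)
    (ψ : DecFiltration V → E) : Prop where
  mem : F ∈ X
  apply_zero : φ 0 = F
  analyticAt_comp : ∀ ζ : DecFiltration V → ℂ, HolomorphicOnAt X ζ F →
    AnalyticAt ℂ (fun u => ζ (φ u)) 0
  left_inv : ∀ᶠ u in 𝓝 0, ψ (φ u) = u
  right_inv : ∀ᶠ F' in 𝓝[X] F, φ (ψ F') = F'
  continuousAt : ContinuousAt ψ F
  holomorphicAt : HolomorphicAt ψ F

namespace IsParametrizationAt

variable {E : Type*} [NormedAddCommGroup E] [NormedSpace ℂ E] {φ : E → DecFiltration V}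
    {ψ : DecFiltration V → E} (h : IsParametrizationAt X F φ ψ)

include h

theorem symm_apply : ψ F = 0 := by
  simpa only [h.apply_zero] using h.left_inv.self_of_nhds

theorem hasFDerivAt_comp (ζ : holomorphicFunctions X F) :
    HasFDerivAt (fun u => ζ.1 (φ u)) (fderiv ℂ (fun u => ζ.1 (φ u)) 0) 0 :=
  (h.analyticAt_comp _ ζ.2).differentiableAt.hasFDerivAt

/-- The differential of `φ` at `0`, which sends `u` to the derivation `ζ ↦ d/dt ζ(φ(tu))` at
`t = 0`. -/
def tangentMap : E →ₗ[ℂ] tangentSpaceAt X F where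
  toFun u := ⟨{
    toFun ζ := fderiv ℂ (fun u => ζ.1 (φ u)) 0 u
    map_add' ζ η := DFunLike.congr_fun ((h.hasFDerivAt_comp ζ).add (h.hasFDerivAt_comp η)).fderiv u
    map_smul' c ζ := DFunLike.congr_fun ((h.hasFDerivAt_comp ζ).const_smul c).fderiv u },
    fun ζ η => by
      have := DFunLike.congr_fun ((h.hasFDerivAt_comp ζ).mul (h.hasFDerivAt_comp η)).fderiv u
      rwa [h.apply_zero] at this⟩
  map_add' u v := Subtype.ext <| LinearMap.ext fun ζ =>
    map_add (fderiv ℂ (fun u => ζ.1 (φ u)) 0) u v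
  map_smul' c u := Subtype.ext <| LinearMap.ext fun ζ =>
    map_smul (fderiv ℂ (fun u => ζ.1 (φ u)) 0) c u

theorem hasDerivAt_tangentMap (u : E) (ζ : holomorphicFunctions X F) :
    HasDerivAt (fun t : ℂ => ζ.1 (φ (t • u))) ((h.tangentMap u).1 ζ) 0 := by
  have hline : HasDerivAt (fun t : ℂ => t • u) u 0 := by
    simpa using (hasDerivAt_id (0 : ℂ)).smul_const u
  exact HasFDerivAt.comp_hasDerivAt_of_eq 0 (h.hasFDerivAt_comp ζ) hline (zero_smul ℂ u).symm

/-- The holomorphic function `f ∘ ψ` on `X` near `F`, for `f` a holomorphic function on `E` near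
`0`. -/
def pullback {f : E → ℂ} (hf : AnalyticAt ℂ f 0) : holomorphicFunctions X F :=
  ⟨fun F' => f (ψ F'), fun F' => f (ψ F'),
    AnalyticAt.comp (g := f) (f := fun A => ψ (F.map A))
      (by rwa [map_one, h.symm_apply]) h.holomorphicAt, Filter.Eventually.of_forall fun _ => rfl⟩

theorem pullback_apply {f : E → ℂ} (hf : AnalyticAt ℂ f 0) (F' : DecFiltration V) :
    (h.pullback hf).1 F' = f (ψ F') :=
  rfl

theorem tangentMap_pullback (u : E) {f : E → ℂ} (hf : AnalyticAt ℂ f 0) :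
    (h.tangentMap u).1 (h.pullback hf) = fderiv ℂ f 0 u := by
  have heq : (fun v => (h.pullback hf).1 (φ v)) =ᶠ[𝓝 0] f := by
    filter_upwards [h.left_inv] with v hv
    rw [pullback_apply, hv]
  exact DFunLike.congr_fun heq.fderiv_eq u

theorem injective_tangentMap : Function.Injective h.tangentMap := by
  refine (injective_iff_map_eq_zero _).2 fun u hu =>
    SeparatingDual.eq_zero_of_forall_dual_eq_zero (R := ℂ) fun l => ?_
  rw [← l.fderiv (x := 0), ← h.tangentMap_pullback u (l.analyticAt 0), hu]
  rfl

variable [FiniteDimensional ℂ E]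

/-- The `i`-th coordinate of `ψ` in the basis `b`. -/
def coordinate {ι : Type*} (b : Module.Basis ι ℂ E) (i : ι) : holomorphicFunctions X F :=
  h.pullback ((b.coord i).toContinuousLinearMap.analyticAt 0)

theorem exists_forall_tangentSpaceAt_apply_eq_sum {ι : Type*} [Fintype ι] (b : Module.Basis ι ℂ E)
    (ζ : holomorphicFunctions X F) :
    ∃ c : ι → ℂ, ∀ δ : tangentSpaceAt X F, δ.1 ζ = ∑ i, c i * δ.1 (h.coordinate b i) := by
  obtain ⟨g, hg, hζg⟩ := exists_analyticAt_eq_add_sum_mul_repr b (h.analyticAt_comp _ ζ.2)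
  refine ⟨fun i => g i 0, fun δ => ?_⟩
  have hψ : Filter.Tendsto ψ (𝓝[X] F) (𝓝 0) :=
    h.symm_apply ▸ h.continuousAt.mono_left nhdsWithin_le_nhds
  have hexpansion : δ.1 ζ = δ.1 (algebraMap ℂ _ (ζ.1 F) +
      ∑ i, h.pullback (hg i) * h.coordinate b i) := by
    refine tangentSpaceAt_congr h.mem δ ?_
    filter_upwards [hψ.eventually hζg, h.right_inv] with F' hF' hφψ
    rw [hφψ, h.apply_zero] at hF'
    rw [hF']
    simp only [Subalgebra.coe_add, AddSubmonoidClass.coe_finsetSum, Pi.add_apply,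
      Finset.sum_apply]
    rfl
  rw [hexpansion, map_add, tangentSpaceAt_algebraMap, zero_add, map_sum]
  refine Finset.sum_congr rfl fun i _ => ?_
  have hcoord : (h.coordinate b i).1 F = 0 :=
    (congrArg (b.coord i) h.symm_apply).trans (map_zero _)
  rw [tangentSpaceAt_leibniz, hcoord, zero_mul, add_zero, pullback_apply, h.symm_apply]

theorem surjective_tangentMap : Function.Surjective h.tangentMap := by
  intro δ
  let b := Module.finBasis ℂ E
  refine ⟨∑ i, δ.1 (h.coordinate b i) • b i, Subtype.ext (LinearMap.ext fun ζ => ?_)⟩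
  obtain ⟨c, hc⟩ := h.exists_forall_tangentSpaceAt_apply_eq_sum b ζ
  rw [hc, hc]
  refine Finset.sum_congr rfl fun i _ => ?_
  rw [coordinate, h.tangentMap_pullback, ContinuousLinearMap.fderiv]
  exact congrArg (c i * ·) (congrFun (b.repr_sum_self _) i)

/-- The isomorphism of `E` with the tangent space that a parametrization induces. -/
def tangentEquiv : E ≃ₗ[ℂ] tangentSpaceAt X F :=
  LinearEquiv.ofBijective h.tangentMap ⟨h.injective_tangentMap, h.surjective_tangentMap⟩

end IsParametrizationAt

end DecFiltration

namespace DecFiltration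

variable {V : Type*} [NormedAddCommGroup V] [NormedSpace ℂ V] {X : Set (DecFiltration V)}
  {F : DecFiltration V}

namespace IsParametrizationAt

variable {E : Type*} [NormedAddCommGroup E] [NormedSpace ℂ E] {φ : E → DecFiltration V}
    {ψ : DecFiltration V → E} {B S : Type*} [NormedAddCommGroup B] [NormedSpace ℂ B]
    [TopologicalSpace S] [ChartedSpace B S] {Φ : S → DecFiltration V} {s : S}

theorem eventually_apply_eq (h : IsParametrizationAt X (Φ s) φ ψ)
    (hΦ : HolomorphicMapAt B X Φ s) : ∀ᶠ s' in 𝓝 s, φ (ψ (Φ s')) = Φ s' :=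
  (tendsto_nhdsWithin_iff.2 ⟨hΦ.1, hΦ.2.1⟩ : Filter.Tendsto Φ (𝓝 s) (𝓝[X] (Φ s))).eventually
    h.right_inv

variable [FiniteDimensional ℂ E]

theorem contMDiffAt_comp (h : IsParametrizationAt X (Φ s) φ ψ) (hΦ : HolomorphicMapAt B X Φ s) :
    ContMDiffAt 𝓘(ℂ, B) 𝓘(ℂ, E) ω (fun s' => ψ (Φ s')) s :=
  contMDiffAt_of_forall_clm_comp fun l => hΦ.2.2 _ (h.pullback (l.analyticAt 0)).2

theorem mfderiv_comp_eq_tangentEquiv (h : IsParametrizationAt X (Φ s) φ ψ)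
    (hΦ : HolomorphicMapAt B X Φ s) (v : TangentSpace 𝓘(ℂ, B) s)
    (ζ : holomorphicFunctions X (Φ s)) :
    (mfderiv 𝓘(ℂ, B) 𝓘(ℂ, ℂ) (fun s' => ζ.1 (Φ s')) s v : ℂ) =
      (h.tangentEquiv (mfderiv 𝓘(ℂ, B) 𝓘(ℂ, E) (fun s' => ψ (Φ s')) s v : E)).1 ζ := by
  have heq : (fun s' => ζ.1 (Φ s')) =ᶠ[𝓝 s] fun s' => ζ.1 (φ (ψ (Φ s'))) := by
    filter_upwards [h.eventually_apply_eq hΦ] with s' hs'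
    rw [hs']
  have hderiv : HasFDerivAt (fun u => ζ.1 (φ u)) (fderiv ℂ (fun u => ζ.1 (φ u)) 0) (ψ (Φ s)) := by
    rw [h.symm_apply]
    exact h.hasFDerivAt_comp ζ
  rw [heq.mfderiv_eq]
  exact mfderiv_comp_apply_of_hasFDerivAt (k := fun s' => ψ (Φ s')) hderiv
    ((h.contMDiffAt_comp hΦ).mdifferentiableAt (by simp)) v

end IsParametrizationAt

variable {E : Submodule ℂ (V →L[ℂ] V)}

theorem IsExpChart.isParametrizationAt [CompleteSpace V] {U : Set E} {N : Set (DecFiltration V)}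
    {ψ : DecFiltration V → E} (h : IsExpChart E X F U N ψ) :
    IsParametrizationAt X F (expMap E F) ψ := by
  have hF : F ∈ N ∩ X := by simpa only [expMap_zero] using h.map_mem 0 h.zero_mem
  have hU := h.isOpen_source.mem_nhds h.zero_mem
  have hN := h.isOpen_target.mem_nhds hF.1
  refine ⟨hF.2, expMap_zero, fun ζ hζ => analyticAt_comp_expMap ?_ (by rwa [expMap_zero]), ?_, ?_,
    h.continuousOn.continuousAt hN, h.holomorphicAt F hF.1⟩
  · filter_upwards [hU] with u hu
    exact (h.map_mem u hu).2
  · filter_upwards [hU] with u hu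
    exact h.left_inv u hu
  · filter_upwards [mem_nhdsWithin_of_mem_nhds hN, self_mem_nhdsWithin] with F' hF'N hF'X
    exact h.right_inv F' ⟨hF'N, hF'X⟩

theorem hasFDerivAt_exp_apply [CompleteSpace V] (E : Submodule ℂ (V →L[ℂ] V)) (x : V) :
    HasFDerivAt (fun u : E => NormedSpace.exp (u : V →L[ℂ] V) x)
      ((ContinuousLinearMap.apply ℂ V x).comp E.subtypeL) 0 := by
  have hexp : HasFDerivAt (NormedSpace.exp : (V →L[ℂ] V) → V →L[ℂ] V)
      (1 : (V →L[ℂ] V) →L[ℂ] (V →L[ℂ] V)) (E.subtypeL 0) := by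
    rw [map_zero]
    exact hasFDerivAt_exp_zero
  exact (ContinuousLinearMap.apply ℂ V x).hasFDerivAt.comp (0 : E)
    (HasFDerivAt.comp (f := E.subtypeL) (0 : E) hexp E.subtypeL.hasFDerivAt)

theorem IsHorizontal.mfderiv_apply_mem [FiniteDimensional ℂ V] {B S : Type*}
    [NormedAddCommGroup B] [NormedSpace ℂ B] [TopologicalSpace S] [ChartedSpace B S]
    {Φ : S → DecFiltration V} {s : S} {ψ : DecFiltration V → E} (hΦ' : IsHorizontal B Φ)
    (h : IsParametrizationAt X (Φ s) (expMap E (Φ s)) ψ) (hΦ : HolomorphicMapAt B X Φ s)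
    (v : TangentSpace 𝓘(ℂ, B) s) {p : ℤ} {x : V} (hx : x ∈ Φ s p) :
    (mfderiv 𝓘(ℂ, B) 𝓘(ℂ, E) (fun s' => ψ (Φ s')) s v : E).1 x ∈ Φ s (p - 1) := by
  have hψΦ := h.contMDiffAt_comp hΦ
  have hexp : AnalyticAt ℂ (fun u : E => NormedSpace.exp (u : V →L[ℂ] V) x) (ψ (Φ s)) :=
    ((ContinuousLinearMap.apply ℂ V x).analyticAt _).comp (EndExp.analyticAt_exp_subtype _ _)
  have hsection : ContMDiffAt 𝓘(ℂ, B) 𝓘(ℂ, V) ω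
      (fun s' => NormedSpace.exp (ψ (Φ s') : V →L[ℂ] V) x) s :=
    hexp.contDiffAt.contMDiffAt.comp s hψΦ
  have hmem : ∀ᶠ s' in 𝓝 s, NormedSpace.exp (ψ (Φ s') : V →L[ℂ] V) x ∈ Φ s' p := by
    filter_upwards [h.eventually_apply_eq hΦ] with s' hs'
    have hx' : NormedSpace.exp (ψ (Φ s') : V →L[ℂ] V) x ∈ expMap E (Φ s) (ψ (Φ s')) p :=
      ⟨x, hx, rfl⟩
    rwa [hs'] at hx'
  have hderiv := mfderiv_comp_apply_of_hasFDerivAt (k := fun s' => ψ (Φ s'))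
    (h.symm_apply.symm ▸ hasFDerivAt_exp_apply E x) (hψΦ.mdifferentiableAt (by simp)) v
  exact hderiv ▸ hΦ' s p _ hsection hmem v

end DecFiltration
end

open DecFiltration GradedPolarizationData in
theorem theorem3p13_general {V : Type*} [NormedAddCommGroup V] [NormedSpace ℂ V]
    [FiniteDimensional ℂ V] [Module ℚ V] (D : GradedPolarizationData V) (F : DecFiltration V)
    (hF : F ∈ D.M) :
    iSupIndep (fun rs : ℤ × ℤ => D.g F rs.1 rs.2) ∧
    D.q F ≤ D.lieGC ∧ IsNilpotentLieSubalgebra (D.q F) ∧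
    (∀ u : D.q F, expMap (D.q F) F u ∈ D.compactDual) ∧
    (∃ (U : Set (D.q F)) (N : Set (DecFiltration V)), 0 ∈ U ∧ F ∈ N ∧
      IsBiholomorphicOn D.M (expMap (D.q F) F) U N) ∧
    ∃ κ : D.q F ≃ₗ[ℂ] tangentSpaceAt D.M F,
      (∀ (u : D.q F) (ζ : holomorphicFunctions D.M F),
        HasDerivAt (fun t : ℂ => ζ.1 (F.map (NormedSpace.exp (t • (u : V →L[ℂ] V)))))
          ((κ u).1 ζ) 0) ∧
      ∀ (E : Type*) [NormedAddCommGroup E] [NormedSpace ℂ E]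
        (S : Type*) [TopologicalSpace S] [ChartedSpace E S] (Φ : S → DecFiltration V) (s : S),
        HolomorphicMapAt E D.M Φ s → IsHorizontal E Φ → Φ s = F →
          ∀ v : TangentSpace 𝓘(ℂ, E) s, ∃ u : D.q F, (u : V →L[ℂ] V) ∈ D.horizontal F ∧
            ∀ ζ : holomorphicFunctions D.M F,
              (mfderiv 𝓘(ℂ, E) 𝓘(ℂ, ℂ) (fun s' => ζ.1 (Φ s')) s v : ℂ) = (κ u).1 ζ := by
  obtain ⟨U, N, ψ, hψ⟩ := exists_isExpChart hF
  have hI := hF.1.isDeligneBigrading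
  have hS := firstRelation_of_mem_M hF
  have hq : D.q F ≤ D.lieGC := (q_eq hI hS).le.trans inf_le_right
  have hparam := hψ.isParametrizationAt
  have hFN : F ∈ N ∩ D.M := by simpa only [expMap_zero] using hψ.map_mem 0 hψ.zero_mem
  refine ⟨iSupIndep_g hI, hq, isNilpotentLieSubalgebra_q hI hS,
    fun u => map_exp_mem_compactDual (hq u.2) (M_subset_compactDual hF),
    ⟨U, N, hψ.zero_mem, hFN.1, hψ.isBiholomorphicOn⟩, hparam.tangentEquiv,
    hparam.hasDerivAt_tangentMap, ?_⟩
  rintro E _ _ S _ _ Φ s hΦ hhorizontal rfl v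
  exact ⟨_, mem_horizontal hI hS (Subtype.mem _) fun p x hx =>
    hhorizontal.mfderiv_apply_mem hparam hΦ v hx, hparam.mfderiv_comp_eq_tangentEquiv hΦ v⟩

theorem theorem3p13 {V : Type*} [NormedAddCommGroup V] [NormedSpace ℂ V] [FiniteDimensional ℂ V]
    [Module ℚ V] (D : GradedPolarizationData V) (F : DecFiltration V) (hF : F ∈ D.M) :
    -- `q_F` is a direct sum and a nilpotent subalgebra of `Lie(G_ℂ)`
    iSupIndep (fun rs : ℤ × ℤ => D.g F rs.1 rs.2) ∧
    D.q F ≤ D.lieGC ∧ IsNilpotentLieSubalgebra (D.q F) ∧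
    -- the map `u ↦ exp(u).F` takes values in the compact dual, and restricts to a biholomorphism
    -- from a neighborhood of zero in `q_F` to a neighborhood of `F` in `M`
    (∀ u : D.q F, F.map (NormedSpace.exp (u : V →L[ℂ] V)) ∈ D.compactDual) ∧
    (∃ (U : Set (D.q F)) (N : Set (DecFiltration V)), 0 ∈ U ∧ F ∈ N ∧
      DecFiltration.IsBiholomorphicOn D.M
        (fun u : D.q F => F.map (NormedSpace.exp (u : V →L[ℂ] V))) U N) ∧
    -- the induced `ℂ`-linear isomorphism `κ` of `q_F` with the tangent space `T_F(M)`
    ∃ κ : D.q F ≃ₗ[ℂ] DecFiltration.tangentSpaceAt D.M F,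
      (∀ (u : D.q F) (ζ : DecFiltration.holomorphicFunctions D.M F),
        HasDerivAt (fun t : ℂ => ζ.1 (F.map (NormedSpace.exp (t • (u : V →L[ℂ] V)))))
          ((κ u).1 ζ) 0) ∧
      -- the derivative of a holomorphic, horizontal map `Φ : S → M` takes values in `T^horiz(M)`
      ∀ (E : Type*) [NormedAddCommGroup E] [NormedSpace ℂ E] [FiniteDimensional ℂ E]
        (S : Type*) [TopologicalSpace S] [ChartedSpace E S] [IsManifold 𝓘(ℂ, E) ω S]
        (Φ : S → DecFiltration V),
        (∀ s, DecFiltration.HolomorphicMapAt E D.M Φ s) →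
        DecFiltration.IsHorizontal E Φ →
        ∀ s, Φ s = F → ∀ v : TangentSpace 𝓘(ℂ, E) s,
          ∃ u : D.q F, (u : V →L[ℂ] V) ∈ D.horizontal F ∧
            ∀ ζ : DecFiltration.holomorphicFunctions D.M F,
              (mfderiv 𝓘(ℂ, E) 𝓘(ℂ, ℂ) (fun s' => ζ.1 (Φ s')) s v : ℂ) = (κ u).1 ζ := by
  obtain ⟨hdirect, hq, hnilpotent, hdual, hchart, κ, hκ, hΦ⟩ := theorem3p13_general D F hF
  exact ⟨hdirect, hq, hnilpotent, hdual, hchart, κ, hκ, fun E _ _ _ S _ _ _ Φ hhol hhor s =>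
    hΦ E S Φ s (hhol s) hhor⟩
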